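/- **Setting.** Fix an architecture on $n$ qubits with $d$ layers: in each layer every qubit belongs to exactly one single-qubit position or two-qubit position (no geometric locality is assumed). In a circuit $\mathcal C$ on it, every two-qubit position holds a Clifford gate and every single-qubit position holds a Clifford gate or the gate $T=\mathrm{diag}(1,e^{i\pi/4})$; let $U_k$ be the unitary of layer $k$. For $0\le Q\le 1$, a probability distribution on such circuits belongs to the *random Clifford+$T$ model with parameter $Q$* if, for every single-qubit position, the conditional probability that it holds a $T$ gate, given the gates at all other positions, is at most $Q$ (for example: every single-qubit position tosses its own independent coin, which permits a $T$ gate there with probability $Q$, and no gate elsewhere depends on that coin). The noisy circuit is $\Phi_{\mathcal C,p}=(T_p\circ\mathcal U_d)\circ\dots\circ(T_p\circ\mathcal U_1)\circ T_p$, where $\mathcal U_k(\rho)=U_k\rho U_k^\dagger$, $T_p=\mathcal N_p^{\otimes n}$ and $\mathcal N_p(\rho)=(1-p)\rho+p\,\mathrm{tr}(\rho)I/2$. Let $\rho_0$ be a product state and $O=\sum_{k=1}^{N}a_kO_k$ with known $a_k\in\mathbb R$ and known Pauli strings $O_k$, and put $\langle O\rangle_{\rm err}=\mathrm{tr}(O\,\Phi_{\mathcal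 C,p}(\rho_0))$. For a Pauli path $s=(s_0,\dots,s_d)$ of $n$-qubit Pauli strings let $|s|=\sum_k|s_k|$ be the sum of the Hamming weights, $$f(s)=\frac{1}{2^{n(d+1)}}\,\mathrm{tr}(Os_d)\prod_{k=1}^{d}\mathrm{tr}(s_kU_ks_{k-1}U_k^\dagger)\;\mathrm{tr}(s_0\rho_0),\qquad \langle O\rangle_\ell=\sum_{|s|\le \ell}f(s)(1-p)^{|s|}.$$ Algorithms are programs of a real random access machine (one step per elementary instruction; addition, subtraction and comparison of natural numbers; $+,-,\times,\div,\sqrt{\ }$ and comparison of reals). The input consists of $n,d,N,p,Q,\epsilon,\delta$, the circuit (each Clifford gate through its action by conjugation on Pauli operators), the Bloch vectors of $\rho_0$, the $a_k$, and the $O_k$ (letters, weight and list of the qubits in the support). **Theorem.** One has $1-\frac1{1+Q}=\Theta(Q)$ as $Q\to0^+$. There are a single program and a constant $C$ such that for all $Q\in[0,1]$ and all $p$ with $1-\frac{1}{1+Q}<p\le 1$ there is $K\in\mathbb N$ (depending only on $p,Q$) such that for all $n,d$, every architecture, every distribution in the random Clifford+$T$ model with parameter $Q$, every product state $\rho_0$,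 every observable $O$ as above, every $\epsilon>0$ and every $0<\delta<1$ the following holds. 1. On every circuit the program halts, and it outputs $\langle O\rangle_\ell$ for some cut-off $\ell$ that is the same for all circuits on the architecture. 2. With probability at least $1-\delta$ over the random circuit $\mathcal C$, the output differs from $\langle O\rangle_{\rm err}$ by at most $\epsilon\|O\|$ and the running time is at most $K\,(n+N+1/\epsilon+1/\delta)^K$. In particular, this is $\mathrm{poly}(n,1/\epsilon,1/\delta)$ when $N=O(\mathrm{poly}(n))$. 3. If moreover $p>Q$, $n\ge2$, $d\ge1$, $N\ge1$ and $\epsilon\le1$, the average running time over the random circuit is at most $$C\,N\left(\frac{nNd}{\epsilon\delta}\right)^{\frac{Q}{p-Q}}\frac{\log\frac{nNd}{\delta\epsilon}}{p-Q}.$$ -/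

import Mathlib

open Matrix
open scoped Kronecker ENNReal Topology ComplexOrder

namespace PauliPath

noncomputable section

/-! ### Pauli operators -/

/-- The single-qubit Pauli matrices; the letters `0, 1, 2, 3` stand for `I, X, Y, Z`. -/
def pauli : Fin 4 → Matrix (Fin 2) (Fin 2) ℂ :=
  ![!![1, 0; 0, 1], !![0, 1; 1, 0], !![0, -Complex.I; Complex.I, 0], !![1, 0; 0, -1]]

/-- Computational basis labels of `n` qubits. -/
abbrev Basis (n : ℕ) := Fin n → Fin 2

/-- Operators on `n` qubits. -/
abbrev Op (n : ℕ) := Matrix (Basis n) (Basis n) ℂ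

/-- A Pauli string on `n` qubits. -/
abbrev PauliString (n : ℕ) := Fin n → Fin 4

/-- The tensor product of single-qubit operators. -/
def tensor {n : ℕ} (M : Fin n → Matrix (Fin 2) (Fin 2) ℂ) : Op n :=
  fun x y => ∏ i, M i (x i) (y i)

/-- The operator of a Pauli string. -/
def PauliString.op {n : ℕ} (s : PauliString n) : Op n := tensor fun i => pauli (s i)

/-- The qubits on which a Pauli string is not the identity. -/
def PauliString.support {n : ℕ} (s : PauliString n) : Finset (Fin n) :=
  Finset.univ.filter fun i => s i ≠ 0

/-- The Hamming weight of a Pauli string. -/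
def PauliString.weight {n : ℕ} (s : PauliString n) : ℕ := s.support.card

/-! ### Gates, architectures, circuits -/

/-- The sign `-1` for `true` and `1` for `false`. -/
def sign (b : Bool) : ℂ := if b then -1 else 1

/-- A single-qubit Clifford gate: a unitary `U` such that `U† P U` is a Pauli operator up to sign,
for every Pauli operator `P`. The fields `img` and `neg` are determined by `U`. -/
structure Clifford1 where
  U : Matrix (Fin 2) (Fin 2) ℂ
  unitary : U ∈ Matrix.unitaryGroup (Fin 2) ℂ
  img : Fin 4 → Fin 4
  neg : Fin 4 → Bool
  conj : ∀ P, Uᴴ * pauli P * U = sign (neg P) • pauli (img P)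

/-- A two-qubit Clifford gate: a unitary `U` such that `U† (P ⊗ P') U` is a two-qubit Pauli
operator up to sign, for all `P`, `P'`. The fields `img` and `neg` are determined by `U`. -/
structure Clifford2 where
  U : Matrix (Fin 2 × Fin 2) (Fin 2 × Fin 2) ℂ
  unitary : U ∈ Matrix.unitaryGroup (Fin 2 × Fin 2) ℂ
  img : Fin 4 → Fin 4 → Fin 4 × Fin 4
  neg : Fin 4 → Fin 4 → Bool
  conj : ∀ P P', Uᴴ * (pauli P ⊗ₖ pauli P') * U =
    sign (neg P P') • (pauli (img P P').1 ⊗ₖ pauli (img P P').2)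

/-- What may stand at a single-qubit position: a Clifford gate or the `T` gate. -/
inductive Gate1 where
  | clifford (g : Clifford1)
  | T

/-- The unitary of a single-qubit gate; `T = diag(1, exp(iπ/4))`. -/
def Gate1.U : Gate1 → Matrix (Fin 2) (Fin 2) ℂ
  | .clifford g => g.U
  | .T => !![1, 0; 0, Complex.exp (Complex.I * (Real.pi / 4))]

/-- An architecture with `n` qubits and `d` layers. In layer `k` qubit `i` is in a two-qubit
position together with `partner k i` if that is different from `i`, and in a single-qubit position
otherwise (an idle qubit is a single-qubit position that holds the identity, a Clifford gate). -/
structure Architecture (n d : ℕ) where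
  partner : Fin d → Fin n → Fin n
  invol : ∀ k i, partner k (partner k i) = i

/-- The single-qubit positions. -/
abbrev Architecture.Pos1 {n d : ℕ} (A : Architecture n d) :=
  {x : Fin d × Fin n // A.partner x.1 x.2 = x.2}

/-- The two-qubit positions, each named by its layer and the smaller one of its two qubits. -/
abbrev Architecture.Pos2 {n d : ℕ} (A : Architecture n d) :=
  {x : Fin d × Fin n // x.2 < A.partner x.1 x.2}

/-- A Clifford+`T` circuit on an architecture. -/
structure Circuit {n d : ℕ} (A : Architecture n d) where
  one : A.Pos1 → Gate1
  two : A.Pos2 → Clifford2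

/-- The unitary of layer `k`: the tensor product of its gates. -/
def Circuit.layer {n d : ℕ} {A : Architecture n d} (c : Circuit A) (k : Fin d) : Op n :=
  fun x y => ∏ i : Fin n,
    if h : A.partner k i = i then (c.one ⟨(k, i), h⟩).U (x i) (y i)
    else if h : i < A.partner k i then
      (c.two ⟨(k, i), h⟩).U (x i, x (A.partner k i)) (y i, y (A.partner k i))
    else 1

/-! ### Noise and expectation values -/

/-- Depolarizing noise of strength `p` on qubit `i`: `M ↦ (1-p) M + p (tr_i M) ⊗ (I/2)_i`. -/
def depolarize {n : ℕ} (p : ℝ) (i : Fin n) (M : Op n) : Op n := fun x y =>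
  (1 - p) * M x y +
    p * (if x i = y i then
      (∑ b : Fin 2, M (Function.update x i b) (Function.update y i b)) / 2 else 0)

/-- A layer of noise: depolarizing noise of strength `p` on every qubit. -/
def noise {n : ℕ} (p : ℝ) (M : Op n) : Op n :=
  (List.finRange n).foldr (fun i M => depolarize p i M) M

/-- The noisy circuit as a channel: noise before the first layer and after every layer. -/
def Circuit.noisy {n d : ℕ} {A : Architecture n d} (c : Circuit A) (p : ℝ) (ρ : Op n) : Op n :=
  Fin.foldl d (fun M k => noise p (c.layer k * M * (c.layer k)ᴴ)) (noise p ρ)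

/-- The noisy expectation value `tr(O Φ(ρ))`. -/
def Circuit.noisyValue {n d : ℕ} {A : Architecture n d} (c : Circuit A) (p : ℝ) (ρ O : Op n) : ℂ :=
  (O * c.noisy p ρ).trace

/-- A single-qubit density matrix. -/
structure QubitState where
  mat : Matrix (Fin 2) (Fin 2) ℂ
  pos : mat.PosSemidef
  trace_one : mat.trace = 1

/-- The product state of `n` single-qubit states. -/
def productState {n : ℕ} (ρ : Fin n → QubitState) : Op n := tensor fun i => (ρ i).mat

/-- The observable `∑ k, a k • O k` for real coefficients `a k` and Pauli strings `O k`. -/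
def observable {n N : ℕ} (a : Fin N → ℝ) (O : Fin N → PauliString n) : Op n :=
  ∑ k, (a k : ℂ) • (O k).op

/-- The operator norm (with respect to the Euclidean norm). -/
def opNorm {n : ℕ} (M : Op n) : ℝ := ‖Matrix.toEuclideanCLM (𝕜 := ℂ) (n := Basis n) M‖

/-! ### Pauli paths -/

/-- A Pauli path `(s_0, …, s_d)`. -/
abbrev Path (n d : ℕ) := Fin (d + 1) → PauliString n

/-- The weight of a Pauli path. -/
def Path.weight {n d : ℕ} (s : Path n d) : ℕ := ∑ k, (s k).weight

/-- The contribution `f(s) = 2^{-n(d+1)} tr(O s_d) ∏ k, tr(s_k U_k s_{k-1} U_k†) tr(s_0 ρ)`. -/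
def Circuit.pathValue {n d : ℕ} {A : Architecture n d} (c : Circuit A) (ρ O : Op n)
    (s : Path n d) : ℂ :=
  1 / 2 ^ (n * (d + 1)) * (O * (s (Fin.last d)).op).trace *
    (∏ k : Fin d, ((s k.succ).op * c.layer k * (s k.castSucc).op * (c.layer k)ᴴ).trace) *
    ((s 0).op * ρ).trace

/-- The Pauli-path expansion of the noisy expectation value, truncated at weight `l`. -/
def Circuit.truncatedValue {n d : ℕ} {A : Architecture n d} (c : Circuit A) (p : ℝ) (ρ O : Op n)
    (l : ℕ) : ℂ :=
  ∑ s : Path n d with s.weight ≤ l, c.pathValue ρ O s * (1 - p) ^ s.weight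

/-! ### The random model -/

/-- `c'` has the same gates as `c` at all positions except possibly at `x`. -/
def AgreeOff {n d : ℕ} {A : Architecture n d} (x : A.Pos1) (c c' : Circuit A) : Prop :=
  (∀ y, y ≠ x → c'.one y = c.one y) ∧ c'.two = c.two

/-- The random Clifford+`T` model with parameter `Q` on a fixed architecture: at every single-qubit
position, the probability that a `T` gate is placed there is at most `Q`, whatever gates stand
at the other positions (conditional probabilities are multiplied out). For instance, every
single-qubit position tosses its own independent coin, which allows the use of a `T` gate there
with probability `Q`, and all other choices are made without looking at that coin. -/
def IsRandomModel {n d : ℕ} {A : Architecture n d} (Q : ℝ) (μ : PMF (Circuit A)) : Prop :=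
  ∀ (x : A.Pos1) (c : Circuit A),
    μ.toOuterMeasure {c' | AgreeOff x c c' ∧ c'.one x = Gate1.T} ≤
      ENNReal.ofReal Q * μ.toOuterMeasure {c' | AgreeOff x c c'}

/-! ### Real random access machines

The memory consists of finitely many arrays of natural numbers and of real numbers, with up to
three indices. A program is a fixed finite text, written with assignments, sequencing, case
distinctions and loops. Every assignment and every evaluation of a test takes one step; as the
expressions in them are part of the program text, this counts the operations of a run up to a
constant factor. Natural numbers can be added, subtracted and compared; real numbers can be added,
subtracted, multiplied, divided and compared, and square roots can be taken. -/

/-- The memory; array `a` has the cells `nat a i j k` and `real a i j k`. -/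
@[ext] structure Memory where
  nat : ℕ → ℕ → ℕ → ℕ → ℕ
  real : ℕ → ℕ → ℕ → ℕ → ℝ

/-- Expressions for natural numbers (`sub` is truncated subtraction). -/
inductive NExpr where
  | lit (m : ℕ)
  | get (a : ℕ) (i j k : NExpr)
  | add (e f : NExpr)
  | sub (e f : NExpr)

/-- Value of an expression. -/
def NExpr.eval (s : Memory) : NExpr → ℕ
  | .lit m => m
  | .get a i j k => s.nat a (i.eval s) (j.eval s) (k.eval s)
  | .add e f => e.eval s + f.eval s
  | .sub e f => e.eval s - f.eval s

/-- Expressions for real numbers. -/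
inductive RExpr where
  | ofNat (e : NExpr)
  | get (a : ℕ) (i j k : NExpr)
  | add (e f : RExpr)
  | sub (e f : RExpr)
  | mul (e f : RExpr)
  | div (e f : RExpr)
  | sqrt (e : RExpr)

/-- Value of an expression. -/
def RExpr.eval (s : Memory) : RExpr → ℝ
  | .ofNat e => (e.eval s : ℝ)
  | .get a i j k => s.real a (i.eval s) (j.eval s) (k.eval s)
  | .add e f => e.eval s + f.eval s
  | .sub e f => e.eval s - f.eval s
  | .mul e f => e.eval s * f.eval s
  | .div e f => e.eval s / f.eval s
  | .sqrt e => Real.sqrt (e.eval s)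

/-- Tests. -/
inductive Test where
  | natLe (e f : NExpr)
  | realLe (e f : RExpr)
  | not (b : Test)
  | and (b c : Test)

/-- Truth of a test. -/
def Test.Holds (s : Memory) : Test → Prop
  | .natLe e f => e.eval s ≤ f.eval s
  | .realLe e f => e.eval s ≤ f.eval s
  | .not b => ¬ b.Holds s
  | .and b c => b.Holds s ∧ c.Holds s

/-- Programs. -/
inductive Program where
  | skip
  | setNat (a : ℕ) (i j k : NExpr) (e : NExpr)
  | setReal (a : ℕ) (i j k : NExpr) (e : RExpr)
  | seq (P R : Program)
  | cond (b : Test) (P R : Program)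
  | loop (b : Test) (P : Program)

/-- Write a natural number to a cell. -/
def Memory.writeNat (s : Memory) (a i j k v : ℕ) : Memory :=
  { s with nat := fun a' i' j' k' =>
      if a' = a ∧ i' = i ∧ j' = j ∧ k' = k then v else s.nat a' i' j' k' }

/-- Write a real number to a cell. -/
def Memory.writeReal (s : Memory) (a i j k : ℕ) (v : ℝ) : Memory :=
  { s with real := fun a' i' j' k' =>
      if a' = a ∧ i' = i ∧ j' = j ∧ k' = k then v else s.real a' i' j' k' }

/-- `Runs P s s' t`: program `P`, started with memory `s`, halts after `t` steps with
memory `s'`. The program `loop b P` repeats `P` as long as the test `b` holds. -/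
inductive Runs : Program → Memory → Memory → ℕ → Prop
  | skip (s : Memory) : Runs .skip s s 1
  | setNat (s : Memory) (a : ℕ) (i j k e : NExpr) :
      Runs (.setNat a i j k e) s
        (s.writeNat a (i.eval s) (j.eval s) (k.eval s) (e.eval s)) 1
  | setReal (s : Memory) (a : ℕ) (i j k : NExpr) (e : RExpr) :
      Runs (.setReal a i j k e) s
        (s.writeReal a (i.eval s) (j.eval s) (k.eval s) (e.eval s)) 1
  | seq {P R : Program} {s s' s'' : Memory} {t t' : ℕ} :
      Runs P s s' t → Runs R s' s'' t' → Runs (.seq P R) s s'' (t + t')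
  | cond_true {b : Test} {P R : Program} {s s' : Memory} {t : ℕ} :
      b.Holds s → Runs P s s' t → Runs (.cond b P R) s s' (t + 1)
  | cond_false {b : Test} {P R : Program} {s s' : Memory} {t : ℕ} :
      ¬ b.Holds s → Runs R s s' t → Runs (.cond b P R) s s' (t + 1)
  | loop_done {b : Test} {P : Program} {s : Memory} :
      ¬ b.Holds s → Runs (.loop b P) s s 1
  | loop_step {b : Test} {P : Program} {s s' s'' : Memory} {t t' : ℕ} :
      b.Holds s → Runs P s s' t → Runs (.loop b P) s' s'' t' →
        Runs (.loop b P) s s'' (t + t' + 1)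

/-! ### The input of the machine -/

/-- A family indexed by `Fin m`, extended by zero to all natural numbers. -/
def pad {α : Type} [Zero α] {m : ℕ} (f : Fin m → α) : ℕ → α :=
  fun i => if h : i < m then f ⟨i, h⟩ else 0

/-- Is there a `T` gate on qubit `i` in layer `k`? -/
def Circuit.isT {n d : ℕ} {A : Architecture n d} (c : Circuit A) (k : Fin d) (i : Fin n) : ℕ :=
  if h : A.partner k i = i then
    match c.one ⟨(k, i), h⟩ with
    | .clifford _ => 0
    | .T => 1
  else 0

/-- The Clifford gate at single-qubit position `(k, i)`: the letter of `U† P U` and its sign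
(`1` for a minus sign); zero if there is no such gate. -/
def Circuit.table1 {n d : ℕ} {A : Architecture n d} (c : Circuit A) (k : Fin d) (i : Fin n)
    (P : Fin 4) : ℕ × ℕ :=
  if h : A.partner k i = i then
    match c.one ⟨(k, i), h⟩ with
    | .clifford g => ((g.img P : ℕ), (g.neg P).toNat)
    | .T => 0
  else 0

/-- The Clifford gate at the two-qubit position with smaller qubit `i` in layer `k`: the two letters
of `U† (P ⊗ P') U` (smaller qubit first) and its sign; zero if there is no such gate. Here
`P` and `P'` are the quotient and the remainder of `m` upon division by `4`. -/
def Circuit.table2 {n d : ℕ} {A : Architecture n d} (c : Circuit A) (k : Fin d) (i : Fin n)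
    (m : Fin 16) : ℕ × ℕ × ℕ :=
  if h : i < A.partner k i then
    let g := c.two ⟨(k, i), h⟩
    let P : Fin 4 := ⟨m / 4, by omega⟩
    let P' : Fin 4 := ⟨m % 4, by omega⟩
    (((g.img P P').1 : ℕ), ((g.img P P').2 : ℕ), (g.neg P P').toNat)
  else 0

/-- The natural numbers of the input: the sizes `n`, `d`, `N`; the architecture; the gates, each
given by its kind and its action on Pauli operators; and, for each Pauli string of the
observable, its weight, the list of the qubits in its support, and its letters. -/
def inputNat {n d N : ℕ} {A : Architecture n d} (c : Circuit A) (O : Fin N → PauliString n) :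
    ℕ → ℕ → ℕ → ℕ → ℕ
  | 0, i, _, _ => pad ![n, d, N] i
  | 1, k, i, _ => pad (fun k => pad (fun i => (A.partner k i : ℕ)) i) k
  | 2, k, i, _ => pad (fun k => pad (fun i => c.isT k i) i) k
  | 3, k, i, P => pad (fun k => pad (fun i => pad (fun P => (c.table1 k i P).1) P) i) k
  | 4, k, i, P => pad (fun k => pad (fun i => pad (fun P => (c.table1 k i P).2) P) i) k
  | 5, k, i, m => pad (fun k => pad (fun i => pad (fun m => (c.table2 k i m).1) m) i) k
  | 6, k, i, m => pad (fun k => pad (fun i => pad (fun m => (c.table2 k i m).2.1) m) i) k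
  | 7, k, i, m => pad (fun k => pad (fun i => pad (fun m => (c.table2 k i m).2.2) m) i) k
  | 8, r, _, _ => pad (fun r => (O r).weight) r
  | 9, r, j, _ => pad (fun r => (((O r).support.sort (· ≤ ·)).map Fin.val).getD j 0) r
  | 10, r, i, _ => pad (fun r => pad (fun i => (O r i : ℕ)) i) r
  | _, _, _, _ => 0

/-- The real numbers of the input: the parameters `p`, `Q`, `ε`, `δ`, the coefficients of the
observable, and the Bloch vectors `tr(P ρ_i)` of the initial state. -/
def inputReal {n N : ℕ} (p Q ε δ : ℝ) (ρ : Fin n → QubitState) (a : Fin N → ℝ) :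
    ℕ → ℕ → ℕ → ℕ → ℝ
  | 1, i, _, _ => pad ![p, Q, ε, δ] i
  | 2, r, _, _ => pad a r
  | 3, i, P, _ => pad (fun i => pad (fun P => (pauli P * (ρ i).mat).trace.re) P) i
  | _, _, _, _ => 0

/-- The initial memory: the input, and zero in all other cells. -/
def input {n d N : ℕ} {A : Architecture n d} (p Q ε δ : ℝ) (c : Circuit A)
    (ρ : Fin n → QubitState) (a : Fin N → ℝ) (O : Fin N → PauliString n) : Memory :=
  ⟨inputNat c O, inputReal p Q ε δ ρ a⟩

/-- The output cell. -/
def Memory.output (s : Memory) : ℝ := s.real 0 0 0 0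

end

end PauliPath

open PauliPath

/-!
The algorithm sums the Pauli paths of weight at most `ℓ` in the Heisenberg picture. A Pauli string
of the observable is conjugated through the layers from the last to the first. A Clifford gate
maps a Pauli operator to a Pauli operator up to sign, and a `T` gate does so as well, except that
`T† X T = (X - Y) / √2` and `T† Y T = (X + Y) / √2`. So the paths with nonzero contribution
that start from one string are the leaves of a binary tree that branches only at `T` gates on the
support of the current string, and noise damps every unit of weight by `1 - p`. The tree `simTop`
describes this computation, and `sum_simTop` says that its leaves add up to the truncated sum.

*Expectations.* Let a branch be cut off as soon as its weight exceeds `w`, and let every unit of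
weight contribute a factor `x` to its branch. The expectation over the random circuit of the
resulting sum `branchSum` is at most `(x (1 + Q))^w` (`expect_branchSum_le`): the string in front of
layer `k` depends only on layers `k` and later, and given these and the other gates of
layer `k - 1`, each qubit of its support is met by a `T` gate with probability at most `Q`, so
that it multiplies the expected number of branches by at most `1 + Q` while using up one unit of
weight. With `x = 1` this bounds the number of leaves (`count_simTop_le`) by `(1 + Q)^ℓ`. With
`x = 1 - p` it bounds the error made for one Pauli string (`enorm_sub_trunc_le`) by `r^ℓ`, where
`r = (1 - p) (1 + Q)`: what is lost at a cut branch is a Pauli expectation value of a noisy state,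
which noise has damped by the weight of the string, and the coefficients at `T` gates are
at most `1`. The assumption on `p` says that `r < 1`.

*Error and cut-off.* The coefficient of a Pauli string in an observable is at most the operator
norm of the observable (`abs_coeff_le`), so the expected error is at most `N r^ℓ ‖O‖`
(`expect_error_le`). The cut-off is the smallest `ℓ` with `2 N r^ℓ ≤ ε δ`. By Markov's inequality
(`one_sub_le_measure`) the error exceeds `ε ‖O‖` with probability at most `δ / 2`, and the running
time exceeds `2 / δ` times the bound for its expectation with probability at most `δ / 2`. As `ℓ`
is minimal, it is logarithmic in `N / (ε δ)`, and `(1 + Q)^ℓ` is polynomially bounded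
(`poly_bound`), with the explicit exponent `Q / (p - Q)` if `p > Q`, because `r ≤ exp (-(p - Q))`
(`average_bound`).

*The program.* The machine has no recursion, so a leaf of the tree is addressed by the bits of
its branching decisions, and each leaf is computed from scratch in `O(ℓ + 1)` steps
(`simulate_spec`), independently of `n` and `d`: a string is stored as the list of its
support together with an array of letters, each level costs time proportional to the weight of the
string, and the string of weight zero ends the simulation at once. Every simulation uses new
memory, which need not be cleared. Backtracking over the bits visits all leaves
(`backLoop_subtree`), and `main_spec` bounds the total time by a constant times
`(ℓ + 1) (1 + number of leaves)`.
-/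

namespace PauliPath

/-! ### Pauli matrices and tensor products -/

theorem pauli_zero : pauli 0 = 1 := by
  ext i j; fin_cases i <;> fin_cases j <;> simp [pauli]

theorem pauli_conjTranspose (P : Fin 4) : (pauli P)ᴴ = pauli P := by
  ext i j; fin_cases P <;> fin_cases i <;> fin_cases j <;> simp [pauli]

theorem pauli_mul_self (P : Fin 4) : pauli P * pauli P = 1 := by
  fin_cases P <;> ext i j <;> fin_cases i <;> fin_cases j <;>
    simp [pauli, Matrix.mul_apply, Fin.sum_univ_two]

theorem trace_pauli_mul (P P' : Fin 4) :
    (pauli P * pauli P').trace = if P = P' then 2 else 0 := by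
  fin_cases P <;> fin_cases P' <;>
    simp [pauli, Matrix.trace_fin_two] <;> norm_num

/-- Pauli twirling: averaging over all Pauli conjugations keeps only the identity component. -/
theorem sum_pauli_conj (R : Fin 4) :
    ∑ P, pauli P * pauli R * pauli P = if R = 0 then (4 : ℂ) • pauli R else 0 := by
  fin_cases R <;> ext i j <;> fin_cases i <;> fin_cases j <;>
    simp [pauli, Matrix.mul_apply, Fin.sum_univ_succ, Matrix.sum_apply] <;> norm_num

theorem sum_pauli_entries (a b c d : Fin 2) :
    ∑ P, pauli P a b * pauli P c d = if a = d ∧ b = c then 2 else 0 := by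
  fin_cases a <;> fin_cases b <;> fin_cases c <;> fin_cases d <;>
    simp [pauli, Fin.sum_univ_succ] <;> norm_num

variable {n : ℕ}

theorem tensor_mul (M M' : Fin n → Matrix (Fin 2) (Fin 2) ℂ) :
    tensor M * tensor M' = tensor fun i => M i * M' i := by
  ext x y
  simp only [tensor, Matrix.mul_apply]
  rw [Fintype.prod_sum]
  exact Finset.sum_congr rfl fun z _ => Finset.prod_mul_distrib.symm

theorem trace_tensor (M : Fin n → Matrix (Fin 2) (Fin 2) ℂ) :
    (tensor M).trace = ∏ i, (M i).trace := by
  simp only [tensor, Matrix.trace, Matrix.diag]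
  rw [Fintype.prod_sum]

theorem tensor_conjTranspose (M : Fin n → Matrix (Fin 2) (Fin 2) ℂ) :
    (tensor M)ᴴ = tensor fun i => (M i)ᴴ := by
  ext x y
  simp [tensor, Matrix.conjTranspose_apply]

theorem tensor_one : tensor (fun _ : Fin n => (1 : Matrix (Fin 2) (Fin 2) ℂ)) = 1 := by
  ext x y
  simp only [tensor, Matrix.one_apply]
  by_cases h : x = y
  · simp [h]
  · rw [if_neg h]
    obtain ⟨i, hi⟩ := Function.ne_iff.mp h
    exact Finset.prod_eq_zero (Finset.mem_univ i) (by simp [hi])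

theorem tensor_update_apply (M : Fin n → Matrix (Fin 2) (Fin 2) ℂ) (i : Fin n)
    (B : Matrix (Fin 2) (Fin 2) ℂ) (x y : Basis n) :
    tensor (Function.update M i B) x y =
      B (x i) (y i) * ∏ j ∈ Finset.univ.erase i, M j (x j) (y j) := by
  rw [tensor, ← Finset.mul_prod_erase _ _ (Finset.mem_univ i), Function.update_self]
  congr 1
  exact Finset.prod_congr rfl fun j hj => by rw [Function.update_of_ne (Finset.ne_of_mem_erase hj)]

theorem tensor_update_smul (M : Fin n → Matrix (Fin 2) (Fin 2) ℂ) (i : Fin n) (a : ℂ)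
    (B : Matrix (Fin 2) (Fin 2) ℂ) :
    tensor (Function.update M i (a • B)) = a • tensor (Function.update M i B) := by
  ext x y
  simp [tensor_update_apply, mul_assoc]

theorem tensor_update_add (M : Fin n → Matrix (Fin 2) (Fin 2) ℂ) (i : Fin n)
    (B B' : Matrix (Fin 2) (Fin 2) ℂ) :
    tensor (Function.update M i (B + B')) =
      tensor (Function.update M i B) + tensor (Function.update M i B') := by
  ext x y
  simp [tensor_update_apply, add_mul]

theorem tensor_update_sum {κ : Type*} [Fintype κ] (M : Fin n → Matrix (Fin 2) (Fin 2) ℂ)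
    (i : Fin n) (B : κ → Matrix (Fin 2) (Fin 2) ℂ) :
    tensor (Function.update M i (∑ k, B k)) = ∑ k, tensor (Function.update M i (B k)) := by
  ext x y
  simp [tensor_update_apply, Matrix.sum_apply, Finset.sum_mul]

/-! ### Pauli strings -/

theorem PauliString.op_conjTranspose (s : PauliString n) : s.opᴴ = s.op := by
  simp [PauliString.op, tensor_conjTranspose, pauli_conjTranspose]

theorem PauliString.op_mul_self (s : PauliString n) : s.op * s.op = 1 := by
  simp [PauliString.op, tensor_mul, pauli_mul_self, tensor_one]

theorem PauliString.op_zero : PauliString.op (0 : PauliString n) = 1 := by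
  simp [PauliString.op, pauli_zero, tensor_one]

theorem PauliString.trace_op_mul (s s' : PauliString n) :
    (s.op * s'.op).trace = if s = s' then 2 ^ n else 0 := by
  simp only [PauliString.op, tensor_mul, trace_tensor, trace_pauli_mul]
  by_cases h : s = s'
  · simp [h]
  · rw [if_neg h]
    obtain ⟨i, hi⟩ := Function.ne_iff.mp h
    exact Finset.prod_eq_zero (Finset.mem_univ i) (by simp [hi])

theorem PauliString.weight_eq_zero {s : PauliString n} : s.weight = 0 ↔ s = 0 := by
  simp [PauliString.weight, PauliString.support, Finset.filter_eq_empty_iff, funext_iff]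

theorem PauliString.mem_support {s : PauliString n} {i : Fin n} : i ∈ s.support ↔ s i ≠ 0 := by
  simp [PauliString.support]

/-- The Pauli operator `P` on qubit `i`. -/
def onePauli (i : Fin n) (P : Fin 4) : Op n := PauliString.op (Function.update 0 i P)

theorem onePauli_eq (i : Fin n) (P : Fin 4) :
    onePauli i P = tensor (Function.update (fun _ => 1) i (pauli P)) := by
  unfold onePauli PauliString.op
  congr 1
  ext1 j
  by_cases h : j = i
  · subst h; simp
  · simp [Function.update_of_ne h, pauli_zero]

theorem onePauli_mul_apply (i : Fin n) (P : Fin 4) (M : Op n) (x y : Basis n) :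
    (onePauli i P * M) x y = ∑ b, pauli P (x i) b * M (Function.update x i b) y := by
  rw [Matrix.mul_apply]
  have : ∀ b : Fin 2, ∀ z : Basis n, z = Function.update x i b →
      onePauli i P x z = pauli P (x i) b := by
    rintro b z rfl
    rw [onePauli_eq, tensor_update_apply, Function.update_self]
    rw [Finset.prod_eq_one, mul_one]
    intro j hj
    rw [Function.update_of_ne (Finset.ne_of_mem_erase hj)]
    simp
  rw [← Finset.sum_subset (Finset.subset_univ (Finset.univ.image fun b => Function.update x i b)),
    Finset.sum_image (fun a _ b _ h => by simpa using congrFun h i)]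
  · exact Finset.sum_congr rfl fun b _ => by rw [this b _ rfl]
  · intro z _ hz
    have : ∃ j ≠ i, x j ≠ z j := by
      by_contra! h
      refine hz (Finset.mem_image.2 ⟨z i, Finset.mem_univ _, ?_⟩)
      ext1 j
      by_cases hj : j = i
      · subst hj; simp
      · rw [Function.update_of_ne hj, h j hj]
    obtain ⟨j, hj, hxz⟩ := this
    rw [onePauli_eq, tensor_update_apply,
      Finset.prod_eq_zero (Finset.mem_erase.2 ⟨hj, Finset.mem_univ j⟩) (by simp [hxz])]
    simp

theorem mul_onePauli_apply (i : Fin n) (P : Fin 4) (M : Op n) (x y : Basis n) :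
    (M * onePauli i P) x y = ∑ b, M x (Function.update y i b) * pauli P b (y i) := by
  have h := congrFun (congrFun (congrArg conjTranspose
    (Matrix.conjTranspose_mul M (onePauli i P))) x) y
  rw [conjTranspose_conjTranspose] at h
  rw [h, conjTranspose_apply, show (onePauli i P)ᴴ = onePauli i P from
    PauliString.op_conjTranspose _, onePauli_mul_apply, star_sum]
  refine Finset.sum_congr rfl fun b _ => ?_
  rw [star_mul', conjTranspose_apply, star_star, mul_comm]
  congr 1
  exact congrFun (congrFun (pauli_conjTranspose P) b) (y i)

/-! ### Depolarizing noise -/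

/-- Depolarizing noise as a mixture of conjugations by Pauli operators. -/
theorem depolarize_eq (p : ℝ) (i : Fin n) (M : Op n) :
    depolarize p i M =
      (1 - p : ℂ) • M + (p / 4 : ℂ) • ∑ P, onePauli i P * M * (onePauli i P)ᴴ := by
  ext x y
  have h : (∑ P, onePauli i P * M * (onePauli i P)ᴴ) x y =
      if x i = y i then 2 * ∑ b, M (Function.update x i b) (Function.update y i b) else 0 := by
    simp only [Matrix.sum_apply, show ∀ P, (onePauli i P)ᴴ = onePauli i P from
      fun P => PauliString.op_conjTranspose _, mul_onePauli_apply, onePauli_mul_apply,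
      Finset.sum_mul]
    rw [Finset.sum_comm]
    simp only [Finset.sum_comm (s := (Finset.univ : Finset (Fin 4)))]
    have : ∀ a b : Fin 2, ∑ P, pauli P (x i) b * M (Function.update x i b)
        (Function.update y i a) * pauli P a (y i) =
        (if x i = y i ∧ b = a then 2 else 0) * M (Function.update x i b)
        (Function.update y i a) := by
      intro a b
      rw [← sum_pauli_entries, Finset.sum_mul]
      exact Finset.sum_congr rfl fun P _ => by ring
    simp only [this]
    by_cases hxy : x i = y i <;> simp [hxy, Fin.sum_univ_two]
    ring
  rw [Matrix.add_apply, Matrix.smul_apply, Matrix.smul_apply, h, depolarize]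
  split_ifs <;> simp
  ring

/-- Twirling one qubit of a Pauli string keeps the string if it is the identity there, and
annihilates it otherwise. -/
theorem sum_onePauli_conj_op (i : Fin n) (s : PauliString n) :
    ∑ P, (onePauli i P)ᴴ * s.op * onePauli i P = if s i = 0 then (4 : ℂ) • s.op else 0 := by
  have h : ∀ P, (onePauli i P)ᴴ * s.op * onePauli i P =
      tensor (Function.update (fun j => pauli (s j)) i (pauli P * pauli (s i) * pauli P)) := by
    intro P
    rw [show (onePauli i P)ᴴ = onePauli i P from PauliString.op_conjTranspose _, onePauli_eq,
      PauliString.op, tensor_mul, tensor_mul]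
    congr 1
    ext1 j
    by_cases hj : j = i
    · subst hj; simp
    · simp [Function.update_of_ne hj]
  rw [Finset.sum_congr rfl fun P _ => h P, ← tensor_update_sum, sum_pauli_conj]
  split_ifs with h0
  · rw [tensor_update_smul]; simp [PauliString.op]
  · rw [← zero_smul ℂ (0 : Matrix (Fin 2) (Fin 2) ℂ), tensor_update_smul, zero_smul]

theorem trace_op_mul_depolarize (p : ℝ) (i : Fin n) (s : PauliString n) (M : Op n) :
    (s.op * depolarize p i M).trace = (if s i = 0 then 1 else 1 - p : ℂ) * (s.op * M).trace := by
  have h : (s.op * ∑ P, onePauli i P * M * (onePauli i P)ᴴ).trace =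
      ((∑ P, (onePauli i P)ᴴ * s.op * onePauli i P) * M).trace := by
    rw [Finset.mul_sum, Finset.sum_mul, trace_sum, trace_sum]
    refine Finset.sum_congr rfl fun P _ => ?_
    rw [← mul_assoc, Matrix.trace_mul_comm]
    simp only [mul_assoc]
  rw [depolarize_eq, mul_add, trace_add, mul_smul_comm, mul_smul_comm, trace_smul, trace_smul, h,
    sum_onePauli_conj_op]
  split_ifs
  · simp only [smul_mul_assoc, trace_smul, smul_eq_mul]; ring
  · simp

/-- In the Heisenberg picture a layer of noise damps a Pauli string by `1 - p` per unit of
weight. -/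
theorem trace_op_mul_noise (p : ℝ) (s : PauliString n) (M : Op n) :
    (s.op * noise p M).trace = (1 - p : ℂ) ^ s.weight * (s.op * M).trace := by
  have h : ∀ l : List (Fin n), (s.op * l.foldr (fun i M => depolarize p i M) M).trace =
      (l.map fun i => if s i = 0 then (1 : ℂ) else 1 - p).prod * (s.op * M).trace := by
    intro l
    induction l with
    | nil => simp
    | cons i l ih => rw [List.foldr_cons, trace_op_mul_depolarize, ih]; simp [mul_assoc]
  rw [noise, h]
  congr 1
  rw [← List.ofFn_eq_map, List.prod_ofFn, Finset.prod_ite]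
  simp [PauliString.weight, PauliString.support]

theorem posSemidef_depolarize {p : ℝ} (h0 : 0 ≤ p) (h1 : p ≤ 1) (i : Fin n) {M : Op n}
    (hM : M.PosSemidef) : (depolarize p i M).PosSemidef := by
  rw [depolarize_eq]
  refine (hM.smul ?_).add ((Matrix.posSemidef_sum _ fun P _ =>
    hM.mul_mul_conjTranspose_same _).smul ?_)
  · exact_mod_cast sub_nonneg.2 h1
  · exact_mod_cast (show (0:ℝ) ≤ p / 4 by positivity)

theorem posSemidef_noise {p : ℝ} (h0 : 0 ≤ p) (h1 : p ≤ 1) {M : Op n} (hM : M.PosSemidef) :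
    (noise p M).PosSemidef := by
  unfold noise
  induction List.finRange n with
  | nil => exact hM
  | cons i l ih => exact posSemidef_depolarize h0 h1 i ih

theorem trace_noise (p : ℝ) (M : Op n) : (noise p M).trace = M.trace := by
  have := trace_op_mul_noise p 0 M
  rwa [PauliString.op_zero, one_mul, one_mul, PauliString.weight_eq_zero.2 rfl, pow_zero,
    one_mul] at this

/-- Pauli expectation values of a positive operator are bounded by its trace. -/
theorem norm_trace_op_mul_le {M : Op n} (hM : M.PosSemidef) (s : PauliString n) :
    ‖(s.op * M).trace‖ ≤ M.trace.re := by
  have key : ∀ e : ℂ, e = 1 ∨ e = -1 → 0 ≤ M.trace + e * (s.op * M).trace := by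
    intro e he
    have hs : star e = e := by rcases he with rfl | rfl <;> simp
    have he2 : e * e = 1 := by rcases he with rfl | rfl <;> simp
    have h := (hM.mul_mul_conjTranspose_same (1 + e • s.op)).trace_nonneg
    have h2 : ((1 + e • s.op) * M * (1 + e • s.op)ᴴ).trace =
        2 * (M.trace + e * (s.op * M).trace) := by
      rw [Matrix.trace_mul_comm, ← mul_assoc]
      have : (1 + e • s.op)ᴴ * (1 + e • s.op) = (2 : ℂ) • (1 + e • s.op) := by
        simp only [conjTranspose_add, conjTranspose_smul, conjTranspose_one, hs,
          PauliString.op_conjTranspose, mul_add, add_mul, mul_one, one_mul, smul_mul_assoc,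
          mul_smul_comm, PauliString.op_mul_self]
        match_scalars <;> first | linear_combination he2 | ring
      rw [this, smul_mul_assoc, trace_smul, add_mul, trace_add, one_mul, smul_mul_assoc,
        trace_smul]
      simp
    rw [h2] at h
    have := mul_nonneg (show (0:ℂ) ≤ 1/2 by norm_num [Complex.le_def]) h
    convert this using 1
    ring
  have h1 := key 1 (Or.inl rfl)
  have h2 := key (-1) (Or.inr rfl)
  have h3 := hM.trace_nonneg
  rw [Complex.le_def] at h1 h2 h3
  simp at h1 h2 h3
  have him : (s.op * M).trace.im = 0 := by linarith [h1.2, h3.2]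
  rw [← Complex.re_add_im (s.op * M).trace, him]
  simp only [Complex.ofReal_zero, zero_mul, add_zero, Complex.norm_real]
  rw [Real.norm_eq_abs, abs_le]
  constructor <;> linarith [h1.1, h2.1]

open scoped MatrixOrder in
theorem posSemidef_productState (ρ : Fin n → QubitState) : (productState ρ).PosSemidef := by
  have h : ∀ i, ∃ B : Matrix (Fin 2) (Fin 2) ℂ, (ρ i).mat = Bᴴ * B := fun i =>
    CStarAlgebra.nonneg_iff_eq_star_mul_self.1 (Matrix.nonneg_iff_posSemidef.2 (ρ i).pos)
  choose B hB using h
  have : productState ρ = (tensor B)ᴴ * tensor B := by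
    rw [tensor_conjTranspose, tensor_mul, productState]
    congr 1
    ext1 i
    exact hB i
  rw [this]
  exact Matrix.posSemidef_conjTranspose_mul_self _

theorem trace_productState (ρ : Fin n → QubitState) : (productState ρ).trace = 1 := by
  simp [productState, trace_tensor, (ρ _).trace_one]

end PauliPath

namespace PauliPath

/-! ### Conjugation of Pauli strings by Clifford gates -/

theorem sign_ne_zero (b : Bool) : sign b ≠ 0 := by cases b <;> simp [sign]

/-- The fields `img` and `neg` are only constrained by `conj`; that the identity is fixed follows
from unitarity and the orthogonality of the Pauli matrices. -/
theorem Clifford1.conj_zero (g : Clifford1) : g.img 0 = 0 ∧ g.neg 0 = false := by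
  have h := g.conj 0
  rw [pauli_zero, mul_one, ← star_eq_conjTranspose,
    mem_unitaryGroup_iff'.1 g.unitary] at h
  have h1 : ((1 : Matrix (Fin 2) (Fin 2) ℂ) * pauli (g.img 0)).trace =
      sign (g.neg 0) * (pauli (g.img 0) * pauli (g.img 0)).trace := by
    conv_lhs => rw [h]
    rw [smul_mul_assoc, trace_smul, smul_eq_mul]
  rw [← pauli_zero, trace_pauli_mul, trace_pauli_mul, if_pos rfl] at h1
  by_cases h0 : 0 = g.img 0
  · rw [if_pos h0] at h1
    refine ⟨h0.symm, ?_⟩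
    cases hb : g.neg 0
    · rfl
    · rw [hb] at h1; norm_num [sign] at h1
  · rw [if_neg h0] at h1
    exact absurd h1.symm (mul_ne_zero (sign_ne_zero _) two_ne_zero)

theorem Clifford2.conj_zero (g : Clifford2) : g.img 0 0 = (0, 0) ∧ g.neg 0 0 = false := by
  have h := g.conj 0 0
  rw [pauli_zero, one_kronecker_one, mul_one, ← star_eq_conjTranspose,
    mem_unitaryGroup_iff'.1 g.unitary] at h
  obtain ⟨⟨a, b⟩, hab⟩ : ∃ x, g.img 0 0 = x := ⟨_, rfl⟩
  rw [hab] at h ⊢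
  have h1 : ((1 : Matrix (Fin 2 × Fin 2) (Fin 2 × Fin 2) ℂ) * (pauli a ⊗ₖ pauli b)).trace =
      sign (g.neg 0 0) * ((pauli a ⊗ₖ pauli b) * (pauli a ⊗ₖ pauli b)).trace := by
    conv_lhs => rw [h]
    rw [smul_mul_assoc, trace_smul, smul_eq_mul]
  rw [← one_kronecker_one, ← mul_kronecker_mul, ← mul_kronecker_mul, trace_kronecker,
    trace_kronecker, ← pauli_zero] at h1
  simp only [trace_pauli_mul, if_true] at h1
  by_cases h0 : 0 = a
  · by_cases h0' : 0 = b
    · rw [if_pos h0, if_pos h0'] at h1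
      refine ⟨by rw [← h0, ← h0'], ?_⟩
      cases hb : g.neg 0 0
      · rfl
      · rw [hb] at h1; norm_num [sign] at h1
    · rw [if_neg h0', mul_zero] at h1
      exact absurd h1.symm (mul_ne_zero (sign_ne_zero _) (by norm_num))
  · rw [if_neg h0, zero_mul] at h1
    exact absurd h1.symm (mul_ne_zero (sign_ne_zero _) (by norm_num))

/-! ### Sums and products over pairings -/

section Pairing

variable {n : ℕ} {π : Fin n → Fin n}

theorem min_pairing_eq (hπ : ∀ i, π (π i) = i) {i b : Fin n} (h : min i (π i) = b) :
    i = b ∨ i = π b := by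
  rcases min_choice i (π i) with h' | h'
  · exact Or.inl (h'.symm.trans h)
  · right; rw [← h, h', hπ]

/-- A product over all points, grouped along the orbits of an involution; every orbit is
represented by its smaller point. -/
theorem prod_pairing {R : Type*} [CommMonoid R] (hπ : ∀ i, π (π i) = i) (f : Fin n → R) :
    ∏ i, f i = ∏ b, if π b = b then f b else if b < π b then f b * f (π b) else 1 := by
  rw [← Finset.prod_fiberwise Finset.univ (fun i => min i (π i)) f]
  refine Finset.prod_congr rfl fun b _ => ?_
  split_ifs with h1 h2
  · have : Finset.univ.filter (fun i => min i (π i) = b) = {b} := by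
      ext i
      simp only [Finset.mem_filter, Finset.mem_univ, true_and, Finset.mem_singleton]
      constructor
      · intro h; rcases min_pairing_eq hπ h with h | h
        · exact h
        · rw [h, h1]
      · rintro rfl; rw [h1, min_self]
    rw [this, Finset.prod_singleton]
  · have : Finset.univ.filter (fun i => min i (π i) = b) = {b, π b} := by
      ext i
      simp only [Finset.mem_filter, Finset.mem_univ, true_and, Finset.mem_singleton,
        Finset.mem_insert]
      constructor
      · exact min_pairing_eq hπ
      · rintro (rfl | rfl)
        · exact min_eq_left h2.le
        · rw [hπ]; exact min_eq_right h2.le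
    rw [this, Finset.prod_pair h2.ne]
  · have : Finset.univ.filter (fun i => min i (π i) = b) = ∅ := by
      refine Finset.filter_eq_empty_iff.2 fun i _ h => ?_
      have hb : b ≤ π b := by
        rcases min_pairing_eq hπ h with rfl | rfl
        · exact min_eq_left_iff.1 h
        · rw [hπ] at h; exact min_eq_right_iff.1 h
      exact h2 (lt_of_le_of_ne hb (Ne.symm h1))
    rw [this, Finset.prod_empty]

/-- Sums of products distribute over the fibres of a map. -/
theorem sum_prod_fiber {ι κ α : Type*} [Fintype ι] [Fintype κ] [DecidableEq ι] [DecidableEq κ]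
    [Fintype α] (rep : ι → κ) (F : ∀ b, ({i // rep i = b} → α) → ℂ) :
    ∑ a : ι → α, ∏ b, F b (fun i => a i) = ∏ b, ∑ v, F b v := by
  rw [Fintype.prod_sum]
  refine Fintype.sum_equiv
    { toFun := fun (a : ι → α) b (i : {i // rep i = b}) => a i
      invFun := fun v i => v (rep i) ⟨i, rfl⟩
      left_inv := fun _ => rfl
      right_inv := fun v => by
        funext b i
        obtain ⟨i, rfl⟩ := i
        rfl } _ _ fun a => rfl

/-- A sum over configurations of a product of factors, each of which sees only one orbit of an
involution. -/
theorem sum_prod_pairing {α : Type*} [Fintype α] (hπ : ∀ i, π (π i) = i)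
    (F1 : Fin n → α → ℂ) (F2 : Fin n → α → α → ℂ) :
    ∑ a : Fin n → α, ∏ b, (if π b = b then F1 b (a b) else
      if b < π b then F2 b (a b) (a (π b)) else 1) =
    ∏ b, if π b = b then ∑ z, F1 b z else if b < π b then ∑ z, ∑ z', F2 b z z' else 1 := by
  let rep : Fin n → Fin n := fun i => min i (π i)
  have hrep : ∀ b, (π b = b ∨ b < π b) → rep b = b := by
    rintro b (h | h)
    · simp [rep, h]
    · exact min_eq_left h.le
  have hrep' : ∀ b, b < π b → rep (π b) = b := by
    intro b h; simp only [rep, hπ]; exact min_eq_right h.le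
  let F : ∀ b, ({i // rep i = b} → α) → ℂ := fun b v =>
    if h : π b = b then F1 b (v ⟨b, hrep b (Or.inl h)⟩) else
      if h : b < π b then F2 b (v ⟨b, hrep b (Or.inr h)⟩) (v ⟨π b, hrep' b h⟩) else 1
  have h := sum_prod_fiber rep F
  have hl : ∀ (a : Fin n → α) b, F b (fun i => a i) = if π b = b then F1 b (a b) else
      if b < π b then F2 b (a b) (a (π b)) else 1 := by
    intro a b
    simp only [F]
    split_ifs <;> rfl
  simp only [hl] at h
  rw [h]
  refine Finset.prod_congr rfl fun b _ => ?_
  split_ifs with h1 h2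
  · have : Unique {i // rep i = b} :=
      { default := ⟨b, hrep b (Or.inl h1)⟩
        uniq := fun i => Subtype.ext (by
          rcases min_pairing_eq hπ i.2 with h | h
          · exact h
          · exact h.trans h1) }
    refine Fintype.sum_equiv (Equiv.funUnique _ α) _ _ fun v => ?_
    simp only [F, dif_pos h1, Equiv.funUnique_apply]
    congr 2
    exact Subsingleton.elim _ _
  · rw [← Fintype.sum_prod_type' (f := fun z z' => F2 b z z')]
    refine Fintype.sum_equiv
      { toFun := fun v => (v ⟨b, hrep b (Or.inr h2)⟩, v ⟨π b, hrep' b h2⟩)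
        invFun := fun z i => if i.1 = b then z.1 else z.2
        left_inv := ?_
        right_inv := ?_ } _ _ fun v => ?_
    · intro v
      funext i
      by_cases hi : i.1 = b
      · simp only [hi, if_true]; congr 1; exact Subtype.ext hi.symm
      · simp only [hi, if_false]; congr 1
        exact Subtype.ext ((min_pairing_eq hπ i.2).resolve_left hi).symm
    · intro z
      simp [h1]
    · simp [F, h1, h2]
  · have hemp : IsEmpty {i // rep i = b} := by
      refine ⟨fun i => ?_⟩
      have h := i.2
      have hb : b ≤ π b := by
        rcases min_pairing_eq hπ h with h' | h'
        · rw [h'] at h; exact min_eq_left_iff.1 h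
        · rw [h'] at h; simp only [rep, hπ] at h; exact min_eq_right_iff.1 h
      exact h2 (lt_of_le_of_ne hb (Ne.symm h1))
    simp [F, h1, h2]

end Pairing

/-! ### Conjugation of Pauli strings by a layer -/

namespace Circuit

variable {n d : ℕ} {A : Architecture n d} (c : Circuit A) (k : Fin d)

theorem partner_lt {k : Fin d} {i : Fin n} (h1 : ¬ A.partner k i = i) (h2 : ¬ i < A.partner k i) :
    A.partner k i < A.partner k (A.partner k i) := by
  rw [A.invol]; exact lt_of_le_of_ne (not_lt.1 h2) h1

/-- The Pauli string, up to sign, to which the Clifford gates of layer `k` conjugate the string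
`u`; qubits with a `T` gate are left alone. -/
def cliff (u : PauliString n) : PauliString n := fun i =>
  if h : A.partner k i = i then
    match c.one ⟨(k, i), h⟩ with
    | .clifford g => g.img (u i)
    | .T => u i
  else if h2 : i < A.partner k i then
    ((c.two ⟨(k, i), h2⟩).img (u i) (u (A.partner k i))).1
  else ((c.two ⟨(k, A.partner k i), partner_lt h h2⟩).img (u (A.partner k i)) (u i)).2

/-- Does the Clifford gate that is named by qubit `i` in layer `k` contribute a minus sign when it
conjugates the string `u`? -/
def negAt (u : PauliString n) (i : Fin n) : Bool :=
  if h : A.partner k i = i then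
    match c.one ⟨(k, i), h⟩ with
    | .clifford g => g.neg (u i)
    | .T => false
  else if h2 : i < A.partner k i then (c.two ⟨(k, i), h2⟩).neg (u i) (u (A.partner k i))
  else false

/-- The real version of `sign`. -/
noncomputable def rsign (b : Bool) : ℝ := if b then -1 else 1

theorem ofReal_rsign (b : Bool) : ((rsign b : ℝ) : ℂ) = sign b := by
  cases b <;> simp [rsign, sign]

theorem abs_rsign (b : Bool) : |rsign b| = 1 := by
  cases b <;> simp [rsign]

/-- The sign that the Clifford gates of layer `k` contribute when they conjugate `u`. -/
noncomputable def sgn (u : PauliString n) : ℝ := ∏ i, rsign (c.negAt k u i)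

theorem abs_sgn (u : PauliString n) : |c.sgn k u| = 1 := by
  simp [sgn, Finset.abs_prod, abs_rsign]

theorem cliff_zero_apply {u : PauliString n} {i : Fin n} (h1 : u i = 0)
    (h2 : u (A.partner k i) = 0) : c.cliff k u i = 0 := by
  unfold cliff
  split_ifs with h h'
  · cases c.one ⟨(k, i), h⟩ with
    | clifford g => simp [h1, g.conj_zero.1]
    | T => simp [h1]
  · rw [h1, h2, (Clifford2.conj_zero _).1]
  · rw [h1, h2, (Clifford2.conj_zero _).1]

theorem negAt_zero {u : PauliString n} {i : Fin n} (h1 : u i = 0)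
    (h2 : u (A.partner k i) = 0) : c.negAt k u i = false := by
  unfold negAt
  split_ifs with h h'
  · cases c.one ⟨(k, i), h⟩ with
    | clifford g => simp [h1, g.conj_zero.2]
    | T => rfl
  · rw [h1, h2, (Clifford2.conj_zero _).2]
  · rfl

theorem cliff_zero : c.cliff k 0 = 0 := by
  funext i; exact c.cliff_zero_apply k rfl rfl

/-- Layer `k` with its `T` gates removed. -/
def cliffLayer : Op n := fun x y => ∏ i : Fin n,
  if h : A.partner k i = i then
    (match c.one ⟨(k, i), h⟩ with
    | .clifford g => g.U
    | .T => 1) (x i) (y i)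
  else if h : i < A.partner k i then
    (c.two ⟨(k, i), h⟩).U (x i, x (A.partner k i)) (y i, y (A.partner k i))
  else 1

/-- The matrix of the `T` gate. -/
noncomputable def tMat : Matrix (Fin 2) (Fin 2) ℂ := Gate1.T.U

/-- The `T` gates of layer `k`. -/
noncomputable def tLayer : Op n := tensor fun i => if c.isT k i = 1 then tMat else 1

/-- The `T` gates of a layer act after its Clifford gates, on other qubits; so in the Heisenberg
picture they come first. -/
theorem layer_eq : c.layer k = c.tLayer k * c.cliffLayer k := by
  have hd : ∀ i x y, x ≠ y → (if c.isT k i = 1 then tMat else 1) x y = 0 := by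
    intro i x y hxy
    split_ifs
    · fin_cases x <;> fin_cases y <;> simp_all [tMat, Gate1.U]
    · exact Matrix.one_apply_ne hxy
  ext x y
  rw [Matrix.mul_apply, Finset.sum_eq_single x]
  · simp only [layer, tLayer, tensor, cliffLayer, ← Finset.prod_mul_distrib]
    refine Finset.prod_congr rfl fun i _ => ?_
    by_cases h : A.partner k i = i
    · simp only [dif_pos h, isT]
      cases c.one ⟨(k, i), h⟩ with
      | clifford g => simp [Gate1.U]
      | T =>
        generalize x i = a
        generalize y i = b
        fin_cases a <;> fin_cases b <;> simp [tMat, Gate1.U]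
    · simp [h, isT]
  · intro z _ hz
    obtain ⟨i, hi⟩ := Function.ne_iff.mp hz
    rw [show c.tLayer k x z = 0 from Finset.prod_eq_zero (Finset.mem_univ i)
      (hd i _ _ (Ne.symm hi)), zero_mul]
  · simp

/-- Entries of products of operators are sums over configurations, which factorize over the
gates. -/
theorem cliffLayer_conj (u : PauliString n) :
    (c.cliffLayer k)ᴴ * u.op * c.cliffLayer k = (c.sgn k u : ℂ) • (c.cliff k u).op := by
  ext x y
  have hl : ((c.cliffLayer k)ᴴ * u.op * c.cliffLayer k) x y =
      ∑ a : Fin n → Fin 2 × Fin 2, star (c.cliffLayer k (fun i => (a i).1) x) *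
        u.op (fun i => (a i).1) (fun i => (a i).2) * c.cliffLayer k (fun i => (a i).2) y := by
    simp only [Matrix.mul_apply, Finset.sum_mul, conjTranspose_apply]
    rw [Finset.sum_comm, ← Fintype.sum_prod_type']
    exact Fintype.sum_equiv (Equiv.arrowProdEquivProdArrow _ (fun _ => Fin 2) (fun _ => Fin 2)).symm
      _ _ fun z => rfl
  let G : Fin n → Matrix (Fin 2) (Fin 2) ℂ := fun i => if h : A.partner k i = i then
    (match c.one ⟨(k, i), h⟩ with
    | .clifford g => g.U
    | .T => 1) else 0
  let H : Fin n → Matrix (Fin 2 × Fin 2) (Fin 2 × Fin 2) ℂ := fun i =>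
    if h : i < A.partner k i then (c.two ⟨(k, i), h⟩).U else 0
  have hC : ∀ x y, c.cliffLayer k x y = ∏ i, if A.partner k i = i then G i (x i) (y i)
      else if i < A.partner k i then H i (x i, x (A.partner k i)) (y i, y (A.partner k i))
      else 1 := by
    intro x y
    refine Finset.prod_congr rfl fun i _ => ?_
    by_cases h : A.partner k i = i
    · simp [h, G]
    · by_cases h' : i < A.partner k i <;> simp [h, h', H]
  have hP : ∀ (s : PauliString n) x y, s.op x y = ∏ i, if A.partner k i = i
      then pauli (s i) (x i) (y i)
      else if i < A.partner k i then pauli (s i) (x i) (y i) *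
        pauli (s (A.partner k i)) (x (A.partner k i)) (y (A.partner k i)) else 1 :=
    fun s x y => prod_pairing (A.invol k) fun i => pauli (s i) (x i) (y i)
  let F1 : Fin n → Fin 2 × Fin 2 → ℂ := fun b z =>
    star (G b z.1 (x b)) * pauli (u b) z.1 z.2 * G b z.2 (y b)
  let F2 : Fin n → Fin 2 × Fin 2 → Fin 2 × Fin 2 → ℂ := fun b z z' =>
    star (H b (z.1, z'.1) (x b, x (A.partner k b))) *
      (pauli (u b) z.1 z.2 * pauli (u (A.partner k b)) z'.1 z'.2) *
      H b (z.2, z'.2) (y b, y (A.partner k b))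
  have hsum : ((c.cliffLayer k)ᴴ * u.op * c.cliffLayer k) x y =
      ∑ a : Fin n → Fin 2 × Fin 2, ∏ b, if A.partner k b = b then F1 b (a b) else
        if b < A.partner k b then F2 b (a b) (a (A.partner k b)) else 1 := by
    rw [hl]
    refine Finset.sum_congr rfl fun a _ => ?_
    rw [hC, hC, hP, star_prod, ← Finset.prod_mul_distrib, ← Finset.prod_mul_distrib]
    refine Finset.prod_congr rfl fun b _ => ?_
    split_ifs <;> simp [F1, F2]
  rw [hsum, sum_prod_pairing (A.invol k), Matrix.smul_apply, smul_eq_mul, hP, sgn,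
    prod_pairing (A.invol k) (fun i => rsign (c.negAt k u i)), Complex.ofReal_prod,
    ← Finset.prod_mul_distrib]
  refine Finset.prod_congr rfl fun b _ => ?_
  have hq : ∀ b, b < A.partner k b → ¬ A.partner k (A.partner k b) = A.partner k b := by
    intro b h; rw [A.invol]; exact h.ne
  have hq2 : ∀ b, b < A.partner k b → ¬ A.partner k b < A.partner k (A.partner k b) := by
    intro b h; rw [A.invol]; exact not_lt.2 h.le
  split_ifs with h1 h2
  · have key : (G b)ᴴ * pauli (u b) * G b = sign (c.negAt k u b) • pauli (c.cliff k u b) := by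
      simp only [G, negAt, cliff, dif_pos h1]
      cases c.one ⟨(k, b), h1⟩ with
      | clifford g => exact g.conj (u b)
      | T => simp [sign]
    have := congrFun (congrFun key (x b)) (y b)
    rw [Matrix.smul_apply, smul_eq_mul, ← ofReal_rsign] at this
    rw [← this]
    simp only [Matrix.mul_apply, F1, conjTranspose_apply, Fintype.sum_prod_type, Finset.sum_mul]
    rw [Finset.sum_comm]
  · have key : (H b)ᴴ * (pauli (u b) ⊗ₖ pauli (u (A.partner k b))) * H b =
        sign (c.negAt k u b) • (pauli (c.cliff k u b) ⊗ₖ pauli (c.cliff k u (A.partner k b))) := by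
      have e2 : c.cliff k u (A.partner k b) =
          ((c.two ⟨(k, b), h2⟩).img (u b) (u (A.partner k b))).2 := by
        simp only [cliff, dif_neg (hq b h2), dif_neg (hq2 b h2)]
        congr 2 <;> simp only [A.invol]
      rw [e2]
      simp only [H, negAt, cliff, dif_neg h1, dif_pos h2]
      exact (c.two ⟨(k, b), h2⟩).conj _ _
    have e3 : c.negAt k u (A.partner k b) = false := by
      simp only [negAt, dif_neg (hq b h2), dif_neg (hq2 b h2)]
    have := congrFun (congrFun key (x b, x (A.partner k b))) (y b, y (A.partner k b))
    rw [Matrix.smul_apply, smul_eq_mul, ← ofReal_rsign, kroneckerMap_apply] at this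
    rw [e3, show rsign false = 1 from rfl, mul_one, ← this]
    simp only [Matrix.mul_apply, F2, conjTranspose_apply, Fintype.sum_prod_type,
      kroneckerMap_apply, Fin.sum_univ_two]
    ring
  · simp

end Circuit

end PauliPath

namespace PauliPath

/-! ### Decision trees -/

/-- Computations that may branch on bits and end with a value: binary decision trees. -/
inductive Dec (α : Type) where
  | ret (a : α)
  | branch (f : Bool → Dec α)

namespace Dec

variable {α β : Type}

/-- The sum of `f` over all leaves. -/
def sum {M : Type*} [AddCommMonoid M] (f : α → M) : Dec α → M
  | ret a => f a
  | branch g => (g false).sum f + (g true).sum f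

/-- Continue at every leaf. -/
def bind (f : α → Dec β) : Dec α → Dec β
  | ret a => f a
  | branch g => branch fun b => (g b).bind f

/-- Follow the bits of `b` from position `q` on; returns the leaf and the position after the last
bit that was read. -/
def run (b : ℕ → Bool) : Dec α → ℕ → α × ℕ
  | ret a, q => (a, q)
  | branch g, q => (g (b q)).run b (q + 1)

/-- The number of leaves. -/
def count (x : Dec α) : ℕ := x.sum fun _ => 1

theorem sum_bind {M : Type*} [AddCommMonoid M] (f : β → M) (g : α → Dec β) (x : Dec α) :
    (x.bind g).sum f = x.sum fun a => (g a).sum f := by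
  induction x with
  | ret a => rfl
  | branch h ih => simp only [bind, sum, ih]

theorem run_bind (b : ℕ → Bool) (g : α → Dec β) (x : Dec α) (q : ℕ) :
    (x.bind g).run b q = (g (x.run b q).1).run b (x.run b q).2 := by
  induction x generalizing q with
  | ret a => rfl
  | branch h ih => simp only [bind, run, ih]

theorem map_sum {M N : Type*} [AddCommMonoid M] [AddCommMonoid N] (φ : M →+ N) (f : α → M)
    (x : Dec α) : φ (x.sum f) = x.sum fun a => φ (f a) := by
  induction x with
  | ret a => rfl
  | branch g ih => simp only [sum, map_add, ih]

theorem sum_mono {M : Type*} [AddCommMonoid M] [Preorder M] [AddLeftMono M] [AddRightMono M]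
    {f g : α → M} (x : Dec α) (h : ∀ a, f a ≤ g a) :
    x.sum f ≤ x.sum g := by
  induction x with
  | ret a => exact h a
  | branch g ih => exact add_le_add (ih _) (ih _)

theorem one_le_count (x : Dec α) : 1 ≤ x.count := by
  induction x with
  | ret a => exact le_rfl
  | branch g ih => exact (ih false).trans (Nat.le_add_right _ _)

end Dec

/-! ### Branching at `T` gates -/

variable {n : ℕ}

/-- The tree of Pauli strings with coefficients to which the `T` gates on the qubits of a list
conjugate a Pauli string, as `T† X T = (X - Y) / √2` and `T† Y T = (X + Y) / √2`. The coefficient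
also collects a factor `η` per qubit in the list. -/
noncomputable def tDec (isT : Fin n → ℕ) (η : ℝ) :
    List (Fin n) → PauliString n → ℝ → Dec (PauliString n × ℝ)
  | [], s, c => .ret (s, c)
  | i :: l, s, c =>
    if isT i = 1 ∧ (s i = 1 ∨ s i = 2) then
      .branch fun b => tDec isT η l (Function.update s i (if b then 2 else 1))
        (c * η / √2 * Circuit.rsign (b && decide (s i = 1)))
    else tDec isT η l s (c * η)

theorem tMat_conj (P : Fin 4) : Circuit.tMatᴴ * pauli P * Circuit.tMat =
    if P = 1 then ((√2 : ℝ) : ℂ)⁻¹ • pauli 1 + (-((√2 : ℝ) : ℂ)⁻¹) • pauli 2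
    else if P = 2 then ((√2 : ℝ) : ℂ)⁻¹ • pauli 1 + ((√2 : ℝ) : ℂ)⁻¹ • pauli 2
    else pauli P := by
  have h1 : Complex.exp (Complex.I * (Real.pi / 4)) = ((√2 : ℝ) : ℂ)⁻¹ * (1 + Complex.I) := by
    rw [mul_comm, Complex.exp_mul_I]
    have : (Real.pi / 4 : ℂ) = ((Real.pi / 4 : ℝ) : ℂ) := by push_cast; ring
    rw [this, ← Complex.ofReal_cos, ← Complex.ofReal_sin, Real.cos_pi_div_four,
      Real.sin_pi_div_four]
    have h2 : (√2 / 2 : ℝ) = (√2)⁻¹ := by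
      rw [eq_comm, inv_eq_one_div, div_eq_div_iff (by positivity) (by norm_num)]
      norm_num
    rw [h2]; push_cast; ring
  have h2 : ((√2 : ℝ) : ℂ)⁻¹ * ((√2 : ℝ) : ℂ)⁻¹ = 1 / 2 := by
    rw [← Complex.ofReal_inv, ← Complex.ofReal_mul, ← mul_inv, Real.mul_self_sqrt (by norm_num)]
    norm_num
  have h3 : Complex.I * Complex.I = -1 := Complex.I_mul_I
  have hr : (starRingEnd ℂ) ((√2 : ℝ) : ℂ)⁻¹ = ((√2 : ℝ) : ℂ)⁻¹ := by
    rw [← Complex.ofReal_inv, Complex.conj_ofReal]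
  generalize ((√2 : ℝ) : ℂ)⁻¹ = r at h1 h2 hr
  ext a b
  fin_cases P <;> fin_cases a <;> fin_cases b <;>
    simp [Circuit.tMat, Gate1.U, pauli, Matrix.mul_apply, Fin.sum_univ_two, h1, hr] <;>
    first
    | linear_combination 0 * h2
    | linear_combination (1 - Complex.I * Complex.I) * h2 - 1 / 2 * h3
    | linear_combination r * h3
    | linear_combination -r * h3

/-- The tree of a list of qubits sums up to the conjugation by the `T` gates on these qubits. -/
theorem tDec_op (isT : Fin n → ℕ) (η : ℝ) (l : List (Fin n)) (hl : l.Nodup) (s : PauliString n)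
    (c : ℝ) :
    (tDec isT η l s c).sum (fun x => (x.2 : ℂ) • x.1.op) = ((c * η ^ l.length : ℝ) : ℂ) •
      tensor fun i => if i ∈ l ∧ isT i = 1 then Circuit.tMatᴴ * pauli (s i) * Circuit.tMat
        else pauli (s i) := by
  induction l generalizing s c with
  | nil => simp [tDec, Dec.sum, PauliString.op]
  | cons i l ih =>
    obtain ⟨hi, hl⟩ := List.nodup_cons.1 hl
    set M : Fin n → Matrix (Fin 2) (Fin 2) ℂ := fun j => if j ∈ i :: l ∧ isT j = 1 then
      Circuit.tMatᴴ * pauli (s j) * Circuit.tMat else pauli (s j) with hM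
    have hup : ∀ R : Fin 4, (tensor fun j => if j ∈ l ∧ isT j = 1 then
        Circuit.tMatᴴ * pauli (Function.update s i R j) * Circuit.tMat
        else pauli (Function.update s i R j)) = tensor (Function.update M i (pauli R)) := by
      intro R
      congr 1
      ext1 j
      by_cases hj : j = i
      · subst hj; simp [hi]
      · simp [hM, hj]
    by_cases h : isT i = 1 ∧ (s i = 1 ∨ s i = 2)
    · rw [tDec, if_pos h]
      simp only [Dec.sum]
      rw [ih hl, ih hl, hup, hup]
      have hMi : M = Function.update M i (M i) := (Function.update_eq_self i M).symm
      have hMv : M i = Circuit.tMatᴴ * pauli (s i) * Circuit.tMat := by simp [hM, h.1]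
      rw [hMi, hMv, tMat_conj]
      rcases h.2 with h2 | h2
      · rw [if_pos h2, tensor_update_add, tensor_update_smul, tensor_update_smul, smul_add,
          smul_smul, smul_smul]
        simp [h2, Circuit.rsign, pow_succ]
        congr 2 <;> ring_nf
      · rw [if_neg (by rw [h2]; decide), if_pos h2, tensor_update_add, tensor_update_smul,
          tensor_update_smul, smul_add, smul_smul, smul_smul]
        simp [h2, Circuit.rsign, pow_succ]
        congr 2 <;> ring
    · rw [tDec, if_neg h, ih hl]
      congr 1
      · push_cast [List.length_cons, pow_succ]; ring
      · congr 1
        ext1 j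
        by_cases hj : j = i
        · subst hj
          rw [if_neg (by simp [hi])]
          simp only [hM]
          by_cases hT : isT j = 1
          · have : ¬ (s j = 1 ∨ s j = 2) := fun h' => h ⟨hT, h'⟩
            rw [not_or] at this
            rw [if_pos ⟨List.mem_cons_self, hT⟩, tMat_conj, if_neg this.1, if_neg this.2]
          · rw [if_neg (by simp [hT])]
        · simp [hM, hj]

/-- The list `l` enumerates the support of `s`. -/
def Enum (l : List (Fin n)) (s : PauliString n) : Prop := l.Nodup ∧ ∀ i, i ∈ l ↔ s i ≠ 0

theorem Enum.length_eq {l : List (Fin n)} {s : PauliString n} (h : Enum l s) :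
    l.length = s.weight := by
  rw [← List.toFinset_card_of_nodup h.1, PauliString.weight]
  congr 1
  ext i
  simp [h.2 i, PauliString.support]

/-- Sums over the leaves agree if the summands agree on strings with a property that the action of
`T` gates preserves. -/
theorem tDec_forall {isT : Fin n → ℕ} {η : ℝ} (Φ : PauliString n → Prop)
    (hΦ : ∀ s i R, Φ s → isT i = 1 → s i = 1 ∨ s i = 2 → (R = 1 ∨ R = 2) →
      Φ (Function.update s i R)) {M : Type*} [AddCommMonoid M] {f g : PauliString n × ℝ → M}
    (hfg : ∀ x, Φ x.1 → f x = g x) (l : List (Fin n)) (s : PauliString n) (c : ℝ) (hs : Φ s) :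
    (tDec isT η l s c).sum f = (tDec isT η l s c).sum g := by
  induction l generalizing s c with
  | nil => exact hfg _ hs
  | cons i l ih =>
    rw [tDec]
    split_ifs with h
    · simp only [Dec.sum]
      exact congrArg₂ (· + ·) (ih _ _ (hΦ s i _ hs h.1 h.2 (by simp)))
        (ih _ _ (hΦ s i _ hs h.1 h.2 (by simp)))
    · exact ih _ _ hs

/-- `T` gates do not change the support. -/
theorem Enum.update {l : List (Fin n)} {s : PauliString n} (h : Enum l s) {i : Fin n} {R : Fin 4}
    (h1 : s i = 1 ∨ s i = 2) (h2 : R = 1 ∨ R = 2) : Enum l (Function.update s i R) := by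
  refine ⟨h.1, fun j => ?_⟩
  rw [h.2]
  by_cases hj : j = i
  · subst hj
    rw [Function.update_self]
    rcases h1 with h1 | h1 <;> rcases h2 with h2 | h2 <;> simp [h1, h2]
  · rw [Function.update_of_ne hj]

namespace Circuit

variable {d : ℕ} {A : Architecture n d} (c : Circuit A) (k : Fin d)

/-- The qubits that are written when qubit `i` in the support of `u` is processed. A gate on two
qubits of the support is applied when its smaller qubit is processed. -/
def touched (u : PauliString n) (i : Fin n) : List (Fin n) :=
  if A.partner k i = i then [i]
  else if i < A.partner k i then [i, A.partner k i]
  else if u (A.partner k i) = 0 then [A.partner k i, i]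
  else []

/-- The support of `cliff u`, computed from the support `l` of `u`. -/
def next (l : List (Fin n)) (u : PauliString n) : List (Fin n) :=
  (l.flatMap (touched (A := A) k u)).filter fun i => c.cliff k u i ≠ 0

theorem mem_touched {k : Fin d} {u : PauliString n} {i j : Fin n}
    (h : j ∈ touched (A := A) k u i) : j = i ∨ j = A.partner k i := by
  unfold touched at h
  split_ifs at h <;> simp at h <;> tauto

theorem nodup_flatMap_touched {l : List (Fin n)} {u : PauliString n} (h : Enum l u) :
    (l.flatMap (touched (A := A) k u)).Nodup := by
  rw [List.nodup_flatMap]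
  refine ⟨fun i _ => ?_, h.1.pairwise_of_forall_ne fun i hi j hj hij => ?_⟩
  · unfold touched
    split_ifs with h1 <;> simp [h1]
    exact fun h => h1 h.symm
  · have key : ∀ i ∈ l, i < A.partner k i → touched (A := A) k u (A.partner k i) = [] := by
      intro i hi hlt
      unfold touched
      rw [A.invol, if_neg hlt.ne, if_neg (not_lt.2 hlt.le), if_neg ((h.2 i).1 hi)]
    intro x hx hx'
    change x ∈ touched k u i at hx
    change x ∈ touched k u j at hx'
    have hji : j = A.partner k i := by
      rcases mem_touched hx with rfl | rfl
      · rcases mem_touched hx' with rfl | h'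
        · exact absurd rfl hij
        · rw [h', A.invol]
      · rcases mem_touched hx' with h' | h'
        · exact h'.symm
        · have := congrArg (A.partner k) h'
          rw [A.invol, A.invol] at this
          exact absurd this hij
    subst hji
    rcases lt_or_gt_of_ne hij with hlt | hlt
    · rw [key i hi hlt] at hx'; simp at hx'
    · have := key (A.partner k i) hj (by rwa [A.invol])
      rw [A.invol] at this
      rw [this] at hx; simp at hx

/-- Every qubit on which the Clifford gates may produce a letter other than the identity is
touched. -/
theorem mem_flatMap_touched {l : List (Fin n)} {u : PauliString n} (h : Enum l u) {i : Fin n}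
    (hi : u i ≠ 0 ∨ u (A.partner k i) ≠ 0) : i ∈ l.flatMap (touched (A := A) k u) := by
  rw [List.mem_flatMap]
  by_cases h1 : A.partner k i = i
  · refine ⟨i, (h.2 i).2 (by rw [h1, or_self] at hi; exact hi), ?_⟩
    simp [touched, h1]
  · rcases lt_or_gt_of_ne h1 with h2 | h2
    · by_cases h3 : u (A.partner k i) = 0
      · refine ⟨i, (h.2 i).2 (hi.resolve_right (not_not.2 h3)), ?_⟩
        simp [touched, h1, h3, not_lt.2 h2.le]
      · refine ⟨A.partner k i, (h.2 _).2 h3, ?_⟩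
        simp [touched, A.invol, Ne.symm h1, h2]
    · by_cases h3 : u i = 0
      · refine ⟨A.partner k i, (h.2 _).2 (hi.resolve_left (not_not.2 h3)), ?_⟩
        simp [touched, A.invol, Ne.symm h1, h3, not_lt.2 h2.le]
      · exact ⟨i, (h.2 i).2 h3, by simp [touched, h1, h2]⟩

theorem enum_next {l : List (Fin n)} {u : PauliString n} (h : Enum l u) :
    Enum (c.next k l u) (c.cliff k u) := by
  refine ⟨(nodup_flatMap_touched k h).filter _, fun i => ?_⟩
  simp only [next, List.mem_filter, decide_eq_true_eq]
  refine ⟨fun h => h.2, fun hi => ⟨mem_flatMap_touched k h ?_, hi⟩⟩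
  by_contra! h'
  exact hi (c.cliff_zero_apply k h'.1 h'.2)

/-- Conjugation of a Pauli string by a layer, as a sum over the tree of its `T` gates. -/
theorem layer_conj {l : List (Fin n)} {s : PauliString n} (h : Enum l s) (η a : ℝ) :
    (tDec (c.isT k) η l s a).sum (fun x => ((x.2 * c.sgn k x.1 : ℝ) : ℂ) • (c.cliff k x.1).op) =
      ((a * η ^ l.length : ℝ) : ℂ) • ((c.layer k)ᴴ * s.op * c.layer k) := by
  let φ : Op n →+ Op n :=
    { toFun := fun M => (c.cliffLayer k)ᴴ * M * c.cliffLayer k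
      map_zero' := by simp
      map_add' := fun M M' => by rw [mul_add, add_mul] }
  have h1 : ((c.tLayer k)ᴴ * s.op * c.tLayer k) = tensor fun i => if i ∈ l ∧ c.isT k i = 1 then
      tMatᴴ * pauli (s i) * tMat else pauli (s i) := by
    rw [tLayer, tensor_conjTranspose, PauliString.op, tensor_mul, tensor_mul]
    congr 1
    ext1 i
    by_cases hT : c.isT k i = 1
    · by_cases hi : i ∈ l
      · simp [hT, hi]
      · have hs : s i = 0 := by
          by_contra h0
          exact hi ((h.2 i).2 h0)
        simp only [hT, hi, if_true, false_and, if_false, hs, tMat_conj]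
        rfl
    · simp [hT]
  have h2 := congrArg φ (tDec_op (c.isT k) η l h.1 s a)
  rw [← h1, Dec.map_sum] at h2
  have h3 : ∀ x : PauliString n × ℝ, φ ((x.2 : ℂ) • x.1.op) =
      ((x.2 * c.sgn k x.1 : ℝ) : ℂ) • (c.cliff k x.1).op := by
    intro x
    simp only [φ, AddMonoidHom.coe_mk, ZeroHom.coe_mk, mul_smul_comm, smul_mul_assoc,
      cliffLayer_conj, smul_smul, Complex.ofReal_mul]
  simp only [h3] at h2
  rw [h2]
  simp only [φ, AddMonoidHom.coe_mk, ZeroHom.coe_mk, mul_smul_comm, smul_mul_assoc, layer_eq,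
    conjTranspose_mul, mul_assoc]

/-- The linear extension of a function on Pauli strings to all operators. -/
noncomputable def pauliSum (f : PauliString n → ℂ) : Op n →+ ℂ where
  toFun M := ∑ s : PauliString n, (M * s.op).trace / 2 ^ n * f s
  map_zero' := by simp
  map_add' M M' := by simp only [add_mul, trace_add, add_div, Finset.sum_add_distrib]

theorem pauliSum_apply (f : PauliString n → ℂ) (M : Op n) :
    pauliSum f M = ∑ s : PauliString n, (M * s.op).trace / 2 ^ n * f s := rfl

theorem pauliSum_smul (f : PauliString n → ℂ) (z : ℂ) (M : Op n) :
    pauliSum f (z • M) = z * pauliSum f M := by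
  simp only [pauliSum, AddMonoidHom.coe_mk, ZeroHom.coe_mk, smul_mul_assoc, trace_smul,
    smul_eq_mul, Finset.mul_sum, mul_div_assoc, mul_assoc]

theorem pauliSum_op (f : PauliString n → ℂ) (u : PauliString n) : pauliSum f u.op = f u := by
  simp [pauliSum, PauliString.trace_op_mul, ite_div, ite_mul]

/-- The transition amplitude between Pauli strings in layer `k`. -/
noncomputable def amp (s s' : PauliString n) : ℂ :=
  (s.op * c.layer k * s'.op * (c.layer k)ᴴ).trace / 2 ^ n

/-- One step of the Pauli-path recursion, carried out by branching at `T` gates instead of summing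
over all Pauli strings. -/
theorem sum_amp_mul {l : List (Fin n)} {s : PauliString n} (h : Enum l s) (η a : ℝ)
    (f : PauliString n → ℂ) :
    (tDec (c.isT k) η l s a).sum (fun x => ((x.2 * c.sgn k x.1 : ℝ) : ℂ) * f (c.cliff k x.1)) =
      ((a * η ^ l.length : ℝ) : ℂ) * ∑ s', c.amp k s s' * f s' := by
  have h2 := congrArg (pauliSum f) (c.layer_conj k h η a)
  rw [Dec.map_sum] at h2
  simp only [pauliSum_smul, pauliSum_op] at h2
  rw [h2, pauliSum_apply]
  refine congrArg _ (Finset.sum_congr rfl fun s' _ => ?_)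
  have : ((c.layer k)ᴴ * s.op * c.layer k * s'.op).trace =
      (s.op * c.layer k * s'.op * (c.layer k)ᴴ).trace := by
    rw [mul_assoc, mul_assoc, trace_mul_comm, ← mul_assoc]
  rw [this, amp]

theorem sgn_zero : c.sgn k 0 = 1 := by
  refine Finset.prod_eq_one fun i _ => ?_
  rw [c.negAt_zero k rfl rfl]; rfl

theorem layer_unitary : (c.layer k)ᴴ * c.layer k = 1 := by
  have h := c.layer_conj k (l := []) (s := 0) ⟨List.nodup_nil, by simp⟩ 1 1
  simpa [tDec, Dec.sum, sgn_zero, cliff_zero, PauliString.op_zero] using h.symm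

end Circuit

end PauliPath

namespace PauliPath

variable {n d : ℕ} {A : Architecture n d}

/-! ### The truncated Pauli-path sum as a recursion -/

/-- The truncated sum over all Pauli paths that end with `s` after `k` layers, for transition
amplitudes `a`, initial values `g` and damping factor `x`. -/
noncomputable def pathSum (a : ℕ → PauliString n → PauliString n → ℂ) (g : PauliString n → ℂ)
    (x : ℂ) : ℕ → PauliString n → ℕ → ℂ
  | 0, s, w => if s.weight ≤ w then x ^ s.weight * g s else 0
  | k + 1, s, w => if s.weight ≤ w then
      x ^ s.weight * ∑ s', a k s s' * pathSum a g x k s' (w - s.weight) else 0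

/-- The sum over all paths is evaluated from the last string of the path to the first. -/
theorem sum_path_eq (a : ℕ → PauliString n → PauliString n → ℂ) (g : PauliString n → ℂ)
    (x : ℂ) (k : ℕ) (s : PauliString n) (w : ℕ) :
    ∑ t : Path n k, (if t (Fin.last k) = s ∧ t.weight ≤ w then
      (∏ j : Fin k, a j (t j.succ) (t j.castSucc)) * g (t 0) * x ^ t.weight else 0) =
      pathSum a g x k s w := by
  induction k generalizing s w with
  | zero =>
    rw [pathSum, Fintype.sum_equiv (Equiv.funUnique (Fin 1) (PauliString n)) _
      (fun u => if u = s ∧ u.weight ≤ w then g u * x ^ u.weight else 0)]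
    · by_cases h : s.weight ≤ w
      · rw [Finset.sum_eq_single s]
        · simp [h, mul_comm]
        · intro u _ hu; simp [hu]
        · simp
      · rw [if_neg h]
        refine Finset.sum_eq_zero fun u _ => if_neg ?_
        rintro ⟨rfl, h'⟩
        exact h h'
    · intro t
      simp [Path.weight]
  | succ k ih =>
    rw [pathSum]
    have h1 : ∀ f : Path n (k + 1) → ℂ, ∑ t, f t =
        ∑ u : PauliString n, ∑ t : Path n k, f (Fin.snoc (α := fun _ => PauliString n) t u) := by
      intro f
      rw [← Fintype.sum_prod_type']
      exact (Fintype.sum_equiv (Fin.snocEquiv fun _ : Fin (k + 2) => PauliString n) _ _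
        fun _ => rfl).symm
    rw [h1]
    have hw : ∀ (t : Path n k) (u : PauliString n),
        Path.weight (d := k + 1) (Fin.snoc (α := fun _ => PauliString n) t u) =
          t.weight + u.weight := by
      intro t u
      rw [Path.weight, Fin.sum_univ_castSucc]
      simp [Path.weight]
    have h0 : ∀ (t : Path n k) (u : PauliString n),
        Fin.snoc (α := fun _ => PauliString n) t u 0 = t 0 := by
      intro t u
      exact Fin.snoc_castSucc (α := fun _ => PauliString n) u t 0
    have hp : ∀ (t : Path n k) (u : PauliString n), (∏ j : Fin (k + 1),
        a j (Fin.snoc (α := fun _ => PauliString n) t u j.succ)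
          (Fin.snoc (α := fun _ => PauliString n) t u j.castSucc)) =
        (∏ j : Fin k, a j (t j.succ) (t j.castSucc)) * a k u (t (Fin.last k)) := by
      intro t u
      rw [Fin.prod_univ_castSucc]
      congr 1
      · refine Finset.prod_congr rfl fun j _ => ?_
        rw [Fin.snoc_castSucc, Fin.succ_castSucc, Fin.snoc_castSucc]
        rfl
      · rw [Fin.snoc_castSucc, Fin.succ_last, Fin.snoc_last]
        rfl
    rw [Finset.sum_eq_single s]
    · simp only [Fin.snoc_last, hw, h0, hp, true_and]
      by_cases h : s.weight ≤ w
      · rw [if_pos h]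
        simp only [← ih, Finset.mul_sum]
        rw [Finset.sum_comm]
        refine Finset.sum_congr rfl fun t _ => ?_
        rw [Finset.sum_eq_single (t (Fin.last k))]
        · by_cases h' : t.weight + s.weight ≤ w
          · rw [if_pos h', if_pos ⟨rfl, by omega⟩, pow_add]
            ring
          · rw [if_neg h', if_neg (by omega)]
            simp
        · intro u _ hu
          rw [if_neg (fun h => hu h.1.symm)]
          simp
        · simp
      · rw [if_neg h]
        exact Finset.sum_eq_zero fun t _ => if_neg (by omega)
    · intro u _ hu
      exact Finset.sum_eq_zero fun t _ => if_neg (by simp [hu])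
    · simp

theorem trace_observable_mul {N : ℕ} (a : Fin N → ℝ) (O : Fin N → PauliString n) (M : Op n) :
    (observable a O * M).trace = ∑ r, (a r : ℂ) * ((O r).op * M).trace := by
  simp [observable, Finset.sum_mul, trace_sum]

namespace Circuit

variable (c : Circuit A)

/-- The transition amplitudes of all layers. -/
noncomputable def amps (k : ℕ) (s s' : PauliString n) : ℂ :=
  if h : k < d then c.amp ⟨k, h⟩ s s' else 0

/-- The truncated Pauli-path sum for the observable `s` and the first `k` layers. -/
noncomputable def trunc (p : ℝ) (ρ : Op n) (k : ℕ) (s : PauliString n) (w : ℕ) : ℂ :=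
  pathSum c.amps (fun s => (s.op * ρ).trace) (1 - p) k s w

theorem trunc_of_lt (p : ℝ) (ρ : Op n) (k : ℕ) {s : PauliString n} {w : ℕ} (h : w < s.weight) :
    c.trunc p ρ k s w = 0 := by
  cases k <;> rw [trunc, pathSum, if_neg (not_le.2 h)]

/-- The truncated Pauli-path sum of an observable is computed for each of its Pauli strings. -/
theorem truncatedValue_eq {N : ℕ} (p : ℝ) (ρ : Op n) (a : Fin N → ℝ) (O : Fin N → PauliString n)
    (l : ℕ) : c.truncatedValue p ρ (observable a O) l = ∑ r, (a r : ℂ) * c.trunc p ρ d (O r) l := by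
  have h1 : ∀ t : Path n d, c.pathValue ρ (observable a O) t = ∑ r, (a r : ℂ) *
      (if t (Fin.last d) = O r then
        (∏ j : Fin d, c.amps j (t j.succ) (t j.castSucc)) * ((t 0).op * ρ).trace else 0) := by
    intro t
    have h2 : (∏ k : Fin d, ((t k.succ).op * c.layer k * (t k.castSucc).op * (c.layer k)ᴴ).trace) =
        (2 ^ n) ^ d * ∏ j : Fin d, c.amps j (t j.succ) (t j.castSucc) := by
      have : (2 ^ n : ℂ) ^ d = ∏ _j : Fin d, (2 ^ n : ℂ) := by simp
      rw [this, ← Finset.prod_mul_distrib]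
      refine Finset.prod_congr rfl fun j _ => ?_
      simp only [amps, amp, j.2, dif_pos, Fin.eta]
      field_simp
    rw [pathValue, h2, trace_observable_mul, Finset.mul_sum, Finset.sum_mul, Finset.sum_mul]
    refine Finset.sum_congr rfl fun r _ => ?_
    rw [PauliString.trace_op_mul]
    by_cases h : t (Fin.last d) = O r
    · rw [if_pos h, if_pos h.symm, mul_add n d 1, pow_add, mul_one, pow_mul]
      field_simp
    · rw [if_neg h, if_neg (Ne.symm h)]
      simp
  rw [truncatedValue, Finset.sum_filter]
  simp only [h1, Finset.sum_mul, ← Finset.sum_filter]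
  rw [Finset.sum_comm]
  refine Finset.sum_congr rfl fun r _ => ?_
  rw [trunc, ← sum_path_eq, Finset.mul_sum, Finset.sum_filter]
  refine Finset.sum_congr rfl fun t _ => ?_
  by_cases h : t.weight ≤ l <;> by_cases h' : t (Fin.last d) = O r <;> simp [h, h', mul_assoc]

/-! ### The noisy state as a recursion -/

/-- The state after noise, `k` layers, and noise after each of them. -/
noncomputable def state (p : ℝ) (ρ : Op n) : ℕ → Op n
  | 0 => noise p ρ
  | k + 1 => if h : k < d then
      noise p (c.layer ⟨k, h⟩ * state p ρ k * (c.layer ⟨k, h⟩)ᴴ) else 0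

theorem noisy_eq (p : ℝ) (ρ : Op n) : c.noisy p ρ = c.state p ρ d := by
  have h : ∀ m (hm : m ≤ d), Fin.foldl m (fun M k => noise p (c.layer (Fin.castLE hm k) * M *
      (c.layer (Fin.castLE hm k))ᴴ)) (noise p ρ) = c.state p ρ m := by
    intro m
    induction m with
    | zero => intro hm; simp [state]
    | succ m ih =>
      intro hm
      rw [Fin.foldl_succ_last, state, dif_pos (Nat.lt_of_succ_le hm), ← ih (by omega)]
      rfl
  exact h d le_rfl

theorem noisyValue_eq {N : ℕ} (p : ℝ) (ρ : Op n) (a : Fin N → ℝ) (O : Fin N → PauliString n) :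
    c.noisyValue p ρ (observable a O) =
      ∑ r, (a r : ℂ) * ((O r).op * c.state p ρ d).trace := by
  rw [noisyValue, noisy_eq, trace_observable_mul]

theorem posSemidef_state {p : ℝ} (h0 : 0 ≤ p) (h1 : p ≤ 1) {ρ : Op n} (hρ : ρ.PosSemidef)
    (k : ℕ) : (c.state p ρ k).PosSemidef := by
  induction k with
  | zero => exact posSemidef_noise h0 h1 hρ
  | succ k ih =>
    rw [state]
    split_ifs with h
    · exact posSemidef_noise h0 h1 (ih.mul_mul_conjTranspose_same _)
    · exact Matrix.PosSemidef.zero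

theorem trace_conj_layer (k : Fin d) (M : Op n) :
    (c.layer k * M * (c.layer k)ᴴ).trace = M.trace := by
  rw [trace_mul_comm, ← mul_assoc, layer_unitary, one_mul]

theorem trace_state {p : ℝ} {ρ : Op n} (hρ : ρ.trace = 1) {k : ℕ} (hk : k ≤ d) :
    (c.state p ρ k).trace = 1 := by
  induction k with
  | zero => rw [state, trace_noise, hρ]
  | succ k ih =>
    rw [state, dif_pos (Nat.lt_of_succ_le hk), trace_noise, trace_conj_layer, ih (by omega)]

/-- Heisenberg picture: expectation values after a layer in terms of those before. -/
theorem trace_op_conj_layer (k : Fin d) (s : PauliString n) (M : Op n) :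
    (s.op * (c.layer k * M * (c.layer k)ᴴ)).trace = ∑ s', c.amp k s s' * (s'.op * M).trace := by
  have hs : Enum s.support.toList s := ⟨Finset.nodup_toList _, fun i => by
    rw [Finset.mem_toList, PauliString.mem_support]⟩
  have h := c.sum_amp_mul k hs 1 1 fun s' => (s'.op * M).trace
  rw [one_pow, one_mul, Complex.ofReal_one, one_mul] at h
  rw [← h]
  let φ : Op n →+ ℂ :=
    { toFun := fun B => (B * M).trace
      map_zero' := by simp
      map_add' := fun B B' => by rw [add_mul, trace_add] }
  have h2 := congrArg φ (c.layer_conj k hs 1 1)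
  rw [Dec.map_sum, one_pow, one_mul, Complex.ofReal_one, one_smul] at h2
  have h3 : (s.op * (c.layer k * M * (c.layer k)ᴴ)).trace =
      φ ((c.layer k)ᴴ * s.op * c.layer k) := by
    change _ = ((c.layer k)ᴴ * s.op * c.layer k * M).trace
    rw [← mul_assoc, trace_mul_comm]
    simp only [mul_assoc]
  rw [h3, ← h2]
  congr 1
  funext x
  change ((_ • (c.cliff k x.1).op) * M).trace = _
  rw [smul_mul_assoc, trace_smul, smul_eq_mul]

/-! ### The simulated computation -/

/-- The computation of one observable, as a decision tree: `k` layers are left, `l` enumerates the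
support of the current string `s`, `w` is the weight that the rest of the path may still have, and
`a` is the current coefficient. The values at the leaves sum up to the truncated Pauli-path sum. -/
noncomputable def sim (p : ℝ) (β : Fin n → Fin 4 → ℝ) :
    (k : ℕ) → k ≤ d → List (Fin n) → PauliString n → ℕ → ℝ → Dec ℝ
  | 0, _, l, s, _, a => .ret (a * (l.map fun i => (1 - p) * β i (s i)).prod)
  | k + 1, hk, l, s, w, a => if l = [] then .ret a else
      (tDec (c.isT ⟨k, hk⟩) (1 - p) l s a).bind fun x =>
        if (c.next ⟨k, hk⟩ l x.1).length ≤ w then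
          sim p β k (Nat.le_of_succ_le hk) (c.next ⟨k, hk⟩ l x.1) (c.cliff ⟨k, hk⟩ x.1)
            (w - (c.next ⟨k, hk⟩ l x.1).length) (x.2 * c.sgn ⟨k, hk⟩ x.1)
        else .ret 0

/-- The Bloch vectors of the initial state. -/
noncomputable def bloch (ρ : Fin n → QubitState) (i : Fin n) (P : Fin 4) : ℝ :=
  (pauli P * (ρ i).mat).trace.re

theorem trace_op_mul_productState (ρ : Fin n → QubitState) {l : List (Fin n)} {s : PauliString n}
    (h : Enum l s) :
    (s.op * productState ρ).trace = ((l.map fun i => bloch ρ i (s i)).prod : ℝ) := by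
  have him : ∀ i P, (pauli P * (ρ i).mat).trace = (bloch ρ i P : ℂ) := by
    intro i P
    have h1 : star (pauli P * (ρ i).mat).trace = (pauli P * (ρ i).mat).trace := by
      rw [← trace_conjTranspose, conjTranspose_mul, (ρ i).pos.1.eq, pauli_conjTranspose,
        trace_mul_comm]
    exact Complex.ext rfl (Complex.conj_eq_iff_im.1 h1)
  rw [PauliString.op, productState, tensor_mul, trace_tensor]
  simp only [him]
  rw [← List.prod_toFinset _ h.1, Complex.ofReal_prod]
  refine (Finset.prod_subset (Finset.subset_univ _) fun i _ hi => ?_).symm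
  have h0 : s i = 0 := by
    by_contra h0
    exact hi (List.mem_toFinset.2 ((h.2 i).2 h0))
  rw [h0, bloch, pauli_zero, one_mul, (ρ i).trace_one]
  rfl

theorem amp_zero (k : Fin d) (s' : PauliString n) : c.amp k 0 s' = if s' = 0 then 1 else 0 := by
  rw [amp, PauliString.op_zero, one_mul, trace_conj_layer]
  have h := PauliString.trace_op_mul s' 0
  rw [PauliString.op_zero, mul_one] at h
  rw [h]
  split_ifs <;> simp

/-- A path that reaches the identity stays there at no weight, so its truncated sum is the trace of
the initial state. This is why the simulation may stop at an empty support. -/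
theorem trunc_zero {p : ℝ} (ρ : Fin n → QubitState) {k : ℕ} (hk : k ≤ d) (w : ℕ) :
    c.trunc p (productState ρ) k 0 w = 1 := by
  have h0 : (0 : PauliString n).weight = 0 := PauliString.weight_eq_zero.2 rfl
  induction k generalizing w with
  | zero => simp [trunc, pathSum, h0, PauliString.op_zero, trace_productState]
  | succ k ih =>
    have := ih (by omega) w
    rw [trunc] at this
    simp [trunc, pathSum, h0, amps, Nat.lt_of_succ_le hk, amp_zero, this]

/-- The recursion of `sim` does not charge for the weight of the current string, in contrast to
`trunc`; the shift of the cut-off accounts for that. -/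
theorem sum_sim (p : ℝ) (ρ : Fin n → QubitState) (k : ℕ) (hk : k ≤ d) {l : List (Fin n)}
    {s : PauliString n} (h : Enum l s) (w : ℕ) (a : ℝ) :
    (((c.sim p (bloch ρ) k hk l s w a).sum id : ℝ) : ℂ) =
      a * c.trunc p (productState ρ) k s (w + s.weight) := by
  induction k generalizing l s w a with
  | zero =>
    rw [sim, trunc, pathSum, if_pos (Nat.le_add_left _ _), trace_op_mul_productState ρ h,
      ← h.length_eq]
    simp only [Dec.sum, id, List.prod_map_mul]
    simp
  | succ k ih =>
    rw [sim]
    by_cases hl : l = []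
    · have hs : s = 0 := PauliString.weight_eq_zero.1 (by rw [← h.length_eq, hl]; rfl)
      rw [if_pos hl, hs, trunc_zero c ρ hk]
      simp [Dec.sum]
    · rw [if_neg hl, Dec.sum_bind]
      have h1 := Dec.map_sum (Complex.ofRealHom : ℝ →+ ℂ) (fun x : PauliString n × ℝ =>
        (if (c.next ⟨k, hk⟩ l x.1).length ≤ w then
          c.sim p (bloch ρ) k (Nat.le_of_succ_le hk) (c.next ⟨k, hk⟩ l x.1) (c.cliff ⟨k, hk⟩ x.1)
            (w - (c.next ⟨k, hk⟩ l x.1).length) (x.2 * c.sgn ⟨k, hk⟩ x.1)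
        else .ret 0).sum id) (tDec (c.isT ⟨k, hk⟩) (1 - p) l s a)
      refine h1.trans ?_
      rw [trunc, pathSum, if_pos (Nat.le_add_left _ _), Nat.add_sub_cancel]
      have h2 := c.sum_amp_mul ⟨k, hk⟩ h (1 - p) a
        fun s' => c.trunc p (productState ρ) k s' w
      rw [tDec_forall (Enum l) (fun s i R hs _ h1 h2 => hs.update h1 h2) ?_ l s a h, h2]
      · simp only [amps, Nat.lt_of_succ_le hk, dif_pos, trunc, h.length_eq]
        push_cast
        ring
      · intro x hx
        have hx' := c.enum_next ⟨k, hk⟩ hx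
        split_ifs with hw
        · refine (ih (Nat.le_of_succ_le hk) hx' _ _).trans ?_
          rw [hx'.length_eq] at hw ⊢
          rw [Nat.sub_add_cancel hw]
        · rw [hx'.length_eq] at hw
          rw [trunc_of_lt c p _ k (not_le.1 hw)]
          simp [Dec.sum]

/-- The computation for a Pauli string of the observable with coefficient `a`. -/
noncomputable def simTop (p : ℝ) (β : Fin n → Fin 4 → ℝ) (L : ℕ) (l : List (Fin n))
    (s : PauliString n) (a : ℝ) : Dec ℝ :=
  if l.length ≤ L then c.sim p β d le_rfl l s (L - l.length) a else .ret 0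

theorem sum_simTop (p : ℝ) (ρ : Fin n → QubitState) (L : ℕ) {l : List (Fin n)}
    {s : PauliString n} (h : Enum l s) (a : ℝ) :
    (((c.simTop p (bloch ρ) L l s a).sum id : ℝ) : ℂ) =
      a * c.trunc p (productState ρ) d s L := by
  rw [simTop]
  split_ifs with hw
  · rw [sum_sim c p ρ d le_rfl h, ← h.length_eq, Nat.sub_add_cancel hw]
  · rw [h.length_eq] at hw
    rw [trunc_of_lt c p _ d (not_le.1 hw)]
    simp [Dec.sum]

end Circuit

end PauliPath

namespace PauliPath

variable {n d : ℕ} {A : Architecture n d}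

/-! ### Counting branches -/

/-- The letters on qubit `i` to which the `T` gates on the qubits of `l` may turn the string `s`. -/
def branchLetters (isT : Fin n → ℕ) (l : List (Fin n)) (s : PauliString n) (i : Fin n) :
    Finset (Fin 4) :=
  if i ∈ l ∧ isT i = 1 ∧ (s i = 1 ∨ s i = 2) then {1, 2} else {s i}

/-- Different leaves hold different strings, so the sum over the leaves is at most the sum over all
strings with suitable letters. -/
theorem sum_tDec_le (isT : Fin n → ℕ) (η : ℝ) {l : List (Fin n)} (hl : l.Nodup)
    (s : PauliString n) (a : ℝ) (f : PauliString n → ℝ≥0∞) :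
    (tDec isT η l s a).sum (fun x => f x.1) ≤
      ∑ u ∈ Fintype.piFinset (branchLetters isT l s), f u := by
  induction l generalizing s a with
  | nil =>
    have : Fintype.piFinset (branchLetters isT [] s) = {s} := by
      have h : branchLetters isT [] s = fun i => {s i} := by funext i; simp [branchLetters]
      rw [h, Fintype.piFinset_singleton]
    rw [this, Finset.sum_singleton]
    exact le_rfl
  | cons i l ih =>
    obtain ⟨hi, hl⟩ := List.nodup_cons.1 hl
    by_cases h : isT i = 1 ∧ (s i = 1 ∨ s i = 2)
    · rw [tDec, if_pos h]
      have hlet : ∀ R, branchLetters isT l (Function.update s i R) i = {R} := by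
        intro R; simp [branchLetters, hi]
      refine (add_le_add (ih hl _ _) (ih hl _ _)).trans ?_
      simp only [Bool.false_eq_true, if_false, if_true]
      rw [← Finset.sum_union]
      · refine Finset.sum_le_sum_of_subset fun u hu => ?_
        rw [Finset.mem_union, Fintype.mem_piFinset, Fintype.mem_piFinset] at hu
        rw [Fintype.mem_piFinset]
        intro j
        by_cases hj : j = i
        · subst hj
          have h0 : branchLetters isT (j :: l) s j = {1, 2} := by simp [branchLetters, h]
          rw [h0]
          rcases hu with hu | hu <;> have := hu j <;> rw [hlet] at this <;> simp_all
        · have h0 : ∀ R, branchLetters isT l (Function.update s i R) j =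
              branchLetters isT (i :: l) s j := by
            intro R; simp [branchLetters, hj]
          rcases hu with hu | hu <;> have := hu j <;> rwa [h0] at this
      · rw [Finset.disjoint_left]
        intro u hu hu'
        have h1 := Fintype.mem_piFinset.1 hu i
        have h2 := Fintype.mem_piFinset.1 hu' i
        rw [hlet, Finset.mem_singleton] at h1 h2
        exact absurd (h1.symm.trans h2) (by decide)
    · rw [tDec, if_neg h]
      refine (ih hl _ _).trans (le_of_eq ?_)
      congr 2
      funext j
      by_cases hj : j = i
      · subst hj; simp [branchLetters, h]
      · simp [branchLetters, hj]

/-- The coefficients at the leaves are bounded by `1`, as each branching divides them by `√2`. -/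
theorem enorm_sum_tDec_le (isT : Fin n → ℕ) (l : List (Fin n)) (s : PauliString n) (a : ℝ)
    (f : PauliString n → ℂ) :
    ‖(tDec isT 1 l s a).sum (fun x => (x.2 : ℂ) * f x.1)‖ₑ ≤
      ‖a‖ₑ * (tDec isT 1 l s a).sum (fun x => ‖f x.1‖ₑ) := by
  induction l generalizing s a with
  | nil =>
    simp only [tDec, Dec.sum, enorm_mul]
    rw [← ofReal_norm, Complex.norm_real, ofReal_norm]
  | cons i l ih =>
    rw [tDec]
    split_ifs with h
    · simp only [Dec.sum]
      have hc : ∀ b : Bool, ‖a * 1 / √2 * Circuit.rsign b‖ₑ ≤ ‖a‖ₑ := by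
        intro b
        rw [← ofReal_norm, ← ofReal_norm, norm_mul, mul_one, norm_div,
          Real.norm_eq_abs (Circuit.rsign b), Circuit.abs_rsign, mul_one]
        refine ENNReal.ofReal_le_ofReal (div_le_self (norm_nonneg _) ?_)
        rw [Real.norm_of_nonneg (Real.sqrt_nonneg _)]
        exact Real.one_le_sqrt.2 (by norm_num)
      rw [mul_add]
      refine (enorm_add_le _ _).trans (add_le_add ?_ ?_)
      · exact (ih _ _).trans (mul_le_mul_left (hc _) _)
      · exact (ih _ _).trans (mul_le_mul_left (hc _) _)
    · exact (ih _ _).trans (by rw [mul_one])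

namespace Circuit

/-- A weighted count of the branches of the computation for the observable `s` and the first `k`
layers: it is cut off as soon as the total weight exceeds `w`, every unit of weight contributes a
factor `x`, and a branch that is not cut off a factor `y`. -/
noncomputable def branchSum (c : Circuit A) (x y : ℝ≥0∞) :
    (k : ℕ) → k ≤ d → PauliString n → ℕ → ℝ≥0∞
  | 0, _, s, w => if s.weight ≤ w then x ^ s.weight * y else x ^ s.weight
  | k + 1, hk, s, w => if s.weight ≤ w then x ^ s.weight *
      ∑ u ∈ Fintype.piFinset (branchLetters (c.isT ⟨k, hk⟩) s.support.toList s),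
        branchSum c x y k (Nat.le_of_succ_le hk) (c.cliff ⟨k, hk⟩ u) (w - s.weight)
      else x ^ s.weight

variable (c : Circuit A)

/-- The letters do not depend on the order in which the support is listed. -/
theorem branchLetters_congr (isT : Fin n → ℕ) {l : List (Fin n)} {s : PauliString n}
    (h : Enum l s) : branchLetters isT s.support.toList s = branchLetters isT l s := by
  funext i
  simp only [branchLetters, Finset.mem_toList, PauliString.mem_support, h.2]

theorem one_le_branchSum (k : ℕ) (hk : k ≤ d) (s : PauliString n) (w : ℕ) :
    1 ≤ c.branchSum 1 1 k hk s w := by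
  induction k generalizing s w with
  | zero => rw [branchSum]; split_ifs <;> simp
  | succ k ih =>
    rw [branchSum]
    split_ifs
    · rw [one_pow, one_mul]
      refine (ih (Nat.le_of_succ_le hk) (c.cliff ⟨k, hk⟩ s) (w - s.weight)).trans ?_
      refine Finset.single_le_sum (f := fun u => c.branchSum 1 1 k (Nat.le_of_succ_le hk)
        (c.cliff ⟨k, hk⟩ u) (w - s.weight)) (fun _ _ => zero_le) ?_
      rw [Fintype.mem_piFinset]
      intro i
      unfold branchLetters
      split_ifs with h
      · rcases h.2.2 with h | h <;> simp [h]
      · simp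
    · simp

theorem count_sim_le (p : ℝ) (β : Fin n → Fin 4 → ℝ) (k : ℕ) (hk : k ≤ d) {l : List (Fin n)}
    {s : PauliString n} (h : Enum l s) (w : ℕ) (a : ℝ) :
    ((c.sim p β k hk l s w a).count : ℝ≥0∞) ≤ c.branchSum 1 1 k hk s (w + s.weight) := by
  classical
  induction k generalizing l s w a with
  | zero => rw [sim, branchSum]; simp [Dec.count, Dec.sum]
  | succ k ih =>
    by_cases hl : l = []
    · rw [sim, if_pos hl]
      refine le_trans ?_ (c.one_le_branchSum _ hk s _)
      simp [Dec.count, Dec.sum]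
    · rw [sim, if_neg hl, Dec.count, Dec.sum_bind]
      have h1 := Dec.map_sum (Nat.castAddMonoidHom ℝ≥0∞) (fun x : PauliString n × ℝ =>
        (if (c.next ⟨k, hk⟩ l x.1).length ≤ w then
          c.sim p β k (Nat.le_of_succ_le hk) (c.next ⟨k, hk⟩ l x.1) (c.cliff ⟨k, hk⟩ x.1)
            (w - (c.next ⟨k, hk⟩ l x.1).length) (x.2 * c.sgn ⟨k, hk⟩ x.1)
        else .ret 0).count) (tDec (c.isT ⟨k, hk⟩) (1 - p) l s a)
      refine (le_of_eq h1).trans ?_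
      rw [branchSum, if_pos (Nat.le_add_left _ _), Nat.add_sub_cancel, one_pow, one_mul,
        branchLetters_congr _ h]
      refine le_trans ?_ (sum_tDec_le _ (1 - p) h.1 s a _)
      let f : PauliString n × ℝ → ℝ≥0∞ := fun x => if Enum l x.1 then
        c.branchSum 1 1 k (Nat.le_of_succ_le hk) (c.cliff ⟨k, hk⟩ x.1) w else ⊤
      have hf := tDec_forall (isT := c.isT ⟨k, hk⟩) (η := 1 - p) (f := f)
        (g := fun x => c.branchSum 1 1 k (Nat.le_of_succ_le hk) (c.cliff ⟨k, hk⟩ x.1) w) (Enum l)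
        (fun s i R hs _ h1 h2 => hs.update h1 h2) (fun x hx => by simp [f, hx]) l s a h
      rw [← hf]
      refine Dec.sum_mono _ fun x => ?_
      by_cases hx : Enum l x.1
      · simp only [f, hx, if_true, Nat.coe_castAddMonoidHom]
        have hx' := c.enum_next ⟨k, hk⟩ hx
        split_ifs with hw
        · refine (ih (Nat.le_of_succ_le hk) hx' _ _).trans ?_
          rw [hx'.length_eq] at hw ⊢
          rw [Nat.sub_add_cancel hw]
        · refine le_trans ?_ (c.one_le_branchSum _ _ _ _)
          simp [Dec.count, Dec.sum]
      · simp [f, hx]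

theorem count_simTop_le (p : ℝ) (β : Fin n → Fin 4 → ℝ) (L : ℕ) {l : List (Fin n)}
    {s : PauliString n} (h : Enum l s) (a : ℝ) :
    ((c.simTop p β L l s a).count : ℝ≥0∞) ≤ c.branchSum 1 1 d le_rfl s L := by
  rw [simTop]
  split_ifs with hw
  · refine (c.count_sim_le p β d le_rfl h _ a).trans ?_
    rw [← h.length_eq, Nat.sub_add_cancel hw]
  · refine le_trans ?_ (c.one_le_branchSum _ _ _ _)
    simp [Dec.count, Dec.sum]

/-! ### The truncation error on a fixed circuit -/

/-- The contribution that is lost when a branch with string `s` is cut off. -/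
theorem norm_trace_op_mul_noise_le {p : ℝ} (h1 : p ≤ 1) {M : Op n} (hM : M.PosSemidef)
    (ht : M.trace = 1) (s : PauliString n) :
    ‖(s.op * noise p M).trace‖ₑ ≤ ENNReal.ofReal (1 - p) ^ s.weight := by
  have h := norm_trace_op_mul_le hM s
  rw [ht, Complex.one_re] at h
  rw [trace_op_mul_noise, ← ENNReal.ofReal_pow (by linarith), ← ofReal_norm, norm_mul,
    norm_pow]
  have : ‖(1 - p : ℂ)‖ = 1 - p := by
    rw [show (1 - p : ℂ) = ((1 - p : ℝ) : ℂ) by push_cast; rfl, Complex.norm_real,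
      Real.norm_of_nonneg (by linarith)]
  rw [this]
  exact ENNReal.ofReal_le_ofReal
    (mul_le_of_le_one_right (pow_nonneg (by linarith) _) h)

/-- As long as a branch is not cut off, exact value and truncated sum obey the same recursion, so
only the cut branches contribute to the error. -/
theorem enorm_sub_trunc_le {p : ℝ} (h0 : 0 ≤ p) (h1 : p ≤ 1) {ρ : Op n} (hρ : ρ.PosSemidef)
    (ht : ρ.trace = 1) (k : ℕ) (hk : k ≤ d) (s : PauliString n) (w : ℕ) :
    ‖(s.op * c.state p ρ k).trace - c.trunc p ρ k s w‖ₑ ≤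
      c.branchSum (ENNReal.ofReal (1 - p)) 0 k hk s w := by
  induction k generalizing s w with
  | zero =>
    rw [branchSum]
    split_ifs with hw
    · rw [trunc, pathSum, if_pos hw, state, trace_op_mul_noise, sub_self]
      simp
    · rw [trunc_of_lt c p ρ 0 (not_le.1 hw), sub_zero]
      exact norm_trace_op_mul_noise_le h1 hρ ht s
  | succ k ih =>
    have hk' : k ≤ d := Nat.le_of_succ_le hk
    rw [branchSum, state, dif_pos (Nat.lt_of_succ_le hk)]
    split_ifs with hw
    · have hs : Enum s.support.toList s := ⟨Finset.nodup_toList _, fun i => by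
        rw [Finset.mem_toList, PauliString.mem_support]⟩
      obtain ⟨D, hD⟩ : ∃ D : PauliString n → ℂ, ∀ s', D s' = (s'.op * c.state p ρ k).trace -
        c.trunc p ρ k s' (w - s.weight) := ⟨_, fun _ => rfl⟩
      have e : (s.op * noise p (c.layer ⟨k, hk⟩ * c.state p ρ k * (c.layer ⟨k, hk⟩)ᴴ)).trace -
          c.trunc p ρ (k + 1) s w = ((1 - p : ℝ) : ℂ) ^ s.weight *
          (tDec (c.isT ⟨k, hk⟩) 1 s.support.toList s 1).sum (fun x => (x.2 : ℂ) *
            ((c.sgn ⟨k, hk⟩ x.1 : ℂ) * D (c.cliff ⟨k, hk⟩ x.1))) := by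
        have h2 := c.sum_amp_mul ⟨k, hk⟩ hs 1 1 D
        simp only [Complex.ofReal_mul, mul_assoc] at h2
        rw [h2, trace_op_mul_noise, trace_op_conj_layer, trunc, pathSum, if_pos hw]
        simp only [hD, mul_sub, Finset.sum_sub_distrib, amps, Nat.lt_of_succ_le hk, dif_pos, trunc]
        push_cast
        ring
      rw [e, enorm_mul]
      refine mul_le_mul' ?_ ?_
      · rw [enorm_pow, ← ofReal_norm, Complex.norm_real,
          Real.norm_of_nonneg (by linarith)]
      · refine (enorm_sum_tDec_le _ _ _ _
          (fun u => (c.sgn ⟨k, hk⟩ u : ℂ) * D (c.cliff ⟨k, hk⟩ u))).trans ?_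
        rw [enorm_one, one_mul]
        refine (sum_tDec_le _ 1 hs.1 s 1 (fun u => ‖((c.sgn ⟨k, hk⟩ u : ℂ) *
          D (c.cliff ⟨k, hk⟩ u))‖ₑ)).trans (Finset.sum_le_sum fun u _ => ?_)
        have hsg : ‖(c.sgn ⟨k, hk⟩ u : ℂ)‖ₑ = 1 := by
          rw [← ofReal_norm, Complex.norm_real, Real.norm_eq_abs, abs_sgn]
          simp
        rw [enorm_mul, hsg, one_mul]
        rw [hD]
        exact ih hk' _ _
    · rw [trunc_of_lt c p ρ (k + 1) (not_le.1 hw), sub_zero]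
      exact norm_trace_op_mul_noise_le h1
        ((c.posSemidef_state h0 h1 hρ k).mul_mul_conjTranspose_same _)
        (by rw [trace_conj_layer, c.trace_state ht hk']) s

/-! ### Expectations over random circuits -/

/-- The expectation of a nonnegative function. -/
noncomputable def expect (μ : PMF (Circuit A)) (F : Circuit A → ℝ≥0∞) : ℝ≥0∞ := ∑' c, μ c * F c

section Expect

variable (μ : PMF (Circuit A))

theorem expect_mono {F G : Circuit A → ℝ≥0∞} (h : ∀ c, F c ≤ G c) : expect μ F ≤ expect μ G :=
  ENNReal.tsum_le_tsum fun c => mul_le_mul_right (h c) _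

theorem expect_add (F G : Circuit A → ℝ≥0∞) :
    expect μ (fun c => F c + G c) = expect μ F + expect μ G := by
  simp only [expect, mul_add, ENNReal.tsum_add]

theorem expect_const_mul (a : ℝ≥0∞) (F : Circuit A → ℝ≥0∞) :
    expect μ (fun c => a * F c) = a * expect μ F := by
  simp only [expect, ← ENNReal.tsum_mul_left]
  exact tsum_congr fun c => by ring

theorem expect_sum {ι : Type*} (S : Finset ι) (F : ι → Circuit A → ℝ≥0∞) :
    expect μ (fun c => ∑ i ∈ S, F i c) = ∑ i ∈ S, expect μ (F i) := by
  classical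
  induction S using Finset.induction_on with
  | empty => simp [expect]
  | insert i S hi ih => simp only [Finset.sum_insert hi, expect_add, ih]

theorem expect_const (a : ℝ≥0∞) : expect μ (fun _ => a) = a := by
  simp only [expect, ENNReal.tsum_mul_right, μ.tsum_coe, one_mul]

open scoped Classical in
/-- The random model, for expectations: if `F` does not see the gate at `x`, a `T` gate there costs
a factor `Q`. -/
theorem expect_T_le {Q : ℝ} {μ : PMF (Circuit A)} (hμ : IsRandomModel Q μ) (x : A.Pos1)
    (F : Circuit A → ℝ≥0∞) (hF : ∀ c c', AgreeOff x c c' → F c' = F c) :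
    expect μ (fun c => F c * if c.one x = Gate1.T then 1 else 0) ≤
      ENNReal.ofReal Q * expect μ F := by
  -- Group the circuits by their gates at the positions other than `x`.
  let g : Circuit A → Circuit A := fun c => { c with one := Function.update c.one x Gate1.T }
  rw [expect, expect, ← ENNReal.tsum_mul_left, ← ENNReal.tsum_fiberwise _ g,
    ← ENNReal.tsum_fiberwise (fun c => ENNReal.ofReal Q * (μ c * F c)) g]
  refine ENNReal.tsum_le_tsum fun b => ?_
  by_cases hb : ∃ c0, g c0 = b
  · obtain ⟨c0, rfl⟩ := hb
    have hfib : ∀ c, c ∈ g ⁻¹' {g c0} ↔ AgreeOff x c0 c := by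
      intro c
      rw [Set.mem_preimage, Set.mem_singleton_iff]
      constructor
      · intro h
        have h1 := congrArg Circuit.one h
        have h2 := congrArg Circuit.two h
        refine ⟨fun y hy => ?_, h2⟩
        have := congrFun h1 y
        simpa [g, Function.update_of_ne hy] using this
      · rintro ⟨h1, h2⟩
        have : Function.update c.one x Gate1.T = Function.update c0.one x Gate1.T := by
          funext y
          by_cases hy : y = x
          · subst hy; simp
          · rw [Function.update_of_ne hy, Function.update_of_ne hy, h1 y hy]
        simp only [g, this, h2]
    have hconst : ∀ c : g ⁻¹' {g c0}, F c = F c0 := fun c => hF c0 c ((hfib c).1 c.2)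
    have e1 : ∑' c : g ⁻¹' {g c0}, μ c * (F c * if (c : Circuit A).one x = Gate1.T then 1 else 0) =
        F c0 * μ.toOuterMeasure {c' | AgreeOff x c0 c' ∧ c'.one x = Gate1.T} := by
      rw [PMF.toOuterMeasure_apply, ← ENNReal.tsum_mul_left,
        tsum_subtype (g ⁻¹' {g c0})
          (fun c => μ c * (F c * if c.one x = Gate1.T then 1 else 0))]
      refine tsum_congr fun c => ?_
      by_cases hc : AgreeOff x c0 c
      · rw [Set.indicator_of_mem ((hfib c).2 hc), hF c0 c hc]
        by_cases hT : c.one x = Gate1.T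
        · simp only [Set.indicator, Set.mem_ofPred_eq, hc, hT, and_self, if_true]; ring
        · simp only [Set.indicator, Set.mem_ofPred_eq, hT, and_false, if_false, mul_zero]
      · rw [Set.indicator_of_notMem (fun h => hc ((hfib c).1 h))]
        simp only [Set.indicator, Set.mem_ofPred_eq, hc, false_and, if_false, mul_zero]
    have e2 : ∑' c : g ⁻¹' {g c0}, ENNReal.ofReal Q * (μ c * F c) =
        F c0 * (ENNReal.ofReal Q * μ.toOuterMeasure {c' | AgreeOff x c0 c'}) := by
      rw [PMF.toOuterMeasure_apply, ← ENNReal.tsum_mul_left, ← ENNReal.tsum_mul_left,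
        tsum_subtype (g ⁻¹' {g c0}) (fun c => ENNReal.ofReal Q * (μ c * F c))]
      refine tsum_congr fun c => ?_
      by_cases hc : AgreeOff x c0 c
      · rw [Set.indicator_of_mem ((hfib c).2 hc), hF c0 c hc]
        simp only [Set.indicator, Set.mem_ofPred_eq, hc, if_true]
        ring
      · rw [Set.indicator_of_notMem (fun h => hc ((hfib c).1 h))]
        simp only [Set.indicator, Set.mem_ofPred_eq, hc, if_false, mul_zero]
    refine (le_of_eq e1).trans (le_trans ?_ (le_of_eq e2.symm))
    exact mul_le_mul_right (hμ x c0) _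
  · have : IsEmpty (g ⁻¹' {b}) := ⟨fun c => hb ⟨c.1, c.2⟩⟩
    simp

/-- The function `F` does not depend on the first `k` layers. -/
def DependsFrom (k : ℕ) (F : Circuit A → ℝ≥0∞) : Prop :=
  ∀ c c' : Circuit A, (∀ x : A.Pos1, k ≤ x.1.1 → c'.one x = c.one x) →
    (∀ x : A.Pos2, k ≤ x.1.1 → c'.two x = c.two x) → F c' = F c

theorem isT_eq_of_agreeOff {k : Fin d} {i j : Fin n} (h : A.partner k i = i) {c c' : Circuit A}
    (hc : AgreeOff ⟨(k, i), h⟩ c c') (hij : j ≠ i) : c'.isT k j = c.isT k j := by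
  unfold isT
  split_ifs with hj
  · rw [hc.1 ⟨(k, j), hj⟩ (by simpa using hij)]
  · rfl

theorem isT_eq {k : Fin d} {i : Fin n} {c c' : Circuit A}
    (h1 : ∀ x : A.Pos1, (k : ℕ) ≤ x.1.1 → c'.one x = c.one x) : c'.isT k i = c.isT k i := by
  unfold isT
  split_ifs with h
  · rw [h1 ⟨(k, i), h⟩ le_rfl]
  · rfl

theorem cliff_eq {k : Fin d} {c c' : Circuit A}
    (h1 : ∀ x : A.Pos1, (k : ℕ) ≤ x.1.1 → c'.one x = c.one x)
    (h2 : ∀ x : A.Pos2, (k : ℕ) ≤ x.1.1 → c'.two x = c.two x) (u : PauliString n) :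
    c'.cliff k u = c.cliff k u := by
  funext i
  unfold cliff
  split_ifs with h h'
  · rw [h1 ⟨(k, i), h⟩ le_rfl]
  · rw [h2 ⟨(k, i), h'⟩ le_rfl]
  · rw [h2 ⟨(k, A.partner k i), _⟩ le_rfl]

/-- Every qubit of a layer contributes at most a factor `1 + Q` to the expected number of
branches, whatever the later layers are. -/
theorem expect_prod_le {Q : ℝ} {μ : PMF (Circuit A)} (hμ : IsRandomModel Q μ) (k : Fin d)
    (F : Circuit A → ℝ≥0∞) (hF : DependsFrom (k + 1) F) (S : Finset (Fin n)) :
    expect μ (fun c => F c * ∏ i ∈ S, (1 + (c.isT k i : ℝ≥0∞))) ≤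
      (1 + ENNReal.ofReal Q) ^ S.card * expect μ F := by
  classical
  induction S using Finset.induction_on with
  | empty => simp
  | insert i S hi ih =>
    rw [Finset.card_insert_of_notMem hi, pow_succ']
    set F' : Circuit A → ℝ≥0∞ := fun c => F c * ∏ i ∈ S, (1 + (c.isT k i : ℝ≥0∞)) with hF'
    have key : expect μ (fun c => F' c * (c.isT k i : ℝ≥0∞)) ≤ ENNReal.ofReal Q * expect μ F' := by
      by_cases h : A.partner k i = i
      · refine le_trans (le_of_eq ?_) (expect_T_le hμ ⟨(k, i), h⟩ F' ?_)
        · congr 1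
          funext c
          congr 1
          simp only [isT, dif_pos h]
          cases c.one ⟨(k, i), h⟩ <;> simp
        · intro c c' hc
          simp only [hF']
          congr 1
          · refine hF c c' (fun x hx => hc.1 x ?_) (fun x _ => congrFun hc.2 x)
            rintro rfl
            simp at hx
          · refine Finset.prod_congr rfl fun j hj => ?_
            rw [isT_eq_of_agreeOff h hc (fun h => hi (h ▸ hj))]
      · have : ∀ c : Circuit A, c.isT k i = 0 := fun c => by simp [isT, h]
        simp [this, expect]
    have e : (fun c => F c * ∏ i ∈ insert i S, (1 + (c.isT k i : ℝ≥0∞))) =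
        fun c : Circuit A => F' c + F' c * (c.isT k i : ℝ≥0∞) := by
      funext c
      rw [Finset.prod_insert hi, hF']
      ring
    rw [e, expect_add, mul_assoc, add_mul, one_mul]
    exact add_le_add ih (key.trans (mul_le_mul_right ih _))

theorem card_branchLetters_le (c : Circuit A) (k : Fin d) (s : PauliString n) :
    ((Fintype.piFinset (branchLetters (c.isT k) s.support.toList s)).card : ℝ≥0∞) ≤
      ∏ i ∈ s.support, (1 + (c.isT k i : ℝ≥0∞)) := by
  rw [Fintype.card_piFinset, Nat.cast_prod]
  rw [← Finset.prod_subset (Finset.subset_univ s.support)]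
  · refine Finset.prod_le_prod' fun i _ => ?_
    unfold branchLetters
    split_ifs with h
    · rw [h.2.1, show ({1, 2} : Finset (Fin 4)).card = 2 from rfl]; norm_num
    · simp
  · intro i _ hi
    simp [branchLetters, hi]

/-- The supermartingale argument: branching gains at most a factor `1 + Q` per unit of weight in
expectation, layer by layer, because the string in front of a layer depends only on the layers
behind it. -/
theorem expect_branchSum_le {Q : ℝ} {μ : PMF (Circuit A)} (hμ : IsRandomModel Q μ)
    {x y : ℝ≥0∞} (hx : x ≤ 1) (hy : y = 0 ∨ x = 1 ∧ y = 1) (k : ℕ) (hk : k ≤ d)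
    (F : Circuit A → ℝ≥0∞) (hF : DependsFrom k F) (s : PauliString n) (w : ℕ) :
    expect μ (fun c => F c * c.branchSum x y k hk s w) ≤
      (x * (1 + ENNReal.ofReal Q)) ^ w * expect μ F := by
  classical
  have hx1 : ∀ m : ℕ, x ^ m ≤ (x * (1 + ENNReal.ofReal Q)) ^ m := fun m =>
    pow_le_pow_left₀ zero_le (le_mul_of_one_le_right' le_self_add) m
  have hcut : ∀ (F : Circuit A → ℝ≥0∞) (s : PauliString n) (w : ℕ), w < s.weight →
      expect μ (fun c => F c * x ^ s.weight) ≤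
      (x * (1 + ENNReal.ofReal Q)) ^ w * expect μ F := by
    intro F s w h
    rw [← expect_const_mul]
    refine expect_mono μ fun c => ?_
    rw [mul_comm]
    exact mul_le_mul_left ((pow_le_pow_right_of_le_one' hx h.le).trans (hx1 w)) _
  induction k generalizing F s w with
  | zero =>
    simp only [branchSum]
    split_ifs with hw
    · rw [← expect_const_mul]
      refine expect_mono μ fun c => ?_
      rw [mul_comm]
      refine mul_le_mul_left ?_ _
      rcases hy with rfl | ⟨rfl, rfl⟩
      · simp
      · rw [one_pow, one_mul]; exact (one_pow w).symm.le.trans (hx1 w)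
    · exact hcut F s w (not_le.1 hw)
  | succ k ih =>
    simp only [branchSum]
    split_ifs with hw
    -- Sort the circuits by the outcome of layer `k`: the event that string `u` occurs and is
    -- mapped to `s'` depends only on the layers from `k` on, so the induction hypothesis applies to
    -- its indicator function.
    · let B : Circuit A → Finset (PauliString n) := fun c =>
        Fintype.piFinset (branchLetters (c.isT ⟨k, hk⟩) s.support.toList s)
      let G : PauliString n × PauliString n → Circuit A → ℝ≥0∞ := fun z c =>
        F c * if z.1 ∈ B c ∧ c.cliff ⟨k, hk⟩ z.1 = z.2 then 1 else 0
      have hG : ∀ z, DependsFrom k (G z) := by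
        intro z c c' h1 h2
        have e1 : F c' = F c := hF c c' (fun y hy => h1 y (by omega)) (fun y hy => h2 y (by omega))
        have e2 : c'.isT ⟨k, hk⟩ = c.isT ⟨k, hk⟩ := funext fun i => isT_eq h1
        have e3 := cliff_eq (k := ⟨k, hk⟩) h1 h2 z.1
        simp only [G, B, e1, e2, e3]
      have e : ∀ c : Circuit A, F c * (x ^ s.weight * ∑ u ∈ B c,
          c.branchSum x y k (Nat.le_of_succ_le hk) (c.cliff ⟨k, hk⟩ u) (w - s.weight)) =
          x ^ s.weight * ∑ z, G z c *
            c.branchSum x y k (Nat.le_of_succ_le hk) z.2 (w - s.weight) := by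
        intro c
        rw [Fintype.sum_prod_type, mul_left_comm, Finset.mul_sum]
        congr 1
        rw [← Finset.sum_subset (Finset.subset_univ (B c))]
        · refine Finset.sum_congr rfl fun u hu => ?_
          rw [Finset.sum_eq_single (c.cliff ⟨k, hk⟩ u)]
          · simp [G, hu]
          · intro s' _ hs'
            simp [G, Ne.symm hs']
          · simp
        · intro u _ hu
          exact Finset.sum_eq_zero fun s' _ => by simp [G, hu]
      have e' : ∀ c : Circuit A, ∑ z, G z c = F c * ((B c).card : ℝ≥0∞) := by
        intro c
        rw [Fintype.sum_prod_type, ← Finset.sum_subset (Finset.subset_univ (B c))]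
        · rw [Finset.card_eq_sum_ones, Nat.cast_sum, Finset.mul_sum]
          refine Finset.sum_congr rfl fun u hu => ?_
          simp [G, hu]
        · intro u _ hu
          exact Finset.sum_eq_zero fun s' _ => by simp [G, hu]
      calc expect μ (fun c => F c * (x ^ s.weight * ∑ u ∈ B c,
            c.branchSum x y k (Nat.le_of_succ_le hk) (c.cliff ⟨k, hk⟩ u) (w - s.weight)))
          = x ^ s.weight * ∑ z, expect μ (fun c => G z c *
              c.branchSum x y k (Nat.le_of_succ_le hk) z.2 (w - s.weight)) := by
            rw [← expect_sum, ← expect_const_mul]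
            exact congrArg _ (funext e)
        _ ≤ x ^ s.weight * ∑ z, (x * (1 + ENNReal.ofReal Q)) ^ (w - s.weight) *
              expect μ (G z) := by
            refine mul_le_mul_right (Finset.sum_le_sum fun z _ => ?_) _
            exact ih (Nat.le_of_succ_le hk) (G z) (hG z) z.2 (w - s.weight)
        _ = x ^ s.weight * ((x * (1 + ENNReal.ofReal Q)) ^ (w - s.weight) *
              expect μ (fun c => F c * ((B c).card : ℝ≥0∞))) := by
            rw [← Finset.mul_sum, ← expect_sum]
            simp only [e']
        _ ≤ x ^ s.weight * ((x * (1 + ENNReal.ofReal Q)) ^ (w - s.weight) *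
              ((1 + ENNReal.ofReal Q) ^ s.weight * expect μ F)) := by
            refine mul_le_mul_right (mul_le_mul_right ?_ _) _
            refine le_trans (expect_mono μ fun c => ?_) (expect_prod_le hμ ⟨k, hk⟩ F hF s.support)
            exact mul_le_mul_right (card_branchLetters_le c ⟨k, hk⟩ s) _
        _ = (x * (1 + ENNReal.ofReal Q)) ^ w * expect μ F := by
            have : (x * (1 + ENNReal.ofReal Q)) ^ w =
                (x * (1 + ENNReal.ofReal Q)) ^ (w - s.weight) *
                  (x ^ s.weight * (1 + ENNReal.ofReal Q) ^ s.weight) := by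
              rw [← mul_pow, ← pow_add, Nat.sub_add_cancel hw]
            rw [this]
            ring
    · exact hcut F s w (not_le.1 hw)

end Expect

end Circuit

end PauliPath

namespace PauliPath

/-! ### Total correctness with a time bound -/

/-- Program `P`, started in `s`, halts after at most `B` steps in a state that satisfies `post`. -/
def Exec (P : Program) (s : Memory) (B : ℕ) (post : Memory → Prop) : Prop :=
  ∃ s' t, Runs P s s' t ∧ t ≤ B ∧ post s'

namespace Exec

variable {P R : Program} {s : Memory} {B B' : ℕ} {post post' : Memory → Prop} {b : Test}

theorem mono (h : Exec P s B post) (hB : B ≤ B') (hp : ∀ s', post s' → post' s') :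
    Exec P s B' post' := by
  obtain ⟨s', t, h1, h2, h3⟩ := h
  exact ⟨s', t, h1, h2.trans hB, hp _ h3⟩

theorem seq (h : Exec P s B fun s' => Exec R s' B' post) : Exec (.seq P R) s (B + B') post := by
  obtain ⟨s', t, h1, h2, s'', t', h3, h4, h5⟩ := h
  exact ⟨s'', t + t', .seq h1 h3, by omega, h5⟩

theorem cond_true (hb : b.Holds s) (h : Exec P s B post) : Exec (.cond b P R) s (B + 1) post := by
  obtain ⟨s', t, h1, h2, h3⟩ := h
  exact ⟨s', t + 1, .cond_true hb h1, by omega, h3⟩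

theorem cond_false (hb : ¬ b.Holds s) (h : Exec R s B post) :
    Exec (.cond b P R) s (B + 1) post := by
  obtain ⟨s', t, h1, h2, h3⟩ := h
  exact ⟨s', t + 1, .cond_false hb h1, by omega, h3⟩

theorem loop_done (hb : ¬ b.Holds s) (h : post s) : Exec (.loop b P) s 1 post :=
  ⟨s, 1, .loop_done hb, le_rfl, h⟩

theorem loop_step (hb : b.Holds s) (h : Exec P s B fun s' => Exec (.loop b P) s' B' post) :
    Exec (.loop b P) s (B + B' + 1) post := by
  obtain ⟨s', t, h1, h2, s'', t', h3, h4, h5⟩ := h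
  exact ⟨s'', t + t' + 1, .loop_step hb h1 h3, by omega, h5⟩

end Exec

/-- Programs without loops. -/
def Program.LoopFree : Program → Prop
  | .seq P R => P.LoopFree ∧ R.LoopFree
  | .cond _ P R => P.LoopFree ∧ R.LoopFree
  | .loop _ _ => False
  | _ => True

/-- A bound for the running time of a program without loops. -/
def Program.size : Program → ℕ
  | .seq P R => P.size + R.size
  | .cond _ P R => P.size + R.size + 1
  | _ => 1

open scoped Classical in
/-- The effect of a program without loops. -/
noncomputable def Program.apply : Program → Memory → Memory
  | .setNat a i j k e, s => s.writeNat a (i.eval s) (j.eval s) (k.eval s) (e.eval s)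
  | .setReal a i j k e, s => s.writeReal a (i.eval s) (j.eval s) (k.eval s) (e.eval s)
  | .seq P R, s => R.apply (P.apply s)
  | .cond b P R, s => if b.Holds s then P.apply s else R.apply s
  | _, s => s

theorem Program.apply_seq (P R : Program) (s : Memory) :
    (Program.seq P R).apply s = R.apply (P.apply s) := rfl

theorem Program.apply_cond_pos {b : Test} {s : Memory} (h : b.Holds s) (P R : Program) :
    (Program.cond b P R).apply s = P.apply s := if_pos h

theorem Program.apply_cond_neg {b : Test} {s : Memory} (h : ¬ b.Holds s) (P R : Program) :
    (Program.cond b P R).apply s = R.apply s := if_neg h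

theorem Exec.of_loopFree {P : Program} (h : P.LoopFree) (s : Memory) {post : Memory → Prop}
    (hp : post (P.apply s)) : Exec P s P.size post := by
  induction P generalizing s post with
  | skip => exact ⟨_, 1, .skip s, le_rfl, hp⟩
  | setNat a i j k e => exact ⟨_, 1, .setNat s a i j k e, le_rfl, hp⟩
  | setReal a i j k e => exact ⟨_, 1, .setReal s a i j k e, le_rfl, hp⟩
  | seq P R ihP ihR => exact Exec.seq (ihP h.1 s (ihR h.2 _ hp))
  | cond b P R ihP ihR =>
    by_cases hb : b.Holds s
    · exact (Exec.cond_true hb (ihP h.1 s (by simpa [Program.apply, hb] using hp))).mono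
        (by simp only [Program.size]; omega) fun _ h => h
    · exact (Exec.cond_false hb (ihR h.2 s (by simpa [Program.apply, hb] using hp))).mono
        (by simp only [Program.size]; omega) fun _ h => h
  | loop b P => exact h.elim

@[simp] theorem Memory.writeNat_nat (s : Memory) (a i j k v a' i' j' k' : ℕ) :
    (s.writeNat a i j k v).nat a' i' j' k' =
      if a' = a ∧ i' = i ∧ j' = j ∧ k' = k then v else s.nat a' i' j' k' := rfl

@[simp] theorem Memory.writeNat_real (s : Memory) (a i j k v : ℕ) :
    (s.writeNat a i j k v).real = s.real := rfl

@[simp] theorem Memory.writeReal_real (s : Memory) (a i j k : ℕ) (v : ℝ) (a' i' j' k' : ℕ) :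
    (s.writeReal a i j k v).real a' i' j' k' =
      if a' = a ∧ i' = i ∧ j' = j ∧ k' = k then v else s.real a' i' j' k' := rfl

@[simp] theorem Memory.writeReal_nat (s : Memory) (a i j k : ℕ) (v : ℝ) :
    (s.writeReal a i j k v).nat = s.nat := rfl

/-! ### The program -/

namespace Prog

/-- A natural number variable, kept in array `11`. -/
def nv (v : ℕ) : NExpr := .get 11 (.lit v) (.lit 0) (.lit 0)

/-- Assignment to a natural number variable. -/
def setv (v : ℕ) (e : NExpr) : Program := .setNat 11 (.lit v) (.lit 0) (.lit 0) e

/-- A real variable, kept in array `4`. -/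
def rv (v : ℕ) : RExpr := .get 4 (.lit v) (.lit 0) (.lit 0)

/-- Assignment to a real variable. -/
def setr (v : ℕ) (e : RExpr) : Program := .setReal 4 (.lit v) (.lit 0) (.lit 0) e

/-- The cut-off `ℓ`. -/
def vCut := nv 0
/-- The index of the current Pauli string of the observable. -/
def vObs := nv 1
/-- The number of the current simulation; every simulation works in fresh memory. -/
def vSim := nv 2
/-- The number of bits in use in the array `14` of branching decisions. -/
def vTop := nv 14
/-- The number of bits read by the current simulation. -/
def vBit := nv 4
/-- The current level. -/
def vLev := nv 5
/-- The weight of the current string. -/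
def vWt := nv 6
/-- The weight that the rest of the path may still have. -/
def vRem := nv 7
/-- A counter. -/
def vCnt := nv 8
/-- The current qubit. -/
def vQ := nv 9
/-- The partner of the current qubit, or a letter. -/
def vX := nv 10
/-- The index into a two-qubit table. -/
def vY := nv 11
/-- The weight of the string under construction. -/
def vNew := nv 12

/-- Entry `j` of the list of qubits in the support of the string at level `k`. -/
def supp (k j : NExpr) : NExpr := .get 12 vSim k j

/-- The letter at qubit `i` of the string at level `k`. -/
def lett (k i : NExpr) : NExpr := .get 13 vSim k i

/-- The layer below the current level. -/
def below : NExpr := .sub vLev (.lit 1)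

/-- The bit at position `q`. -/
def bit (q : NExpr) : NExpr := .get 14 q (.lit 0) (.lit 0)

/-- `1 - p`. -/
def damp : RExpr := .sub (.ofNat (.lit 1)) (.get 1 (.lit 0) (.lit 0) (.lit 0))

/-- The sign `1 - 2 e` of a bit `e`. -/
def sgnE (e : NExpr) : RExpr := .sub (.ofNat (.lit 1)) (.ofNat (.add e e))

/-- The action of the `T` gates on one qubit of the support. The bit `y` that decides about a
branch from `X` to `-Y` contributes a sign; as the letter is `1` or `2`, the sign bit is the
truncated difference of `y` and the letter minus one. -/
def tBody : Program :=
  .seq (setv 9 (supp vLev vCnt)) <|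
  .seq (setr 0 (.mul (rv 0) damp)) <|
  .seq (.cond (.and (.natLe (.lit 1) (.get 2 below vQ (.lit 0)))
      (.and (.natLe (.lit 1) (lett vLev vQ)) (.natLe (lett vLev vQ) (.lit 2))))
    (.seq (setr 0 (.mul (.div (rv 0) (.sqrt (.ofNat (.lit 2))))
        (sgnE (.sub (bit vBit) (.sub (lett vLev vQ) (.lit 1)))))) <|
      .seq (.setNat 13 vSim vLev vQ (.add (.lit 1) (bit vBit)))
        (setv 4 (.add vBit (.lit 1))))
    .skip)
  (setv 8 (.add vCnt (.lit 1)))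

/-- Write the letter `e` at qubit `a` of the string under construction. The list of its support
is extended only if the letter is not the identity. -/
def put (a e : NExpr) : Program :=
  .seq (.setNat 13 vSim below a e) <|
  .seq (.setNat 12 vSim below vNew a)
    (setv 12 (.add vNew (.sub e (.sub e (.lit 1)))))

/-- The action of the Clifford gate on the qubits `a`, `b`, where `a` is the smaller one. -/
def pairGate (a b : NExpr) : Program :=
  .seq (setv 11 (.add (.add (.add (.add (lett vLev a) (lett vLev a)) (lett vLev a))
    (lett vLev a)) (lett vLev b))) <|
  .seq (setr 0 (.mul (rv 0) (sgnE (.get 7 below a vY)))) <|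
  .seq (put a (.get 5 below a vY)) (put b (.get 6 below a vY))

/-- The action of the Clifford gate at a single-qubit position; a `T` gate, for which the tables
hold zeros, keeps the letter. -/
def singleGate : Program :=
  .seq (setr 0 (.mul (rv 0) (sgnE (.get 4 below vQ (lett vLev vQ))))) <|
  .seq (setv 10 (.add (.get 3 below vQ (lett vLev vQ)) (.sub (lett vLev vQ) (.sub (lett vLev vQ)
    (.add (.add (.get 2 below vQ (.lit 0)) (.get 2 below vQ (.lit 0)))
      (.get 2 below vQ (.lit 0))))))) <|
  put vQ vX

/-- The action of the Clifford gates on one qubit of the support. -/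
def cBody : Program :=
  .seq (setv 9 (supp vLev vCnt)) <|
  .seq (setv 10 (.get 1 below vQ (.lit 0))) <|
  .seq (.cond (.and (.natLe vX vQ) (.natLe vQ vX)) singleGate
    (.cond (.natLe vQ vX) (pairGate vQ vX)
      (.cond (.natLe (lett vLev vX) (.lit 0)) (pairGate vX vQ) .skip)))
  (setv 8 (.add vCnt (.lit 1)))

/-- Is the counter smaller than the weight of the current string? -/
def more : Test := .natLe (.add vCnt (.lit 1)) vWt

/-- End of a level: check the weight of the new string. -/
def levelEnd : Program :=
  .seq (setv 5 below)
    (.cond (.natLe vNew vRem) (.seq (setv 6 vNew) (setv 7 (.sub vRem vNew)))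
      (.seq (setv 6 (.lit 0)) (setr 0 (.ofNat (.lit 0)))))

/-- Conjugation by one layer. -/
def levelBody : Program :=
  .seq (setv 8 (.lit 0)) <| .seq (.loop more tBody) <|
  .seq (.seq (setv 8 (.lit 0)) (setv 12 (.lit 0))) <| .seq (.loop more cBody) levelEnd

/-- Conjugation by all layers, as long as the string is not the identity. -/
def levelLoop : Program := .loop (.and (.natLe (.lit 1) vLev) (.natLe (.lit 1) vWt)) levelBody

/-- One factor of the expectation value in the initial state. -/
def finBody : Program :=
  .seq (setv 9 (supp vLev vCnt)) <|
  .seq (setr 0 (.mul (rv 0) (.mul damp (.get 3 vQ (lett vLev vQ) (.lit 0)))))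
    (setv 8 (.add vCnt (.lit 1)))

/-- Load one letter of a Pauli string of the observable. -/
def loadBody : Program :=
  .seq (.setNat 12 vSim vLev vCnt (.get 9 vObs vCnt (.lit 0))) <|
  .seq (.setNat 13 vSim vLev (.get 9 vObs vCnt (.lit 0))
      (.get 10 vObs (.get 9 vObs vCnt (.lit 0)) (.lit 0)))
    (setv 8 (.add vCnt (.lit 1)))

/-- Initialization of a simulation. -/
def simStart : Program :=
  .seq (setv 4 (.lit 0)) <| .seq (setv 5 (.get 0 (.lit 1) (.lit 0) (.lit 0))) <|
  .seq (setv 6 (.get 8 vObs (.lit 0) (.lit 0))) <| .seq (setv 7 vCut) <|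
  .seq (setv 8 (.lit 0)) (setr 0 (.get 2 vObs (.lit 0) (.lit 0)))

/-- End of a simulation: add the value of the path to the output. -/
def simEnd : Program :=
  .seq (.setReal 0 (.lit 0) (.lit 0) (.lit 0)
    (.add (.get 0 (.lit 0) (.lit 0) (.lit 0)) (rv 0))) <|
  .seq (setv 2 (.add vSim (.lit 1))) (setv 14 vBit)

/-- Simulation of a single path, with branching decisions given by the array of bits. -/
def simulate : Program :=
  .seq simStart <|
  .seq (.cond (.natLe vWt vRem)
    (.seq (setv 7 (.sub vRem vWt)) (.loop more loadBody))
    (.seq (setv 6 (.lit 0)) (setr 0 (.ofNat (.lit 0))))) <|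
  .seq levelLoop <| .seq (setv 8 (.lit 0)) <| .seq (.loop more finBody) simEnd

/-- The last bit in use. -/
def lastBit : NExpr := bit (.sub vTop (.lit 1))

/-- One step of backtracking: drop the last bit if it is `1`, otherwise replace it by `1` and
simulate the path with these bits. -/
def backBody : Program :=
  .cond (.natLe (.lit 1) lastBit)
    (.seq (.setNat 14 (.sub vTop (.lit 1)) (.lit 0) (.lit 0) (.lit 0))
      (setv 14 (.sub vTop (.lit 1))))
    (.seq (.setNat 14 (.sub vTop (.lit 1)) (.lit 0) (.lit 0) (.lit 1)) simulate)

/-- The backtracking search. -/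
def backLoop : Program := .loop (.natLe (.lit 1) vTop) backBody

/-- All paths of all Pauli strings of the observable. -/
def obsLoop : Program :=
  .loop (.natLe (.add vObs (.lit 1)) (.get 0 (.lit 2) (.lit 0) (.lit 0)))
    (.seq simulate <| .seq backLoop (setv 1 (.add vObs (.lit 1))))

/-- The number `N` of Pauli strings, as a real number. -/
def numObs : RExpr := .ofNat (.get 0 (.lit 2) (.lit 0) (.lit 0))

/-- The factor `(1 - p) (1 + Q)` by which the expected error decreases per unit of weight. -/
def rate : RExpr :=
  .mul damp (.add (.ofNat (.lit 1)) (.get 1 (.lit 1) (.lit 0) (.lit 0)))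

/-- Computation of the cut-off: the first power of `rate` that is at most `ε δ / (2 N)`. -/
def cutLoop : Program :=
  .loop (.not (.realLe (.mul (rv 1) (.add numObs numObs))
      (.mul (.get 1 (.lit 2) (.lit 0) (.lit 0)) (.get 1 (.lit 3) (.lit 0) (.lit 0)))))
    (.seq (setr 1 (.mul (rv 1) rate)) (setv 0 (.add vCut (.lit 1))))

/-- The whole program. -/
def main : Program := .seq (setr 1 (.ofNat (.lit 1))) <| .seq cutLoop obsLoop

end Prog

/-! ### Reading the input -/

section Input

variable {n d N : ℕ} {A : Architecture n d} (p Q ε δ : ℝ) (c : Circuit A)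
    (ρ : Fin n → QubitState) (a : Fin N → ℝ) (O : Fin N → PauliString n)

theorem pad_apply {α : Type} [Zero α] {m : ℕ} (f : Fin m → α) (i : Fin m) : pad f i = f i := by
  simp [pad]

theorem input_nat_partner (k : Fin d) (i : Fin n) :
    (input p Q ε δ c ρ a O).nat 1 k i 0 = A.partner k i := by
  simp [input, inputNat, pad_apply]

theorem input_nat_isT (k : Fin d) (i : Fin n) :
    (input p Q ε δ c ρ a O).nat 2 k i 0 = c.isT k i := by
  simp [input, inputNat, pad_apply]

theorem input_nat_table1 (k : Fin d) (i : Fin n) (P : Fin 4) :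
    (input p Q ε δ c ρ a O).nat 3 k i P = (c.table1 k i P).1 ∧
    (input p Q ε δ c ρ a O).nat 4 k i P = (c.table1 k i P).2 := by
  simp [input, inputNat, pad_apply]

theorem input_nat_table2 (k : Fin d) (i : Fin n) (m : Fin 16) :
    (input p Q ε δ c ρ a O).nat 5 k i m = (c.table2 k i m).1 ∧
    (input p Q ε δ c ρ a O).nat 6 k i m = (c.table2 k i m).2.1 ∧
    (input p Q ε δ c ρ a O).nat 7 k i m = (c.table2 k i m).2.2 := by
  simp [input, inputNat, pad_apply]

theorem input_nat_weight (r : Fin N) :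
    (input p Q ε δ c ρ a O).nat 8 r 0 0 = (O r).weight := by
  simp [input, inputNat, pad_apply]

theorem input_nat_support (r : Fin N) (j : ℕ) (hj : j < ((O r).support.sort (· ≤ ·)).length) :
    (input p Q ε δ c ρ a O).nat 9 r j 0 = ((O r).support.sort (· ≤ ·))[j] := by
  simp only [input, inputNat, pad_apply]
  rw [List.getD_eq_getElem _ _ (by simpa using hj), List.getElem_map]

theorem input_nat_letter (r : Fin N) (i : Fin n) :
    (input p Q ε δ c ρ a O).nat 10 r i 0 = (O r i : ℕ) := by
  simp [input, inputNat, pad_apply]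

theorem input_real_params : (input p Q ε δ c ρ a O).real 1 0 0 0 = p ∧
    (input p Q ε δ c ρ a O).real 1 1 0 0 = Q ∧ (input p Q ε δ c ρ a O).real 1 2 0 0 = ε ∧
    (input p Q ε δ c ρ a O).real 1 3 0 0 = δ := ⟨rfl, rfl, rfl, rfl⟩

theorem input_real_coeff (r : Fin N) : (input p Q ε δ c ρ a O).real 2 r 0 0 = a r := by
  simp [input, inputReal, pad_apply]

theorem input_real_bloch (i : Fin n) (P : Fin 4) :
    (input p Q ε δ c ρ a O).real 3 i P 0 = Circuit.bloch ρ i P := by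
  simp [input, inputReal, pad_apply, Circuit.bloch]

end Input

end PauliPath

namespace PauliPath

/-! ### Invariants of the program -/

/-- The part of the memory that a simulation does not change: the input `I`, the cut-off, the
number of the Pauli string, the number of the simulation, the bits, the output so far, and the
memory reserved for later simulations. -/
structure Ctx (I : Memory) (cut r sid : ℕ) (b : ℕ → Bool) (o : ℝ) (M : Memory) : Prop where
  inN : ∀ a ≤ 10, M.nat a = I.nat a
  inR : ∀ a, 1 ≤ a → a ≤ 3 → M.real a = I.real a
  vcut : M.nat 11 0 0 0 = cut
  vobs : M.nat 11 1 0 0 = r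
  vsim : M.nat 11 2 0 0 = sid
  bits : ∀ q, M.nat 14 q 0 0 = (b q).toNat
  fresh : ∀ id > sid, ∀ k i, M.nat 13 id k i = 0
  out : M.real 0 0 0 0 = o

namespace Ctx

variable {I M : Memory} {cut r sid : ℕ} {b : ℕ → Bool} {o : ℝ}

theorem writeNat (h : Ctx I cut r sid b o M) (a i j k v : ℕ)
    (ok : (a = 11 ∧ 4 ≤ i) ∨ a = 12 ∨ (a = 13 ∧ i = sid)) :
    Ctx I cut r sid b o (M.writeNat a i j k v) where
  inN a' ha' := by
    rw [← h.inN a' ha']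
    funext i' j' k'
    rw [Memory.writeNat_nat, if_neg (by omega)]
  inR := h.inR
  vcut := by rw [Memory.writeNat_nat, if_neg (by omega), h.vcut]
  vobs := by rw [Memory.writeNat_nat, if_neg (by omega), h.vobs]
  vsim := by rw [Memory.writeNat_nat, if_neg (by omega), h.vsim]
  bits q := by rw [Memory.writeNat_nat, if_neg (by omega), h.bits]
  fresh id hid k' i' := by rw [Memory.writeNat_nat, if_neg (by omega), h.fresh id hid]
  out := h.out

theorem writeReal (h : Ctx I cut r sid b o M) (i j k : ℕ) (v : ℝ) :
    Ctx I cut r sid b o (M.writeReal 4 i j k v) where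
  inN := h.inN
  inR a' h1 h2 := by
    rw [← h.inR a' h1 h2]
    funext i' j' k'
    rw [Memory.writeReal_real, if_neg (by omega)]
  vcut := h.vcut
  vobs := h.vobs
  vsim := h.vsim
  bits := h.bits
  fresh := h.fresh
  out := by rw [Memory.writeReal_real, if_neg (by omega), h.out]

end Ctx

/-- The memory of a simulation at level `k`: the current string `s` with its support `l`, the
remaining weight `w`, the number `q` of bits read, and the coefficient `a`. Lower levels are
blank. -/
structure LevInv {n : ℕ} (sid k : ℕ) (l : List (Fin n)) (s : PauliString n) (w q : ℕ) (a : ℝ)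
    (M : Memory) : Prop where
  lev : M.nat 11 5 0 0 = k
  wt : M.nat 11 6 0 0 = l.length
  rem : M.nat 11 7 0 0 = w
  bit : M.nat 11 4 0 0 = q
  coef : M.real 4 0 0 0 = a
  supp : ∀ j (h : j < l.length), M.nat 12 sid k j = l[j]
  lett : ∀ i : Fin n, M.nat 13 sid k i = s i
  clean : ∀ k' < k, ∀ i, M.nat 13 sid k' i = 0

open Prog Circuit

theorem one_le_and_le_two (P : Fin 4) : (1 ≤ (P : ℕ) ∧ (P : ℕ) ≤ 2) ↔ (P = 1 ∨ P = 2) := by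
  fin_cases P <;> simp

/-- The sign bit `y - (P - 1)`, with truncated subtraction, is `1` exactly if an `X` turns into
a `Y`. -/
theorem branch_sign (b : Bool) {P : Fin 4} (h : P = 1 ∨ P = 2) :
    (1 : ℝ) - ((b.toNat - ((P : ℕ) - 1) + (b.toNat - ((P : ℕ) - 1)) : ℕ) : ℝ) =
      rsign (b && decide (P = 1)) := by
  rcases h with rfl | rfl <;> cases b <;> norm_num [rsign]; decide

theorem branch_letter (b : Bool) : 1 + b.toNat = (((if b then 2 else 1 : Fin 4)) : ℕ) := by
  cases b <;> rfl

section Loops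

variable {n d N : ℕ} {A : Architecture n d} {p Q ε δ : ℝ} {c : Circuit A}
  {ρ : Fin n → QubitState} {ca : Fin N → ℝ} {O : Fin N → PauliString n}
  {cut r sid : ℕ} {b : ℕ → Bool} {o : ℝ}

theorem isT_le_one (c : Circuit A) (k : Fin d) (i : Fin n) : c.isT k i ≤ 1 := by
  unfold isT
  split_ifs with h
  · cases c.one ⟨(k, i), h⟩ <;> simp
  · simp

/-- The loop over the support follows one branch of the tree of the `T` gates. -/
theorem tLoop_spec (k : Fin d) (l : List (Fin n)) (w : ℕ) (rest : List (Fin n)) (j : ℕ)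
    (s : PauliString n) (a : ℝ) (q : ℕ) (M : Memory)
    (hC : Ctx (input p Q ε δ c ρ ca O) cut r sid b o M) (hL : LevInv sid (k + 1) l s w q a M)
    (hj : M.nat 11 8 0 0 = j) (hr : l.drop j = rest) :
    Exec (.loop more tBody) M (rest.length * (tBody.size + 1) + 1) fun M' =>
      Ctx (input p Q ε δ c ρ ca O) cut r sid b o M' ∧
      LevInv sid (k + 1) l ((tDec (c.isT k) (1 - p) rest s a).run b q).1.1 w
        ((tDec (c.isT k) (1 - p) rest s a).run b q).2
        ((tDec (c.isT k) (1 - p) rest s a).run b q).1.2 M' := by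
  induction rest generalizing j s a q M with
  | nil =>
    have hle : l.length ≤ j := List.drop_eq_nil_iff.1 hr
    refine (Exec.loop_done ?_ ⟨hC, hL⟩).mono (by omega) fun _ h => h
    simp only [more, Test.Holds, NExpr.eval, vCnt, vWt, nv, hj, hL.wt]
    omega
  | cons i rest ih =>
    have hlt : j < l.length := by
      by_contra hcon
      rw [List.drop_eq_nil_of_le (not_lt.1 hcon)] at hr
      cases hr
    have hi : l[j] = i := by
      rw [List.drop_eq_getElem_cons hlt] at hr
      exact (List.cons.inj hr).1
    have hr' : l.drop (j + 1) = rest := by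
      rw [List.drop_eq_getElem_cons hlt] at hr
      exact (List.cons.inj hr).2
    have hS : M.nat 12 sid (k + 1) j = i := by rw [hL.supp j hlt, hi]
    have hT : M.nat 2 k i 0 = c.isT k i := by rw [hC.inN 2 (by omega), input_nat_isT]
    have hp : M.real 1 0 0 0 = p := by
      rw [hC.inR 1 le_rfl (by omega)]; exact (input_real_params p Q ε δ c ρ ca O).1
    have hT1 := isT_le_one c k i
    refine (Exec.loop_step (B := tBody.size) (B' := rest.length * (tBody.size + 1) + 1) ?_
      (Exec.of_loopFree ?_ M ?_)).mono (by rw [List.length_cons]; ring_nf; omega) fun _ h => h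
    · simp only [more, Test.Holds, NExpr.eval, vCnt, vWt, nv, hj, hL.wt]
      omega
    · simp [tBody, Program.LoopFree, setv, setr]
    · by_cases hcase : c.isT k i = 1 ∧ (s i = 1 ∨ s i = 2)
      · have h12 := (one_le_and_le_two (s i)).2 hcase.2
        have e : tBody.apply M = (((((M.writeNat 11 9 0 0 i).writeReal 4 0 0 0
            (a * (1 - p))).writeReal 4 0 0 0 (a * (1 - p) / √2 *
              rsign (b q && decide (s i = 1)))).writeNat 13 sid (k + 1) i
              ((if b q then 2 else 1 : Fin 4) : ℕ)).writeNat 11 4 0 0 (q + 1)).writeNat 11 8 0 0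
              (j + 1) := by
          rw [← branch_letter, ← branch_sign (b q) hcase.2]
          simp [tBody, Program.apply, setv, setr, supp, lett, vLev, vCnt, vSim, vQ, vBit, nv, rv,
            damp, sgnE, below, bit, NExpr.eval, RExpr.eval, Test.Holds, hj, hC.vsim, hL.lev,
            hL.coef, hL.bit, hS, hT, hp, hL.lett, hcase.1, h12, hC.bits]
        rw [tDec, if_pos hcase, Dec.run]
        refine ih (j + 1) _ _ _ _ ?_ ?_ ?_ hr'
        · rw [e]
          exact ((((((hC.writeNat 11 9 0 0 _ (by omega)).writeReal _ _ _ _).writeReal _ _ _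
            _).writeNat 13 sid _ _ _ (by omega)).writeNat 11 4 _ _ _ (by omega)).writeNat 11 8 _ _
            _ (by omega))
        · rw [e]
          constructor
          · simp [hL.lev]
          · simp [hL.wt]
          · simp [hL.rem]
          · simp
          · simp
          · intro j' hj'; simp [hL.supp j' hj']
          · intro i'
            by_cases hi' : i' = i
            · subst hi'; simp
            · simp [hL.lett, Fin.val_inj, hi']
          · intro k' hk' i'
            have : k' ≠ k + 1 := by omega
            simp [hL.clean k' hk', this]
        · rw [e]; simp
      · have e : tBody.apply M = ((M.writeNat 11 9 0 0 i).writeReal 4 0 0 0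
            (a * (1 - p))).writeNat 11 8 0 0 (j + 1) := by
          have hn : ¬ (1 ≤ c.isT k i ∧ (1 ≤ (s i : ℕ) ∧ (s i : ℕ) ≤ 2)) := by
            rw [one_le_and_le_two]
            intro h
            exact hcase ⟨by omega, h.2⟩
          simp only [tBody, Program.apply_seq]
          rw [Program.apply_cond_neg]
          · simp [Program.apply, setv, setr, supp, vLev, vCnt, vSim, nv, rv, damp, NExpr.eval,
              RExpr.eval, hj, hC.vsim, hL.lev, hL.coef, hS, hp]
          · simpa [Program.apply, setv, setr, supp, lett, vLev, vCnt, vSim, vQ, nv, rv, below,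
              NExpr.eval, Test.Holds, hj, hC.vsim, hL.lev, hS, hT, hL.lett] using hn
        rw [tDec, if_neg hcase]
        refine ih (j + 1) _ _ _ _ ?_ ?_ ?_ hr'
        · rw [e]
          exact ((hC.writeNat 11 9 0 0 _ (by omega)).writeReal _ _ _ _).writeNat 11 8 _ _ _
            (by omega)
        · rw [e]
          constructor
          · simp [hL.lev]
          · simp [hL.wt]
          · simp [hL.rem]
          · simp [hL.bit]
          · simp
          · intro j' hj'; simp [hL.supp j' hj']
          · intro i'; simp [hL.lett]
          · intro k' hk' i'
            simp [hL.clean k' hk']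
        · rw [e]; simp

end Loops

end PauliPath

namespace PauliPath
open Prog Circuit

/-! ### The Clifford gates of a layer -/

section CliffordLoop

variable {n d N : ℕ} {A : Architecture n d} {p Q ε δ : ℝ} {c : Circuit A}
  {ρ : Fin n → QubitState} {ca : Fin N → ℝ} {O : Fin N → PauliString n}
  {cut r sid : ℕ} {b : ℕ → Bool} {o : ℝ}

theorem sign_toNat (b : Bool) : (1 : ℝ) - ((b.toNat + b.toNat : ℕ) : ℝ) = rsign b := by
  cases b <;> norm_num [rsign]

/-- The tables hold zeros for a `T` gate; then the second summand is the letter, which is at most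
`3`. For a Clifford gate the second summand vanishes. -/
theorem table1_fst (k : Fin d) {i : Fin n} (h : A.partner k i = i) (u : PauliString n) :
    (c.table1 k i (u i)).1 + ((u i : ℕ) - ((u i : ℕ) - (c.isT k i + c.isT k i + c.isT k i))) =
      (c.cliff k u i : ℕ) := by
  simp only [table1, isT, cliff, dif_pos h]
  cases c.one ⟨(k, i), h⟩ with
  | clifford g => simp
  | T =>
    have := (u i).2
    change 0 + ((u i : ℕ) - ((u i : ℕ) - (1 + 1 + 1))) = (u i : ℕ)
    omega

theorem table1_snd (k : Fin d) {i : Fin n} (h : A.partner k i = i) (u : PauliString n) :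
    (c.table1 k i (u i)).2 = (c.negAt k u i).toNat := by
  simp only [table1, negAt, dif_pos h]
  cases c.one ⟨(k, i), h⟩ <;> rfl

theorem table2_eq (k : Fin d) {i : Fin n} (h : i < A.partner k i) (u : PauliString n)
    (m : Fin 16) (hm : (m : ℕ) = u i + u i + u i + u i + u (A.partner k i)) :
    (c.table2 k i m).1 = (c.cliff k u i : ℕ) ∧
    (c.table2 k i m).2.1 = (c.cliff k u (A.partner k i) : ℕ) ∧
    (c.table2 k i m).2.2 = (c.negAt k u i).toNat := by
  have h1 : ¬ A.partner k i = i := h.ne'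
  have h2 : ¬ A.partner k (A.partner k i) = A.partner k i := by rw [A.invol]; exact h.ne
  have h3 : ¬ A.partner k i < A.partner k (A.partner k i) := by
    rw [A.invol]; exact not_lt.2 h.le
  have e1 : (⟨m / 4, by omega⟩ : Fin 4) = u i := Fin.ext (by simp only; omega)
  have e2 : (⟨m % 4, by omega⟩ : Fin 4) = u (A.partner k i) := Fin.ext (by simp only; omega)
  have e : c.cliff k u (A.partner k i) =
      ((c.two ⟨(k, i), h⟩).img (u i) (u (A.partner k i))).2 := by
    simp only [cliff, dif_neg h2, dif_neg h3]
    congr 2 <;> simp only [A.invol]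
  rw [e]
  simp only [table2, cliff, negAt, dif_pos h, dif_neg h1, e1, e2, and_self]

/-- The memory while the gates of layer `k` are applied to the string `u` with support `l`: the
letters on the qubits of the list `P` of the new string are known. -/
structure NewInv (c : Circuit A) (sid : ℕ) (k : Fin d) (l : List (Fin n)) (u : PauliString n)
    (w q : ℕ) (P : List (Fin n)) (a : ℝ) (M : Memory) : Prop where
  lev : M.nat 11 5 0 0 = k + 1
  wt : M.nat 11 6 0 0 = l.length
  rem : M.nat 11 7 0 0 = w
  bit : M.nat 11 4 0 0 = q
  coef : M.real 4 0 0 0 = a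
  supp : ∀ j (h : j < l.length), M.nat 12 sid (k + 1) j = l[j]
  lett : ∀ i : Fin n, M.nat 13 sid (k + 1) i = u i
  cnt : M.nat 11 12 0 0 = (P.filter fun i => c.cliff k u i ≠ 0).length
  supp' : ∀ j (h : j < (P.filter fun i => c.cliff k u i ≠ 0).length),
    M.nat 12 sid k j = (P.filter fun i => c.cliff k u i ≠ 0)[j]
  lett' : ∀ i : Fin n, M.nat 13 sid k i = if i ∈ P then (c.cliff k u i : ℕ) else 0
  clean : ∀ k' < (k : ℕ), ∀ i, M.nat 13 sid k' i = 0

namespace NewInv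

variable {k : Fin d} {l : List (Fin n)} {u : PauliString n} {w q : ℕ} {P : List (Fin n)} {a : ℝ}
  {M : Memory}

theorem writeVar (h : NewInv c sid k l u w q P a M) (v x : ℕ) (hv : 8 ≤ v) (hv' : v ≤ 11) :
    NewInv c sid k l u w q P a (M.writeNat 11 v 0 0 x) where
  lev := by rw [Memory.writeNat_nat, if_neg (by omega), h.lev]
  wt := by rw [Memory.writeNat_nat, if_neg (by omega), h.wt]
  rem := by rw [Memory.writeNat_nat, if_neg (by omega), h.rem]
  bit := by rw [Memory.writeNat_nat, if_neg (by omega), h.bit]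
  coef := h.coef
  supp j hj := by rw [Memory.writeNat_nat, if_neg (by omega), h.supp j hj]
  lett i := by rw [Memory.writeNat_nat, if_neg (by omega), h.lett]
  cnt := by rw [Memory.writeNat_nat, if_neg (by omega), h.cnt]
  supp' j hj := by rw [Memory.writeNat_nat, if_neg (by omega), h.supp' j hj]
  lett' i := by rw [Memory.writeNat_nat, if_neg (by omega), h.lett']
  clean k' hk' i := by rw [Memory.writeNat_nat, if_neg (by omega), h.clean k' hk']

theorem writeCoef (h : NewInv c sid k l u w q P a M) (a' : ℝ) :
    NewInv c sid k l u w q P a' (M.writeReal 4 0 0 0 a') where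
  lev := h.lev
  wt := h.wt
  rem := h.rem
  bit := h.bit
  coef := by simp
  supp := h.supp
  lett := h.lett
  cnt := h.cnt
  supp' := h.supp'
  lett' := h.lett'
  clean := h.clean

/-- Writing one letter of the new string. For an identity letter the entry `i` stays behind the end
of the support list, where the next one overwrites it. -/
theorem put (h : NewInv c sid k l u w q P a M) (i : Fin n) {v m : ℕ}
    (hv : v = (c.cliff k u i : ℕ)) (hm : m = M.nat 11 12 0 0) :
    NewInv c sid k l u w q (P ++ [i]) a (((M.writeNat 13 sid k i v).writeNat 12 sid k m i).writeNat
      11 12 0 0 (m + (v - (v - 1)))) where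
  lev := by simp [h.lev]
  wt := by simp [h.wt]
  rem := by simp [h.rem]
  bit := by simp [h.bit]
  coef := h.coef
  supp j hj := by simp [h.supp j hj]
  lett j := by simp [h.lett j]
  cnt := by
    rw [Memory.writeNat_nat, if_pos ⟨rfl, rfl, rfl, rfl⟩, hm, h.cnt, List.filter_append,
      List.length_append, hv]
    by_cases h0 : c.cliff k u i = 0
    · simp [h0]
    · have : (c.cliff k u i : ℕ) ≠ 0 := fun h' => h0 (Fin.ext h')
      simp only [ne_eq, h0, not_false_eq_true, decide_true, List.filter_cons_of_pos,
        List.filter_nil, List.length_singleton]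
      omega
  supp' j hj := by
    have hm' : m = (P.filter fun i => c.cliff k u i ≠ 0).length := hm.trans h.cnt
    rw [Memory.writeNat_nat, if_neg (by omega), Memory.writeNat_nat]
    simp only [List.filter_append] at hj ⊢
    by_cases hjm : j < m
    · rw [if_neg (by omega), Memory.writeNat_nat, if_neg (by omega),
        h.supp' j (hm' ▸ hjm), List.getElem_append_left]
    · have h0 : c.cliff k u i ≠ 0 := by
        intro h0
        simp [h0] at hj
        simp at hm'
        omega
      have hj' : j = m := by
        simp [h0] at hj
        simp at hm'
        omega
      rw [if_pos ⟨trivial, trivial, trivial, hj'⟩, List.getElem_append_right (by omega)]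
      simp [h0]
  lett' j := by
    rw [Memory.writeNat_nat, if_neg (by omega), Memory.writeNat_nat, if_neg (by omega),
      Memory.writeNat_nat]
    by_cases hji : j = i
    · subst hji; simp [hv]
    · have : (j : ℕ) ≠ i := fun h' => hji (Fin.ext h')
      simp [this, hji, h.lett' j]
  clean k' hk' j := by
    rw [Memory.writeNat_nat, if_neg (by omega), Memory.writeNat_nat, if_neg (by omega),
      Memory.writeNat_nat, if_neg (by omega), h.clean k' hk']

end NewInv

variable {k : Fin d} {l : List (Fin n)} {u : PauliString n} {w q : ℕ} {P : List (Fin n)} {a : ℝ}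
  {M : Memory}

theorem singleGate_spec (hC : Ctx (input p Q ε δ c ρ ca O) cut r sid b o M)
    (hI : NewInv c sid k l u w q P a M) (i : Fin n) (hi : M.nat 11 9 0 0 = i)
    (h : A.partner k i = i) :
    Ctx (input p Q ε δ c ρ ca O) cut r sid b o (singleGate.apply M) ∧
    NewInv c sid k l u w q (P ++ [i]) (a * rsign (c.negAt k u i)) (singleGate.apply M) ∧
    (singleGate.apply M).nat 11 8 0 0 = M.nat 11 8 0 0 := by
  have h3 : M.nat 3 k i (u i) = (c.table1 k i (u i)).1 := by
    rw [hC.inN 3 (by omega), (input_nat_table1 p Q ε δ c ρ ca O k i (u i)).1]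
  have h4 : M.nat 4 k i (u i) = (c.negAt k u i).toNat := by
    rw [hC.inN 4 (by omega), (input_nat_table1 p Q ε δ c ρ ca O k i (u i)).2, table1_snd k h]
  have h2 : M.nat 2 k i 0 = c.isT k i := by rw [hC.inN 2 (by omega), input_nat_isT]
  have e : singleGate.apply M = (((((M.writeReal 4 0 0 0 (a * rsign (c.negAt k u i))).writeNat
      11 10 0 0 (c.cliff k u i)).writeNat 13 sid k i (c.cliff k u i)).writeNat 12 sid k
      (M.nat 11 12 0 0) i).writeNat 11 12 0 0 (M.nat 11 12 0 0 +
      ((c.cliff k u i : ℕ) - ((c.cliff k u i : ℕ) - 1)))) := by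
    rw [← table1_fst k h u, ← sign_toNat]
    simp [singleGate, Prog.put, Program.apply, setv, setr, Prog.lett, vLev, vSim, vQ, vX, vNew, nv,
      rv, sgnE, below, NExpr.eval, RExpr.eval, hC.vsim, hI.lev, hI.coef, hi, hI.lett, h2, h3, h4]
  rw [e]
  refine ⟨?_, ?_, by simp⟩
  · exact ((((hC.writeReal _ _ _ _).writeNat 11 10 _ _ _ (by omega)).writeNat 13 sid _ _ _
      (by omega)).writeNat 12 _ _ _ _ (by omega)).writeNat 11 12 _ _ _ (by omega)
  · exact ((hI.writeCoef _).writeVar 10 _ (by omega) (by omega)).put i rfl (by simp)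

theorem pairGate_spec (hC : Ctx (input p Q ε δ c ρ ca O) cut r sid b o M)
    (hI : NewInv c sid k l u w q P a M) {va vb : ℕ} (hva : va = 9 ∨ va = 10)
    (hvb : vb = 9 ∨ vb = 10) (i : Fin n) (hi : M.nat 11 va 0 0 = i)
    (hi' : M.nat 11 vb 0 0 = A.partner k i) (h : i < A.partner k i) :
    Ctx (input p Q ε δ c ρ ca O) cut r sid b o ((pairGate (nv va) (nv vb)).apply M) ∧
    NewInv c sid k l u w q (P ++ [i, A.partner k i]) (a * rsign (c.negAt k u i))
      ((pairGate (nv va) (nv vb)).apply M) ∧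
    ((pairGate (nv va) (nv vb)).apply M).nat 11 8 0 0 = M.nat 11 8 0 0 := by
  set x := A.partner k i with hx
  obtain ⟨m, hm⟩ : ∃ m : Fin 16, (m : ℕ) = u i + u i + u i + u i + u x :=
    ⟨⟨u i + u i + u i + u i + u x, by have := (u i).2; have := (u x).2; omega⟩, rfl⟩
  obtain ⟨t1, t2, t3⟩ := table2_eq (c := c) k h u m hm
  have h5 : M.nat 5 k i m = c.cliff k u i := by
    rw [hC.inN 5 (by omega), (input_nat_table2 p Q ε δ c ρ ca O k i m).1, t1]
  have h6 : M.nat 6 k i m = c.cliff k u x := by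
    rw [hC.inN 6 (by omega), (input_nat_table2 p Q ε δ c ρ ca O k i m).2.1, t2]
  have h7 : M.nat 7 k i m = (c.negAt k u i).toNat := by
    rw [hC.inN 7 (by omega), (input_nat_table2 p Q ε δ c ρ ca O k i m).2.2, t3]
  have hne : va ≠ 11 ∧ va ≠ 12 ∧ vb ≠ 11 ∧ vb ≠ 12 := by omega
  obtain ⟨n1, n2, n3, n4⟩ := hne
  have e : (pairGate (nv va) (nv vb)).apply M = ((((((((M.writeNat 11 11 0 0 m).writeReal 4 0 0 0
      (a * rsign (c.negAt k u i))).writeNat 13 sid k i (c.cliff k u i)).writeNat 12 sid k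
      (M.nat 11 12 0 0) i).writeNat 11 12 0 0 (M.nat 11 12 0 0 +
      ((c.cliff k u i : ℕ) - ((c.cliff k u i : ℕ) - 1)))).writeNat 13 sid k x
      (c.cliff k u x)).writeNat 12 sid k (M.nat 11 12 0 0 +
      ((c.cliff k u i : ℕ) - ((c.cliff k u i : ℕ) - 1))) x).writeNat 11 12 0 0
      (M.nat 11 12 0 0 + ((c.cliff k u i : ℕ) - ((c.cliff k u i : ℕ) - 1)) +
      ((c.cliff k u x : ℕ) - ((c.cliff k u x : ℕ) - 1)))) := by
    rw [← sign_toNat]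
    simp [pairGate, Prog.put, Program.apply, setv, setr, Prog.lett, vLev, vSim, vY, vNew, nv,
      rv, sgnE, below, NExpr.eval, RExpr.eval, hC.vsim, hI.lev, hI.coef, hi, hi', hI.lett,
      ← hm, h5, h6, h7, n1, n2, n3, n4]
  rw [e]
  refine ⟨?_, ?_, by simp⟩
  · exact (((((((hC.writeNat 11 11 _ _ _ (by omega)).writeReal _ _ _ _).writeNat 13 sid _ _ _
      (by omega)).writeNat 12 _ _ _ _ (by omega)).writeNat 11 12 _ _ _ (by omega)).writeNat 13 sid
      _ _ _ (by omega)).writeNat 12 _ _ _ _ (by omega)).writeNat 11 12 _ _ _ (by omega)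
  · have := (((hI.writeVar 11 m (by omega) (by omega)).writeCoef (a * rsign (c.negAt k u i))).put i
      (m := M.nat 11 12 0 0) rfl (by simp)).put x (m := M.nat 11 12 0 0 +
      ((c.cliff k u i : ℕ) - ((c.cliff k u i : ℕ) - 1))) rfl (by simp)
    rwa [List.append_assoc] at this

theorem negAt_partner (k : Fin d) {i : Fin n} (h : i < A.partner k i) (u : PauliString n) :
    c.negAt k u (A.partner k i) = false := by
  have h2 : ¬ A.partner k (A.partner k i) = A.partner k i := by rw [A.invol]; exact h.ne
  have h3 : ¬ A.partner k i < A.partner k (A.partner k i) := by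
    rw [A.invol]; exact not_lt.2 h.le
  simp only [negAt, dif_neg h2, dif_neg h3]

/-- The loop over the support applies all Clifford gates that act on it, each of them once. -/
theorem cLoop_spec (k : Fin d) (l : List (Fin n)) (u : PauliString n) (w q : ℕ)
    (rest : List (Fin n)) (j : ℕ) (P : List (Fin n)) (a : ℝ) (M : Memory)
    (hC : Ctx (input p Q ε δ c ρ ca O) cut r sid b o M) (hI : NewInv c sid k l u w q P a M)
    (hj : M.nat 11 8 0 0 = j) (hr : l.drop j = rest) :
    Exec (.loop more cBody) M (rest.length * (cBody.size + 1) + 1) fun M' =>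
      Ctx (input p Q ε δ c ρ ca O) cut r sid b o M' ∧
      NewInv c sid k l u w q (P ++ rest.flatMap (touched (A := A) k u))
        (a * ((rest.flatMap (touched (A := A) k u)).map fun i => rsign (c.negAt k u i)).prod)
        M' := by
  induction rest generalizing j P a M with
  | nil =>
    have hle : l.length ≤ j := List.drop_eq_nil_iff.1 hr
    refine (Exec.loop_done ?_ ⟨hC, by simpa using hI⟩).mono (by omega) fun _ h => h
    simp only [more, Test.Holds, NExpr.eval, vCnt, vWt, nv, hj, hI.wt]
    omega
  | cons i rest ih =>
    have hlt : j < l.length := by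
      by_contra hcon
      rw [List.drop_eq_nil_of_le (not_lt.1 hcon)] at hr
      cases hr
    rw [List.drop_eq_getElem_cons hlt] at hr
    obtain ⟨hi, hr'⟩ := List.cons.inj hr
    have hS : M.nat 12 sid (k + 1) j = i := by rw [hI.supp j hlt, hi]
    have hx : M.nat 1 k i 0 = A.partner k i := by rw [hC.inN 1 (by omega), input_nat_partner]
    refine (Exec.loop_step (B := cBody.size) (B' := rest.length * (cBody.size + 1) + 1) ?_
      (Exec.of_loopFree ?_ M ?_)).mono (by rw [List.length_cons]; ring_nf; omega) fun _ h => h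
    · simp only [more, Test.Holds, NExpr.eval, vCnt, vWt, nv, hj, hI.wt]
      omega
    · simp [cBody, singleGate, pairGate, Prog.put, Program.LoopFree, setv, setr]
    · -- The state in front of the case distinction.
      let M1 := (M.writeNat 11 9 0 0 i).writeNat 11 10 0 0 (A.partner k i)
      have hC1 : Ctx (input p Q ε δ c ρ ca O) cut r sid b o M1 :=
        (hC.writeNat 11 9 _ _ _ (by omega)).writeNat 11 10 _ _ _ (by omega)
      have hI1 : NewInv c sid k l u w q P a M1 :=
        (hI.writeVar 9 _ (by omega) (by omega)).writeVar 10 _ (by omega) (by omega)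
      have hi1 : M1.nat 11 9 0 0 = i := by simp [M1]
      have hx1 : M1.nat 11 10 0 0 = A.partner k i := by simp [M1]
      have hj1 : M1.nat 11 8 0 0 = j := by simp [M1, hj]
      -- It suffices to know the effect of the case distinction.
      have key : ∀ G : Program,
          (Program.cond (.and (.natLe vX vQ) (.natLe vQ vX)) singleGate
            (.cond (.natLe vQ vX) (pairGate vQ vX)
              (.cond (.natLe (Prog.lett vLev vX) (.lit 0)) (pairGate vX vQ) .skip))).apply M1 =
            G.apply M1 →
          (Ctx (input p Q ε δ c ρ ca O) cut r sid b o (G.apply M1) ∧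
          NewInv c sid k l u w q (P ++ touched (A := A) k u i)
            (a * ((touched (A := A) k u i).map fun i => rsign (c.negAt k u i)).prod)
            (G.apply M1) ∧ (G.apply M1).nat 11 8 0 0 = M1.nat 11 8 0 0) →
          Exec (.loop more cBody) (cBody.apply M) (rest.length * (cBody.size + 1) + 1) fun M' =>
            Ctx (input p Q ε δ c ρ ca O) cut r sid b o M' ∧
            NewInv c sid k l u w q (P ++ (i :: rest).flatMap (touched (A := A) k u))
              (a * (((i :: rest).flatMap (touched (A := A) k u)).map
                fun i => rsign (c.negAt k u i)).prod) M' := by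
        rintro G hG ⟨g1, g2, g3⟩
        have e : cBody.apply M = (G.apply M1).writeNat 11 8 0 0 (j + 1) := by
          have e0 : (setv 10 (.get 1 below vQ (.lit 0))).apply
              ((setv 9 (Prog.supp vLev vCnt)).apply M) = M1 := by
            simp [M1, Program.apply, setv, Prog.supp, vLev, vCnt, vSim, vQ, nv, below, NExpr.eval,
              hj, hC.vsim, hI.lev, hS, hx]
          simp only [cBody, Program.apply_seq]
          rw [e0, hG]
          simp [Program.apply, setv, vCnt, nv, NExpr.eval, g3, hj1]
        rw [e]
        have := ih (j + 1) _ _ _ (g1.writeNat 11 8 0 0 (j + 1) (by omega))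
          (g2.writeVar 8 (j + 1) (by omega) (by omega)) (by simp) hr'
        rw [List.append_assoc, mul_assoc, ← List.prod_append, ← List.map_append] at this
        exact this
      have hQX : (Test.natLe vQ vX).Holds M1 ↔ i ≤ A.partner k i := by
        simp only [Test.Holds, NExpr.eval, vQ, vX, nv, hi1, hx1, Fin.val_fin_le]
      have hXQ : (Test.natLe vX vQ).Holds M1 ↔ A.partner k i ≤ i := by
        simp only [Test.Holds, NExpr.eval, vQ, vX, nv, hi1, hx1, Fin.val_fin_le]
      have hand : (Test.and (.natLe vX vQ) (.natLe vQ vX)).Holds M1 ↔ A.partner k i = i := by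
        rw [Test.Holds, hQX, hXQ, le_antisymm_iff]
      have hzero : (Test.natLe (Prog.lett vLev vX) (.lit 0)).Holds M1 ↔
          u (A.partner k i) = 0 := by
        simp only [Test.Holds, NExpr.eval, Prog.lett, vLev, vSim, vX, nv, hC1.vsim, hI1.lev, hx1,
          hI1.lett]
        rw [Nat.le_zero, Fin.val_eq_zero_iff]
      by_cases h1 : A.partner k i = i
      · refine key singleGate (Program.apply_cond_pos (hand.2 h1) _ _) ?_
        have ht : touched (A := A) k u i = [i] := if_pos h1
        rw [ht, List.map_singleton, List.prod_singleton]
        exact singleGate_spec hC1 hI1 i hi1 h1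
      · rcases lt_or_gt_of_ne h1 with h2 | h2
        · have h2' : A.partner k i < A.partner k (A.partner k i) := by rwa [A.invol]
          by_cases h3 : u (A.partner k i) = 0
          · refine key (pairGate vX vQ) ?_ ?_
            · rw [Program.apply_cond_neg (fun h => h1 (hand.1 h)),
                Program.apply_cond_neg (fun h => not_le.2 h2 (hQX.1 h)),
                Program.apply_cond_pos (hzero.2 h3)]
            · have ht : touched (A := A) k u i = [A.partner k i, i] := by
                simp [touched, h1, h3, not_lt.2 h2.le]
              have := pairGate_spec hC1 hI1 (Or.inr rfl) (Or.inl rfl) (A.partner k i) hx1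
                (by rw [A.invol, hi1]) h2'
              rw [ht]
              have hn := negAt_partner (c := c) k h2' u
              rw [A.invol] at this hn
              simpa [hn, rsign, vX, vQ] using this
          · refine key .skip ?_ ?_
            · rw [Program.apply_cond_neg (fun h => h1 (hand.1 h)),
                Program.apply_cond_neg (fun h => not_le.2 h2 (hQX.1 h)),
                Program.apply_cond_neg (fun h => h3 (hzero.1 h))]
            · have ht : touched (A := A) k u i = [] := by
                simp [touched, h1, h3, not_lt.2 h2.le]
              rw [ht]
              exact ⟨hC1, by simpa [Program.apply] using hI1, rfl⟩
        · refine key (pairGate vQ vX) ?_ ?_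
          · rw [Program.apply_cond_neg (fun h => h1 (hand.1 h)),
              Program.apply_cond_pos (hQX.2 (le_of_lt h2))]
          · have ht : touched (A := A) k u i = [i, A.partner k i] := by
              simp [touched, h1, show i < A.partner k i from h2]
            have := pairGate_spec hC1 hI1 (Or.inl rfl) (Or.inr rfl) i hi1 hx1 h2
            rw [ht]
            have hn := negAt_partner (c := c) k h2 u
            simpa [hn, rsign, vX, vQ] using this

end CliffordLoop

end PauliPath

namespace PauliPath
open Prog Circuit

/-! ### The simulation of one path -/

section Simulation

variable {n d N : ℕ} {A : Architecture n d} {p Q ε δ : ℝ} {c : Circuit A}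
  {ρ : Fin n → QubitState} {ca : Fin N → ℝ} {O : Fin N → PauliString n}
  {cut r sid : ℕ} {b : ℕ → Bool} {o : ℝ}

theorem enum_run_tDec (isT : Fin n → ℕ) (η : ℝ) {l : List (Fin n)} (rest : List (Fin n))
    {s : PauliString n} (h : Enum l s) (a : ℝ) (q : ℕ) :
    Enum l ((tDec isT η rest s a).run b q).1.1 := by
  induction rest generalizing s a q with
  | nil => exact h
  | cons i rest ih =>
    rw [tDec]
    split_ifs with h1
    · rw [Dec.run]
      exact ih (h.update h1.2 (by cases b q <;> simp)) _ _
    · exact ih h _ _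

/-- Gates that meet only identities contribute no sign, so the touched qubits suffice. -/
theorem sgn_eq_prod (k : Fin d) {l : List (Fin n)} {u : PauliString n} (h : Enum l u) :
    c.sgn k u = ((l.flatMap (touched (A := A) k u)).map fun i => rsign (c.negAt k u i)).prod := by
  rw [sgn, ← List.prod_toFinset _ (nodup_flatMap_touched k h)]
  refine (Finset.prod_subset (Finset.subset_univ _) fun i _ hi => ?_).symm
  rw [List.mem_toFinset] at hi
  have h0 : u i = 0 ∧ u (A.partner k i) = 0 := by
    by_contra h0
    exact hi (mem_flatMap_touched k h (by tauto))
  rw [negAt_zero c k h0.1 h0.2]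
  rfl

/-- The end of a level. If the new string is too heavy, the computation is stopped by an empty
support list together with the coefficient zero. -/
theorem levelEnd_spec {k : Fin d} {l : List (Fin n)} {u : PauliString n} {w q : ℕ} {a : ℝ}
    {M : Memory} (hu : Enum l u) (hC : Ctx (input p Q ε δ c ρ ca O) cut r sid b o M)
    (hI : NewInv c sid k l u w q (l.flatMap (touched (A := A) k u)) a M) :
    Ctx (input p Q ε δ c ρ ca O) cut r sid b o (levelEnd.apply M) ∧
    if (c.next k l u).length ≤ w then
      LevInv sid k (c.next k l u) (c.cliff k u) (w - (c.next k l u).length) q a (levelEnd.apply M)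
    else LevInv sid k ([] : List (Fin n)) (c.cliff k u) w q 0 (levelEnd.apply M) := by
  have hnew : M.nat 11 12 0 0 = (c.next k l u).length := hI.cnt
  have hlett : ∀ i : Fin n, M.nat 13 sid k i = c.cliff k u i := by
    intro i
    rw [hI.lett' i]
    split_ifs with hi
    · rfl
    · have h0 : u i = 0 ∧ u (A.partner k i) = 0 := by
        by_contra h0
        exact hi (mem_flatMap_touched k hu (by tauto))
      rw [cliff_zero_apply c k h0.1 h0.2]
      rfl
  have hcond : (Test.natLe vNew vRem).Holds ((setv 5 below).apply M) ↔
      (c.next k l u).length ≤ w := by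
    simp [Test.Holds, NExpr.eval, vNew, vRem, nv, Program.apply, setv, hnew, hI.rem]
  split_ifs with hw
  · have e : levelEnd.apply M = ((M.writeNat 11 5 0 0 k).writeNat 11 6 0 0
        (c.next k l u).length).writeNat 11 7 0 0 (w - (c.next k l u).length) := by
      rw [levelEnd, Program.apply_seq, Program.apply_cond_pos (hcond.2 hw)]
      simp [Program.apply, setv, below, vNew, vRem, vLev, nv, NExpr.eval, hnew, hI.rem, hI.lev]
    rw [e]
    refine ⟨((hC.writeNat _ _ _ _ _ (by omega)).writeNat _ _ _ _ _ (by omega)).writeNat _ _ _ _ _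
      (by omega), ⟨by simp, by simp, by simp, by simp [hI.bit], hI.coef, ?_, ?_, ?_⟩⟩
    · intro j hj
      refine Eq.trans ?_ (hI.supp' j hj)
      simp
    · intro i; simpa using hlett i
    · intro k' hk' i; simpa using hI.clean k' hk' i
  · have e : levelEnd.apply M = ((M.writeNat 11 5 0 0 k).writeNat 11 6 0 0 0).writeReal 4 0 0 0
        0 := by
      rw [levelEnd, Program.apply_seq, Program.apply_cond_neg (mt hcond.1 hw)]
      simp [Program.apply, setv, setr, below, vLev, nv, NExpr.eval, RExpr.eval, hI.lev]
    rw [e]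
    refine ⟨((hC.writeNat _ _ _ _ _ (by omega)).writeNat _ _ _ _ _ (by omega)).writeReal _ _ _ _,
      ⟨by simp, by simp, by simp [hI.rem], by simp [hI.bit], by simp, ?_, ?_, ?_⟩⟩
    · intro j hj; simp at hj
    · intro i; simpa using hlett i
    · intro k' hk' i; simpa using hI.clean k' hk' i

theorem levelBody_spec (k : Fin d) {l : List (Fin n)} {s : PauliString n} {w q : ℕ} {a : ℝ}
    {M : Memory} (hs : Enum l s) (hC : Ctx (input p Q ε δ c ρ ca O) cut r sid b o M)
    (hL : LevInv sid (k + 1) l s w q a M) :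
    Exec levelBody M (l.length * (tBody.size + cBody.size + 2) + (levelEnd.size + 5)) fun M' =>
      Ctx (input p Q ε δ c ρ ca O) cut r sid b o M' ∧
      if (c.next k l ((tDec (c.isT k) (1 - p) l s a).run b q).1.1).length ≤ w then
        LevInv sid k (c.next k l ((tDec (c.isT k) (1 - p) l s a).run b q).1.1)
          (c.cliff k ((tDec (c.isT k) (1 - p) l s a).run b q).1.1)
          (w - (c.next k l ((tDec (c.isT k) (1 - p) l s a).run b q).1.1).length)
          ((tDec (c.isT k) (1 - p) l s a).run b q).2
          (((tDec (c.isT k) (1 - p) l s a).run b q).1.2 *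
            c.sgn k ((tDec (c.isT k) (1 - p) l s a).run b q).1.1) M'
      else LevInv sid k ([] : List (Fin n))
          (c.cliff k ((tDec (c.isT k) (1 - p) l s a).run b q).1.1) w
          ((tDec (c.isT k) (1 - p) l s a).run b q).2 0 M' := by
  have hu : Enum l ((tDec (c.isT k) (1 - p) l s a).run b q).1.1 := enum_run_tDec _ _ _ hs _ _
  generalize hrun : (tDec (c.isT k) (1 - p) l s a).run b q = y at hu ⊢
  refine (Exec.seq (B := 1) (B' := (l.length * (tBody.size + 1) + 1) +
    (2 + ((l.length * (cBody.size + 1) + 1) + levelEnd.size)))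
    (Exec.of_loopFree (P := setv 8 (.lit 0)) trivial M ?_)).mono
    (by ring_nf; omega) fun _ h => h
  refine Exec.seq ((tLoop_spec k l w l 0 s a q _ (hC.writeNat 11 8 0 0 0 (by omega)) ?_ (by simp)
    rfl).mono le_rfl ?_)
  · exact ⟨by simp [hL.lev], by simp [hL.wt], by simp [hL.rem], by simp [hL.bit], hL.coef,
      fun j hj => by simp [hL.supp j hj], fun i => by simp [hL.lett],
      fun k' hk' i => by simp [hL.clean k' hk']⟩
  · rintro M1 ⟨hC1, hL1⟩
    rw [hrun] at hL1
    refine Exec.seq (B := 2) (Exec.of_loopFree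
      (P := .seq (setv 8 (.lit 0)) (setv 12 (.lit 0))) ⟨trivial, trivial⟩ M1 ?_)
    have e : (Program.seq (setv 8 (.lit 0)) (setv 12 (.lit 0))).apply M1 =
      (M1.writeNat 11 8 0 0 0).writeNat 11 12 0 0 0 := rfl
    rw [e]
    refine Exec.seq ((cLoop_spec k l y.1.1 w y.2 l 0 [] y.1.2 _
      ((hC1.writeNat 11 8 0 0 0 (by omega)).writeNat 11 12 0 0 0 (by omega)) ?_ (by simp)
      rfl).mono le_rfl ?_)
    · exact ⟨by simp [hL1.lev], by simp [hL1.wt], by simp [hL1.rem], by simp [hL1.bit], hL1.coef,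
        fun j hj => by simp [hL1.supp j hj], fun i => by simp [hL1.lett], by simp,
        fun j hj => by simp at hj, fun i => by simp [hL1.clean k (Nat.lt_succ_self _)],
        fun k' hk' i => by simp [hL1.clean k' (Nat.lt_succ_of_lt hk')]⟩
    · rintro M2 ⟨hC2, hI2⟩
      rw [← sgn_eq_prod k hu, List.nil_append] at hI2
      exact Exec.of_loopFree (by simp [levelEnd, Program.LoopFree, setv, setr]) M2
        (levelEnd_spec hu hC2 hI2)

/-- Number of steps per unit of weight in the loop over all levels. -/
def levelCost : ℕ := tBody.size + cBody.size + 2 + (levelEnd.size + 5) + 1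

/-- The time is charged to the weight of the path, as a level is only processed if its string has
positive weight. The final state has no layers left, or an empty support. -/
theorem levelLoop_spec (k : ℕ) (hk : k ≤ d) {l : List (Fin n)} {s : PauliString n} {w q : ℕ} {a : ℝ}
    {M : Memory} (hs : Enum l s) (hC : Ctx (input p Q ε δ c ρ ca O) cut r sid b o M)
    (hL : LevInv sid k l s w q a M) :
    Exec levelLoop M (levelCost * (l.length + w) + 1) fun M' =>
      Ctx (input p Q ε δ c ρ ca O) cut r sid b o M' ∧
      ∃ k' l' s' w' q' a', LevInv sid k' l' s' w' q' a' M' ∧ l'.length ≤ l.length + w ∧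
        (c.sim p (bloch ρ) k hk l s w a).run b q =
          (a' * (l'.map fun i => (1 - p) * bloch ρ i (s' i)).prod, q') := by
  induction k generalizing l s w q a M with
  | zero =>
    refine (Exec.loop_done ?_ ⟨hC, 0, l, s, w, q, a, hL, by omega, rfl⟩).mono (by omega)
      fun _ h => h
    simp [Test.Holds, NExpr.eval, vLev, nv, hL.lev]
  | succ k ih =>
    by_cases hl : l = []
    · refine (Exec.loop_done ?_ ⟨hC, _, l, s, w, q, a, hL, by omega, ?_⟩).mono (by omega)
        fun _ h => h
      · simp [Test.Holds, NExpr.eval, vWt, nv, hL.wt, hl]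
      · rw [sim, if_pos hl, hl]; simp [Dec.run]
    · have hpos : 1 ≤ l.length := List.length_pos_iff.2 hl
      have hcost : l.length * (tBody.size + cBody.size + 2) + (levelEnd.size + 5) +
          (levelCost * w + 1) + 1 ≤ levelCost * (l.length + w) + 1 := by
        unfold levelCost
        nlinarith
      refine (Exec.loop_step ?_ ((levelBody_spec ⟨k, hk⟩ hs hC hL).mono le_rfl ?_)).mono hcost
        fun _ h => h
      · simp [Test.Holds, NExpr.eval, vLev, vWt, nv, hL.lev, hL.wt, hpos]
      · rintro M1 ⟨hC1, h1⟩
        have hu : Enum l ((tDec (c.isT ⟨k, hk⟩) (1 - p) l s a).run b q).1.1 :=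
          enum_run_tDec _ _ _ hs _ _
        rw [sim, if_neg hl, Dec.run_bind]
        generalize (tDec (c.isT ⟨k, hk⟩) (1 - p) l s a).run b q = y at h1 hu ⊢
        split_ifs at h1 ⊢ with hw
        · refine (ih (by omega) (c.enum_next ⟨k, hk⟩ hu) hC1 h1).mono ?_ ?_
          · rw [Nat.add_sub_cancel' hw]
          · rintro M2 ⟨hC2, k', l', s', w', q', a', g1, g2, g3⟩
            exact ⟨hC2, k', l', s', w', q', a', g1, by omega, g3⟩
        · refine (Exec.loop_done ?_ ⟨hC1, _, [], _, w, y.2, 0, h1, by simp, ?_⟩).mono (by omega)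
            fun _ h => h
          · simp [Test.Holds, NExpr.eval, vWt, nv, h1.wt]
          · simp [Dec.run]

theorem finLoop_spec {k : ℕ} {l : List (Fin n)} {s : PauliString n} {w q : ℕ}
    (rest : List (Fin n)) (j : ℕ) {a : ℝ} {M : Memory}
    (hC : Ctx (input p Q ε δ c ρ ca O) cut r sid b o M) (hL : LevInv sid k l s w q a M)
    (hj : M.nat 11 8 0 0 = j) (hr : l.drop j = rest) :
    Exec (.loop more finBody) M (rest.length * (finBody.size + 1) + 1) fun M' =>
      Ctx (input p Q ε δ c ρ ca O) cut r sid b o M' ∧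
      LevInv sid k l s w q (a * (rest.map fun i => (1 - p) * bloch ρ i (s i)).prod) M' := by
  induction rest generalizing j a M with
  | nil =>
    have hle : l.length ≤ j := List.drop_eq_nil_iff.1 hr
    refine (Exec.loop_done ?_ ⟨hC, by simpa using hL⟩).mono (by omega) fun _ h => h
    simp only [more, Test.Holds, NExpr.eval, vCnt, vWt, nv, hj, hL.wt]
    omega
  | cons i rest ih =>
    have hlt : j < l.length := by
      by_contra hcon
      rw [List.drop_eq_nil_of_le (not_lt.1 hcon)] at hr
      cases hr
    rw [List.drop_eq_getElem_cons hlt] at hr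
    obtain ⟨hi, hr'⟩ := List.cons.inj hr
    have hS : M.nat 12 sid k j = i := by rw [hL.supp j hlt, hi]
    have hp : M.real 1 0 0 0 = p := by
      rw [hC.inR 1 le_rfl (by omega)]; exact (input_real_params p Q ε δ c ρ ca O).1
    have hb : M.real 3 i (s i) 0 = bloch ρ i (s i) := by
      rw [hC.inR 3 (by omega) le_rfl, input_real_bloch]
    refine (Exec.loop_step (B := finBody.size) (B' := rest.length * (finBody.size + 1) + 1) ?_
      (Exec.of_loopFree ?_ M ?_)).mono (by rw [List.length_cons]; ring_nf; omega) fun _ h => h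
    · simp only [more, Test.Holds, NExpr.eval, vCnt, vWt, nv, hj, hL.wt]
      omega
    · simp [finBody, Program.LoopFree, setv, setr]
    · have e : finBody.apply M = ((M.writeNat 11 9 0 0 i).writeReal 4 0 0 0
          (a * ((1 - p) * bloch ρ i (s i)))).writeNat 11 8 0 0 (j + 1) := by
        simp [finBody, Program.apply, setv, setr, Prog.supp, Prog.lett, vLev, vCnt, vSim, vQ, nv,
          rv, damp, NExpr.eval, RExpr.eval, hj, hC.vsim, hL.lev, hL.coef, hS, hp, hb, hL.lett]
      rw [e]
      have := ih (j + 1) (((hC.writeNat 11 9 0 0 i (by omega)).writeReal 0 0 0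
        (a * ((1 - p) * bloch ρ i (s i)))).writeNat 11 8 0 0 (j + 1) (by omega))
        (a := a * ((1 - p) * bloch ρ i (s i)))
        ⟨by simp [hL.lev], by simp [hL.wt], by simp [hL.rem], by simp [hL.bit], by simp,
          fun j hj => by simp [hL.supp j hj], fun i => by simp [hL.lett],
          fun k' hk' i => by simp [hL.clean k' hk']⟩ (by simp) hr'
      rwa [mul_assoc, ← List.prod_cons, ← List.map_cons (f := fun i => (1 - p) * bloch ρ i (s i))]
        at this

/-- The memory while a Pauli string with support list `l` is loaded; the first `j` of its letters
are present. -/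
structure LoadInv (sid k : ℕ) (l : List (Fin n)) (s : PauliString n) (w : ℕ) (a : ℝ) (j : ℕ)
    (M : Memory) : Prop where
  lev : M.nat 11 5 0 0 = k
  wt : M.nat 11 6 0 0 = l.length
  rem : M.nat 11 7 0 0 = w
  bit : M.nat 11 4 0 0 = 0
  cnt : M.nat 11 8 0 0 = j
  coef : M.real 4 0 0 0 = a
  supp : ∀ j' (h : j' < l.length), j' < j → M.nat 12 sid k j' = l[j']
  lett : ∀ i : Fin n, M.nat 13 sid k i = if i ∈ l.take j then (s i : ℕ) else 0
  clean : ∀ k' < k, ∀ i, M.nat 13 sid k' i = 0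

theorem loadLoop_spec {r : Fin N} {k : ℕ} {w : ℕ} {a : ℝ} (rest : List (Fin n)) (j : ℕ) {M : Memory}
    (hC : Ctx (input p Q ε δ c ρ ca O) cut r sid b o M)
    (hL : LoadInv sid k ((O r).support.sort (· ≤ ·)) (O r) w a j M)
    (hr : ((O r).support.sort (· ≤ ·)).drop j = rest) :
    Exec (.loop more loadBody) M (rest.length * (loadBody.size + 1) + 1) fun M' =>
      Ctx (input p Q ε δ c ρ ca O) cut r sid b o M' ∧
      LevInv sid k ((O r).support.sort (· ≤ ·)) (O r) w 0 a M' := by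
  set l := (O r).support.sort (· ≤ ·) with hl
  induction rest generalizing j M with
  | nil =>
    have hle : l.length ≤ j := List.drop_eq_nil_iff.1 hr
    refine (Exec.loop_done ?_ ⟨hC, hL.lev, hL.wt, hL.rem, hL.bit, hL.coef,
      fun j' hj' => hL.supp j' hj' (by omega), fun i => ?_, hL.clean⟩).mono (by omega) fun _ h => h
    · simp only [more, Test.Holds, NExpr.eval, vCnt, vWt, nv, hL.cnt, hL.wt]
      omega
    · rw [hL.lett, List.take_of_length_le hle]
      split_ifs with hi
      · rfl
      · rw [hl, Finset.mem_sort, PauliString.mem_support, not_not] at hi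
        rw [hi]
        rfl
  | cons i rest ih =>
    have hlt : j < l.length := by
      by_contra hcon
      rw [List.drop_eq_nil_of_le (not_lt.1 hcon)] at hr
      cases hr
    rw [List.drop_eq_getElem_cons hlt] at hr
    obtain ⟨hi, hr'⟩ := List.cons.inj hr
    have h9 : M.nat 9 r j 0 = i := by
      rw [hC.inN 9 (by omega), input_nat_support _ _ _ _ _ _ _ _ _ _ hlt, ← hi]
    have h10 : M.nat 10 r i 0 = (O r i : ℕ) := by
      rw [hC.inN 10 (by omega), input_nat_letter]
    refine (Exec.loop_step (B := loadBody.size) (B' := rest.length * (loadBody.size + 1) + 1) ?_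
      (Exec.of_loopFree ?_ M ?_)).mono (by rw [List.length_cons]; ring_nf; omega) fun _ h => h
    · simp only [more, Test.Holds, NExpr.eval, vCnt, vWt, nv, hL.cnt, hL.wt]
      omega
    · simp [loadBody, Program.LoopFree, setv]
    · have e : loadBody.apply M = ((M.writeNat 12 sid k j i).writeNat 13 sid k i
          (O r i)).writeNat 11 8 0 0 (j + 1) := by
        simp [loadBody, Program.apply, setv, vLev, vCnt, vSim, vObs, nv,
          NExpr.eval, hL.cnt, hC.vsim, hC.vobs, hL.lev, h9, h10]
      rw [e]
      refine ih (j + 1) (((hC.writeNat 12 _ _ _ _ (by omega)).writeNat 13 sid _ _ _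
        (by omega)).writeNat 11 8 0 0 (j + 1) (by omega))
        ⟨by simp [hL.lev], by simp [hL.wt], by simp [hL.rem], by simp [hL.bit], by simp, hL.coef,
          fun j' hj' hlt' => ?_, fun i' => ?_,
          fun k' hk' i => by simp [hL.clean k' hk', hk'.ne]⟩ hr'
      · by_cases hjj : j' = j
        · subst hjj; simp [hi]
        · simp [hjj, hL.supp j' hj' (by omega)]
      · rw [List.take_add_one, List.getElem?_eq_getElem hlt, hi]
        by_cases hii : i' = i
        · subst hii; simp
        · simp [hii, Fin.val_inj, hL.lett i']

/-- The memory is ready for the simulation with number `sid`. -/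
def Ready (I : Memory) (cut r sid : ℕ) (b : ℕ → Bool) (o : ℝ) (M : Memory) : Prop :=
  Ctx I cut r sid b o M ∧ ∀ k i, M.nat 13 sid k i = 0

/-- A bound for the running time of a simulation with cut-off `0`, and for its increment with the
cut-off. -/
def simCost : ℕ := simStart.size + loadBody.size + levelCost + finBody.size + simEnd.size + 20

/-- Given that the loop over all levels has reached a leaf, the rest of the simulation adds the
value of the leaf to the output and passes on to fresh memory. -/
theorem simulate_tail_spec {M : Memory} {v : ℝ × ℕ}
    (h : Exec levelLoop M (levelCost * cut + 1) fun M' =>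
      Ctx (input p Q ε δ c ρ ca O) cut r sid b o M' ∧
      ∃ k l s w q a, LevInv sid k l s w q a M' ∧ l.length ≤ cut ∧
        v = (a * (l.map fun i => (1 - p) * bloch ρ i (s i)).prod, q)) :
    Exec (.seq levelLoop <| .seq (setv 8 (.lit 0)) <| .seq (.loop more finBody) simEnd) M
      ((levelCost * cut + 1) + (1 + ((cut * (finBody.size + 1) + 1) + simEnd.size))) fun M' =>
        Ready (input p Q ε δ c ρ ca O) cut r (sid + 1) b (o + v.1) M' ∧
          M'.nat 11 14 0 0 = v.2 := by
  refine Exec.seq (h.mono le_rfl ?_)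
  rintro M1 ⟨hC1, k, l, s, w, q, a, hL1, hlen, rfl⟩
  refine Exec.seq (B := 1) (Exec.of_loopFree (P := setv 8 (.lit 0)) trivial M1 ?_)
  refine Exec.seq ((finLoop_spec l 0 (M := (setv 8 (.lit 0)).apply M1)
    (hC1.writeNat 11 8 0 0 0 (by omega)) (l := l) (k := k) (s := s) (w := w) (q := q) (a := a)
    ⟨by simp [Program.apply, setv, NExpr.eval, hL1.lev],
      by simp [Program.apply, setv, NExpr.eval, hL1.wt],
      by simp [Program.apply, setv, NExpr.eval, hL1.rem],
      by simp [Program.apply, setv, NExpr.eval, hL1.bit], hL1.coef,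
      fun j hj => by simp [Program.apply, setv, NExpr.eval, hL1.supp j hj],
      fun i => by simp [Program.apply, setv, NExpr.eval, hL1.lett],
      fun k' hk' i => by simp [Program.apply, setv, NExpr.eval, hL1.clean k' hk']⟩
    (by simp [Program.apply, setv, NExpr.eval]) rfl).mono
      (by gcongr) ?_)
  rintro M2 ⟨hC2, hL2⟩
  refine Exec.of_loopFree (by simp [simEnd, Program.LoopFree, setv]) M2 ?_
  generalize a * (l.map fun i => (1 - p) * bloch ρ i (s i)).prod = z at hL2 ⊢
  have e : simEnd.apply M2 = ((M2.writeReal 0 0 0 0 (o + z)).writeNat 11 2 0 0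
      (sid + 1)).writeNat 11 14 0 0 q := by
    simp [simEnd, Program.apply, setv, vSim, vBit, nv, rv, NExpr.eval, RExpr.eval, hC2.vsim,
      hC2.out,      hL2.coef, hL2.bit]
  rw [e]
  refine ⟨⟨⟨?_, ?_, ?_, ?_, ?_, ?_, ?_, ?_⟩, ?_⟩, by simp⟩
  · intro a' ha'
    rw [← hC2.inN a' ha']
    funext i' j' k'
    simp [show a' ≠ 11 by omega]
  · intro a' h1 h2
    rw [← hC2.inR a' h1 h2]
    funext i' j' k'
    simp [show a' ≠ 0 by omega]
  · simp [hC2.vcut]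
  · simp [hC2.vobs]
  · simp
  · intro q'; simp [hC2.bits]
  · intro id hid k' i'
    simp [hC2.fresh id (by omega)]
  · simp
  · intro k' i'
    simp [hC2.fresh (sid + 1) (Nat.lt_succ_self _)]

/-- One simulation adds to the output the value of the leaf that is addressed by the bits `b`, and
reports how many of them were read. -/
theorem simulate_spec {r : Fin N} {M : Memory}
    (hR : Ready (input p Q ε δ c ρ ca O) cut r sid b o M) :
    Exec simulate M (simCost * (cut + 1)) fun M' =>
      Ready (input p Q ε δ c ρ ca O) cut r (sid + 1) b (o + ((c.simTop p (bloch ρ) cut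
        ((O r).support.sort (· ≤ ·)) (O r) (ca r)).run b 0).1) M' ∧
      M'.nat 11 14 0 0 = ((c.simTop p (bloch ρ) cut
        ((O r).support.sort (· ≤ ·)) (O r) (ca r)).run b 0).2 := by
  set l := (O r).support.sort (· ≤ ·) with hl
  have hE : Enum l (O r) := ⟨Finset.sort_nodup _ _, fun i => by
    rw [hl, Finset.mem_sort, PauliString.mem_support]⟩
  obtain ⟨hC, hclean⟩ := hR
  have h01 : M.nat 0 1 0 0 = d := by
    rw [hC.inN 0 (by omega)]; rfl
  have h8 : M.nat 8 r 0 0 = l.length := by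
    rw [hC.inN 8 (by omega), input_nat_weight, hE.length_eq]
  have h2 : M.real 2 r 0 0 = ca r := by
    rw [hC.inR 2 (by omega) (by omega), input_real_coeff]
  let M1 := (((((M.writeNat 11 4 0 0 0).writeNat 11 5 0 0 d).writeNat 11 6 0 0 l.length).writeNat
    11 7 0 0 cut).writeNat 11 8 0 0 0).writeReal 4 0 0 0 (ca r)
  have e1 : simStart.apply M = M1 := by
    simp [M1, simStart, Program.apply, setv, setr, vObs, vCut, nv, NExpr.eval, RExpr.eval, h01, h8,
      h2, hC.vobs, hC.vcut]
  have hC1 : Ctx (input p Q ε δ c ρ ca O) cut r sid b o M1 :=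
    (((((hC.writeNat 11 4 _ _ _ (by omega)).writeNat 11 5 _ _ _ (by omega)).writeNat 11 6 _ _ _
      (by omega)).writeNat 11 7 _ _ _ (by omega)).writeNat 11 8 _ _ _ (by omega)).writeReal _ _ _ _
  have hcond : (Test.natLe vWt vRem).Holds M1 ↔ l.length ≤ cut := by
    simp [M1, Test.Holds, NExpr.eval, vWt, vRem, nv]
  by_cases hw : l.length ≤ cut
  · rw [simTop, if_pos hw]
    refine (Exec.seq (B := simStart.size) (B' := (1 + (cut * (loadBody.size + 1) + 1) + 1) +
      ((levelCost * cut + 1) + (1 + ((cut * (finBody.size + 1) + 1) + simEnd.size))))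
      (Exec.of_loopFree (by simp [simStart, Program.LoopFree, setv, setr]) M ?_)).mono
      (by unfold simCost; ring_nf; omega) fun _ h => h
    rw [e1]
    refine Exec.seq (Exec.cond_true (hcond.2 hw) (Exec.seq (B := 1) (Exec.of_loopFree
      (P := setv 7 (.sub vRem vWt)) trivial M1 ?_)))
    have e2 : (setv 7 (.sub vRem vWt)).apply M1 = M1.writeNat 11 7 0 0 (cut - l.length) := by
      simp [M1, Program.apply, setv, vRem, vWt, nv, NExpr.eval]
    rw [e2]
    refine (loadLoop_spec l 0 (hC1.writeNat 11 7 _ _ _ (by omega)) (k := d) (w := cut - l.length)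
      (a := ca r) ⟨by simp [M1], by simp [M1, hl], by simp, by simp [M1], by simp [M1],
        by simp [M1], fun j' _ h => absurd h (Nat.not_lt_zero _), fun i => by simp [M1, hclean],
        fun k' hk' i => by simp [M1, hclean]⟩ rfl).mono (by gcongr) ?_
    rintro M2 ⟨hC2, hL2⟩
    refine simulate_tail_spec ((levelLoop_spec d le_rfl hE hC2 hL2).mono
      (by rw [Nat.add_sub_cancel' hw]) ?_)
    rintro M3 ⟨hC3, k', l', s', w', q', a', g1, g2, g3⟩
    exact ⟨hC3, k', l', s', w', q', a', g1, by omega, g3⟩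
  · rw [simTop, if_neg hw]
    refine (Exec.seq (B := simStart.size) (B' := (2 + 1) +
      ((levelCost * cut + 1) + (1 + ((cut * (finBody.size + 1) + 1) + simEnd.size))))
      (Exec.of_loopFree (by simp [simStart, Program.LoopFree, setv, setr]) M ?_)).mono
      (by unfold simCost; ring_nf; omega) fun _ h => h
    rw [e1]
    refine Exec.seq (Exec.cond_false (mt hcond.1 hw) (Exec.of_loopFree
      (P := .seq (setv 6 (.lit 0)) (setr 0 (.ofNat (.lit 0)))) ⟨trivial, trivial⟩ M1 ?_))
    have e2 : (Program.seq (setv 6 (.lit 0)) (setr 0 (.ofNat (.lit 0)))).apply M1 =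
        (M1.writeNat 11 6 0 0 0).writeReal 4 0 0 0 0 := by
      simp [Program.apply, setv, setr, NExpr.eval, RExpr.eval]
    rw [e2]
    refine simulate_tail_spec ((Exec.loop_done ?_ ⟨(hC1.writeNat 11 6 _ _ _ (by omega)).writeReal _
      _ _ _, d, ([] : List (Fin n)), 0, cut, 0, 0, ⟨by simp [M1], by simp, by simp [M1],
        by simp [M1], by simp, fun j hj => absurd hj (Nat.not_lt_zero _),
        fun i => by simp [M1, hclean], fun k' hk' i => by simp [M1, hclean]⟩, by simp, ?_⟩).mono
      (by omega) fun _ h => h)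
    · simp [Test.Holds, NExpr.eval, vWt, vLev, nv]
    · simp [Dec.run]

end Simulation

end PauliPath

namespace PauliPath
open Prog Circuit

/-! ### Backtracking over all paths -/

section Enumeration

variable {n d N : ℕ} {A : Architecture n d} {p Q ε δ : ℝ} {c : Circuit A}
  {ρ : Fin n → QubitState} {ca : Fin N → ℝ} {O : Fin N → PauliString n}
  {cut : ℕ}

/-- A bound for the running time per leaf of the backtracking search. -/
def leafCost (cut : ℕ) : ℕ := simCost * (cut + 1) + 10

theorem Ready.writeBit {I M : Memory} {r sid : ℕ} {b : ℕ → Bool} {o : ℝ}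
    (h : Ready I cut r sid b o M) (t : ℕ) (x : Bool) :
    Ready I cut r sid (Function.update b t x) o (M.writeNat 14 t 0 0 x.toNat) := by
  obtain ⟨h, h'⟩ := h
  refine ⟨⟨fun a ha => ?_, h.inR, by simp [h.vcut], by simp [h.vobs], by simp [h.vsim],
    fun q => ?_, fun id hid k i => by simp [h.fresh id hid], h.out⟩, fun k i => by simp [h']⟩
  · rw [← h.inN a ha]
    funext i j k
    simp [show a ≠ 14 by omega]
  · by_cases hq : q = t
    · subst hq; simp
    · simp [hq, h.bits]

theorem Ready.writeTop {I M : Memory} {r sid : ℕ} {b : ℕ → Bool} {o : ℝ}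
    (h : Ready I cut r sid b o M) (t : ℕ) :
    Ready I cut r sid b o (M.writeNat 11 14 0 0 t) :=
  ⟨h.1.writeNat _ _ _ _ _ (by omega), fun k i => by simp [h.2]⟩

/-- The tree computed for the Pauli string with number `r`. -/
noncomputable def simTree (p : ℝ) (c : Circuit A) (ρ : Fin n → QubitState) (ca : Fin N → ℝ)
    (O : Fin N → PauliString n) (cut : ℕ) (r : Fin N) : Dec ℝ :=
  c.simTop p (bloch ρ) cut ((O r).support.sort (· ≤ ·)) (O r) (ca r)

/-- If the leftmost leaf of the subtree `τ` below the first `t` bits has been simulated, then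
the search visits the other leaves of `τ` and goes back to the root of `τ`. -/
theorem backLoop_subtree {r : Fin N} (τ : Dec ℝ) (t : ℕ) (b : ℕ → Bool) (sid : ℕ) (o : ℝ)
    (M : Memory) (hτ : ∀ b' : ℕ → Bool, (∀ q < t, b' q = b q) →
      (simTree p c ρ ca O cut r).run b' 0 = τ.run b' t)
    (hb : ∀ q, t ≤ q → b q = false)
    (hR : Ready (input p Q ε δ c ρ ca O) cut r sid b (o + (τ.run b t).1) M)
    (ht : M.nat 11 14 0 0 = (τ.run b t).2) (B : ℕ) (post : Memory → Prop)
    (hpost : ∀ sid' M', Ready (input p Q ε δ c ρ ca O) cut r sid' b (o + τ.sum id) M' →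
      M'.nat 11 14 0 0 = t → Exec backLoop M' B post) :
    Exec backLoop M ((τ.count - 1) * leafCost cut + B) post := by
  induction τ generalizing t b sid o M B with
  | ret v =>
    have := hpost sid M hR ht
    simpa [Dec.count, Dec.sum] using this
  | branch f ih =>
    obtain ⟨m, hm⟩ := Nat.exists_eq_add_of_le (f false).one_le_count
    obtain ⟨m', hm'⟩ := Nat.exists_eq_add_of_le (f true).one_le_count
    have hcount : (Dec.branch f).count = m + m' + 2 := by
      change (f false).count + (f true).count = _
      omega
    have hbt : b t = false := hb t le_rfl
    have hcost : ((f false).count - 1) * leafCost cut + (simCost * (cut + 1) + 2 +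
        (((f true).count - 1) * leafCost cut + (3 + B + 1)) + 1) ≤
        ((Dec.branch f).count - 1) * leafCost cut + B := by
      rw [hcount, hm, hm']
      have e : m + m' + 2 - 1 = m + m' + 1 := by omega
      rw [e, Nat.add_sub_cancel_left, Nat.add_sub_cancel_left, add_mul, add_mul]
      have : leafCost cut = simCost * (cut + 1) + 10 := rfl
      omega
    refine (ih false (t + 1) b sid o M ?_ (fun q hq => hb q (by omega)) ?_ ?_ _ ?_).mono hcost
      fun _ h => h
    · intro b' hb'
      rw [hτ b' fun q hq => hb' q (by omega), Dec.run, hb' t (Nat.lt_succ_self _), hbt]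
    · rwa [Dec.run, hbt] at hR
    · rwa [Dec.run, hbt] at ht
    intro sid1 M1 hR1 ht1
    -- The last bit is changed from `0` to `1`.
    have hbit : M1.nat 14 t 0 0 = 0 := by rw [hR1.1.bits, hbt]; rfl
    refine Exec.loop_step (by simp [Test.Holds, NExpr.eval, vTop, nv, ht1])
      ((Exec.cond_false (by simp [Test.Holds, NExpr.eval, vTop, nv, ht1, lastBit, bit, hbit])
        (Exec.seq (B := 1) (B' := simCost * (cut + 1)) (Exec.of_loopFree
          (P := .setNat 14 (.sub vTop (.lit 1)) (.lit 0) (.lit 0) (.lit 1)) trivial M1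
          ?_))).mono (by omega) fun _ h => h)
    have e : (Program.setNat 14 (.sub vTop (.lit 1)) (.lit 0) (.lit 0) (.lit 1)).apply M1 =
        M1.writeNat 14 t 0 0 true.toNat := by
      simp [Program.apply, vTop, nv, NExpr.eval, ht1]
    rw [e]
    refine (simulate_spec (hR1.writeBit t true)).mono le_rfl ?_
    rintro M2 ⟨hR2, ht2⟩
    have hrun := hτ (Function.update b t true) fun q hq => Function.update_of_ne hq.ne _ _
    rw [Dec.run, Function.update_self, simTree] at hrun
    rw [hrun] at hR2 ht2
    refine ih true (t + 1) (Function.update b t true) (sid1 + 1) (o + (f false).sum id) M2 ?_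
      (fun q hq => ?_) hR2 ht2 _ ?_
    · intro b' hb'
      rw [hτ b' fun q hq => by rw [hb' q (by omega), Function.update_of_ne hq.ne], Dec.run,
        hb' t (Nat.lt_succ_self _), Function.update_self]
    · rw [Function.update_of_ne (by omega), hb q (by omega)]
    intro sid3 M3 hR3 ht3
    -- The last bit is `1` and is dropped.
    have hbit3 : M3.nat 14 t 0 0 = 1 := by rw [hR3.1.bits, Function.update_self]; rfl
    refine Exec.loop_step (by simp [Test.Holds, NExpr.eval, vTop, nv, ht3])
      ((Exec.cond_true (by simp [Test.Holds, NExpr.eval, vTop, nv, ht3, lastBit, bit, hbit3])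
        (Exec.of_loopFree (P := .seq (.setNat 14 (.sub vTop (.lit 1)) (.lit 0) (.lit 0) (.lit 0))
          (setv 14 (.sub vTop (.lit 1)))) ⟨trivial, trivial⟩ M3 ?_)).mono
            (by simp [Program.size, setv]) fun _ h => h)
    have e3 : (Program.seq (.setNat 14 (.sub vTop (.lit 1)) (.lit 0) (.lit 0) (.lit 0))
          (setv 14 (.sub vTop (.lit 1)))).apply M3 =
        (M3.writeNat 14 t 0 0 false.toNat).writeNat 11 14 0 0 t := by
      simp [Program.apply, vTop, nv, NExpr.eval, ht3, setv]
    rw [e3]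
    refine hpost sid3 _ ?_ (by simp)
    have := (hR3.writeBit t false).writeTop t
    rw [Function.update_idem, Function.update_eq_self_iff.2 hbt.symm, add_assoc] at this
    exact this

theorem obsLoop_spec (rest : List (Fin N)) (r sid : ℕ) (o : ℝ) (M : Memory)
    (hr : (List.finRange N).drop r = rest)
    (hR : Ready (input p Q ε δ c ρ ca O) cut r sid (fun _ => false) o M) :
    Exec obsLoop M ((rest.map fun r => (simTree p c ρ ca O cut r).count).sum * leafCost cut + 1)
      fun M' => M'.output = o + (rest.map fun r => (simTree p c ρ ca O cut r).sum id).sum := by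
  have h02 : M.nat 0 2 0 0 = N := by rw [hR.1.inN 0 (by omega)]; rfl
  induction rest generalizing r sid o M with
  | nil =>
    have hle : N ≤ r := by simpa using List.drop_eq_nil_iff.1 hr
    refine (Exec.loop_done ?_ (by simpa [Memory.output] using hR.1.out)).mono (by omega)
      fun _ h => h
    simp only [Test.Holds, NExpr.eval, vObs, nv, hR.1.vobs, h02]
    omega
  | cons r' rest ih =>
    have hlt : r < (List.finRange N).length := by
      by_contra hcon
      rw [List.drop_eq_nil_of_le (not_lt.1 hcon)] at hr
      cases hr
    rw [List.drop_eq_getElem_cons hlt] at hr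
    obtain ⟨hi, hr'⟩ := List.cons.inj hr
    have hrr : (r' : ℕ) = r := by rw [← hi]; simp
    subst hrr
    obtain ⟨m, hm⟩ := Nat.exists_eq_add_of_le (simTree p c ρ ca O cut r').one_le_count
    refine (Exec.loop_step (B := simCost * (cut + 1) + (((simTree p c ρ ca O cut r').count - 1) *
      leafCost cut + 1 + 1)) ?_ (Exec.seq ((simulate_spec hR).mono le_rfl ?_))).mono
      (B' := ((r' :: rest).map fun r => (simTree p c ρ ca O cut r).count).sum * leafCost cut + 1)
      (B := simCost * (cut + 1) + (((simTree p c ρ ca O cut r').count - 1) *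
      leafCost cut + 1 + 1) + ((rest.map fun r => (simTree p c ρ ca O cut r).count).sum *
        leafCost cut + 1) + 1) ?_ fun _ h => h
    · simp only [Test.Holds, NExpr.eval, vObs, nv, hR.1.vobs, h02]
      omega
    · rintro M1 ⟨hR1, ht1⟩
      refine Exec.seq (backLoop_subtree (simTree p c ρ ca O cut r') 0 (fun _ => false) _ o M1
        (fun b' hb' => rfl) (fun _ _ => rfl) hR1 ht1 1 _ fun sid2 M2 hR2 ht2 => ?_)
      refine Exec.loop_done (by simp [Test.Holds, NExpr.eval, vTop, nv, ht2]) ?_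
      refine Exec.of_loopFree (P := setv 1 (.add vObs (.lit 1))) trivial M2 ?_
      have e : (setv 1 (.add vObs (.lit 1))).apply M2 = M2.writeNat 11 1 0 0 (r' + 1) := by
        simp [Program.apply, setv, vObs, nv, NExpr.eval, hR2.1.vobs]
      rw [e]
      have hR3 : Ready (input p Q ε δ c ρ ca O) cut (r' + 1) sid2 (fun _ => false)
          (o + (simTree p c ρ ca O cut r').sum id) (M2.writeNat 11 1 0 0 (r' + 1)) := by
        obtain ⟨h, h'⟩ := hR2
        refine ⟨⟨fun a ha => ?_, h.inR, by simp [h.vcut], by simp, by simp [h.vsim],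
          fun q => by simp [h.bits], fun id hid k i => by simp [h.fresh id hid], h.out⟩,
          fun k i => by simp [h']⟩
        rw [← h.inN a ha]
        funext i j k
        simp [show a ≠ 11 by omega]
      have := ih (r' + 1) sid2 _ _ hr' hR3 (by rw [hR3.1.inN 0 (by omega)]; rfl)
      rw [add_assoc, ← List.sum_cons, ← List.map_cons (f := fun r =>
        (simTree p c ρ ca O cut r).sum id)] at this
      exact this
    · rw [List.map_cons, List.sum_cons, add_mul, hm, Nat.add_sub_cancel_left, add_mul]
      have : leafCost cut = simCost * (cut + 1) + 10 := rfl
      omega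

/-- The loop stops at the minimal cut-off, and the memory is then ready for the first simulation. -/
theorem cutLoop_spec {M : Memory} (j : ℕ) (m : ℕ) (hm : m + j = cut)
    (hcut : ((1 - p) * (1 + Q)) ^ cut * (N + N) ≤ ε * δ)
    (hmin : ∀ m < cut, ¬ ((1 - p) * (1 + Q)) ^ m * (N + N) ≤ ε * δ)
    (hM : M = ((input p Q ε δ c ρ ca O).writeNat 11 0 0 0 m).writeReal 4 1 0 0
      (((1 - p) * (1 + Q)) ^ m)) :
    Exec cutLoop M (j * 3 + 1) fun M' =>
      Ready (input p Q ε δ c ρ ca O) cut 0 0 (fun _ => false) 0 M' := by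
  have hpar : M.real 1 = (input p Q ε δ c ρ ca O).real 1 := by rw [hM]; funext i j k; simp
  have h02 : M.nat 0 2 0 0 = N := by rw [hM]; rfl
  obtain ⟨h1, h2, h3, h4⟩ := input_real_params p Q ε δ c ρ ca O
  have h10 : M.real 4 1 0 0 = ((1 - p) * (1 + Q)) ^ m := by rw [hM]; simp
  have h11 : M.nat 11 0 0 0 = m := by rw [hM]; simp
  have htest : (Test.realLe (.mul (rv 1) (.add numObs numObs))
      (.mul (.get 1 (.lit 2) (.lit 0) (.lit 0)) (.get 1 (.lit 3) (.lit 0) (.lit 0)))).Holds M ↔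
      ((1 - p) * (1 + Q)) ^ m * (N + N) ≤ ε * δ := by
    simp [Test.Holds, RExpr.eval, NExpr.eval, rv, numObs, h10, h02, hpar, h3, h4]
  induction j generalizing m M with
  | zero =>
    obtain rfl : m = cut := by omega
    refine (Exec.loop_done (by rw [Test.Holds, htest]; exact not_not.2 hcut) ?_).mono (by omega)
      fun _ h => h
    subst hM
    refine ⟨⟨fun a ha => ?_, fun a ha ha' => ?_, by simp, rfl, rfl, fun q => rfl,
      fun id hid k i => rfl, rfl⟩, fun k i => rfl⟩
    · funext i j k
      simp [show a ≠ 11 by omega]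
    · funext i j k
      simp [show a ≠ 4 by omega]
  | succ j ih =>
    refine (Exec.loop_step (B := 2) (by rw [Test.Holds, htest]; exact hmin m (by omega))
      (Exec.of_loopFree (P := .seq (setr 1 (.mul (rv 1) rate)) (setv 0 (.add vCut (.lit 1))))
        ⟨trivial, trivial⟩ M ?_)).mono (B := 2 + (j * 3 + 1) + 1) (by omega) fun _ h => h
    have e : (Program.seq (setr 1 (.mul (rv 1) rate)) (setv 0 (.add vCut (.lit 1)))).apply M =
        ((input p Q ε δ c ρ ca O).writeNat 11 0 0 0 (m + 1)).writeReal 4 1 0 0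
          (((1 - p) * (1 + Q)) ^ (m + 1)) := by
      have : (Program.seq (setr 1 (.mul (rv 1) rate)) (setv 0 (.add vCut (.lit 1)))).apply M =
          (M.writeReal 4 1 0 0 (((1 - p) * (1 + Q)) ^ (m + 1))).writeNat 11 0 0 0 (m + 1) := by
        simp [Program.apply, setr, setv, rate, damp, vCut, nv, rv, NExpr.eval, RExpr.eval, h10, h11,
          hpar, h1, h2, pow_succ]
      rw [this, hM]
      ext a i j k
      · simp only [Memory.writeNat_nat, Memory.writeReal_nat]
        split_ifs <;> rfl
      · simp only [Memory.writeNat_real, Memory.writeReal_real]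
        split_ifs <;> rfl
    rw [e]
    exact ih (m + 1) (by omega) rfl (by funext i j k; simp) rfl (by simp) (by simp)
      (by simp [Test.Holds, RExpr.eval, NExpr.eval, rv, numObs, h3, h4]; rfl)

/-- A bound for the running time of the program per leaf and unit of weight. -/
def unitCost : ℕ := simCost + 13

theorem main_spec (hcut : ((1 - p) * (1 + Q)) ^ cut * (N + N) ≤ ε * δ)
    (hmin : ∀ m < cut, ¬ ((1 - p) * (1 + Q)) ^ m * (N + N) ≤ ε * δ) :
    Exec main (input p Q ε δ c ρ ca O)
      (unitCost * (cut + 1) * (1 + ∑ r, (simTree p c ρ ca O cut r).count)) fun M' =>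
        M'.output = ∑ r, (simTree p c ρ ca O cut r).sum id := by
  have hcost : 1 + ((cut * 3 + 1) + ((∑ r, (simTree p c ρ ca O cut r).count) * leafCost cut + 1)) ≤
      unitCost * (cut + 1) * (1 + ∑ r, (simTree p c ρ ca O cut r).count) := by
    generalize ∑ r, (simTree p c ρ ca O cut r).count = S
    have h1 : leafCost cut ≤ unitCost * (cut + 1) := by
      unfold leafCost unitCost; nlinarith
    have h2 : 1 + (cut * 3 + 1) + 1 ≤ unitCost * (cut + 1) := by
      unfold unitCost; nlinarith
    nlinarith
  refine (Exec.seq (B := 1) (Exec.of_loopFree (P := setr 1 (.ofNat (.lit 1))) trivial _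
    ?_)).mono hcost fun _ h => h
  refine Exec.seq ((cutLoop_spec (c := c) (ρ := ρ) (ca := ca) (O := O) cut 0 (zero_add _) hcut hmin
    ?_).mono le_rfl ?_)
  · ext a i j k
    · simp only [Program.apply, setr, Memory.writeReal_nat, Memory.writeNat_nat]
      split_ifs with h
      · obtain ⟨rfl, rfl, rfl, rfl⟩ := h; rfl
      · rfl
    · simp [Program.apply, setr, NExpr.eval, RExpr.eval]
  · intro M1 hR
    refine (obsLoop_spec _ 0 0 0 M1 rfl hR).mono ?_ ?_
    · rw [List.drop_zero, ← List.sum_ofFn, List.ofFn_eq_map]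
    · intro M2 h
      rw [h, List.drop_zero, zero_add, ← List.sum_ofFn, List.ofFn_eq_map]

end Enumeration

end PauliPath

namespace PauliPath
open Prog Circuit

/-! ### The coefficients of an observable are bounded by its norm -/

section Observable

variable {n N : ℕ}

/-- The diagonal entries are bounded by the operator norm. -/
theorem norm_trace_le_opNorm (M : Op n) : ‖M.trace‖ ≤ 2 ^ n * opNorm M := by
  have hentry : ∀ x : Basis n, ‖M x x‖ ≤ opNorm M := by
    intro x
    have h1 := (Matrix.toEuclideanCLM (𝕜 := ℂ) (n := Basis n) M).le_opNorm
      (EuclideanSpace.single x 1)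
    rw [PiLp.norm_single, norm_one, mul_one] at h1
    refine le_trans ?_ h1
    refine le_trans (le_of_eq ?_) (PiLp.norm_apply_le _ x)
    simp
  calc ‖M.trace‖ ≤ ∑ x : Basis n, ‖M x x‖ := norm_sum_le _ _
    _ ≤ ∑ _x : Basis n, opNorm M := Finset.sum_le_sum fun x _ => hentry x
    _ = 2 ^ n * opNorm M := by simp

theorem opNorm_op_mul_le (s : PauliString n) (M : Op n) : opNorm (s.op * M) ≤ opNorm M := by
  have hs : Matrix.toEuclideanCLM (𝕜 := ℂ) (n := Basis n) s.op ∈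
      unitary (EuclideanSpace ℂ (Basis n) →L[ℂ] EuclideanSpace ℂ (Basis n)) := by
    have h : star s.op * s.op = 1 := by
      rw [Matrix.star_eq_conjTranspose, PauliString.op_conjTranspose, PauliString.op_mul_self]
    have h' : s.op * star s.op = 1 := by
      rw [Matrix.star_eq_conjTranspose, PauliString.op_conjTranspose, PauliString.op_mul_self]
    rw [Unitary.mem_iff, ← map_star, ← map_mul, ← map_mul, h, h', map_one]
    exact ⟨rfl, rfl⟩
  rw [opNorm, map_mul]
  exact (CStarRing.norm_mem_unitary_mul _ hs).le

/-- The coefficient of the Pauli string `s` in an observable, in which Pauli strings may be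
repeated. -/
def coeff (a : Fin N → ℝ) (O : Fin N → PauliString n) (s : PauliString n) : ℝ :=
  ∑ r with O r = s, a r

/-- Repeated Pauli strings are collected; the norm of the observable bounds only the collected
coefficients. -/
theorem sum_mul_eq (a : Fin N → ℝ) (O : Fin N → PauliString n) (g : PauliString n → ℂ) :
    ∑ r, (a r : ℂ) * g (O r) = ∑ s ∈ Finset.univ.image O, (coeff a O s : ℂ) * g s := by
  rw [← Finset.sum_fiberwise_of_maps_to (t := Finset.univ.image O)
    (fun r _ => Finset.mem_image_of_mem O (Finset.mem_univ r))]
  refine Finset.sum_congr rfl fun s _ => ?_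
  rw [coeff, Complex.ofReal_sum, Finset.sum_mul]
  refine Finset.sum_congr rfl fun r hr => ?_
  rw [(Finset.mem_filter.1 hr).2]

/-- The coefficient of `s` is the normalized trace of the observable times the unitary `s`. -/
theorem abs_coeff_le (a : Fin N → ℝ) (O : Fin N → PauliString n) (s : PauliString n) :
    |coeff a O s| ≤ opNorm (observable a O) := by
  have h : (s.op * observable a O).trace = 2 ^ n * (coeff a O s : ℂ) := by
    rw [observable, Finset.mul_sum, trace_sum, coeff, Complex.ofReal_sum, Finset.mul_sum,
      Finset.sum_filter]
    refine Finset.sum_congr rfl fun r _ => ?_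
    rw [mul_smul_comm, trace_smul, PauliString.trace_op_mul, smul_eq_mul]
    by_cases h : s = O r
    · rw [if_pos h, if_pos h.symm, mul_comm]
    · rw [if_neg h, if_neg (Ne.symm h), mul_zero]
  have h1 := (norm_trace_le_opNorm (s.op * observable a O)).trans
    (mul_le_mul_of_nonneg_left (opNorm_op_mul_le s _) (by positivity))
  rw [h, norm_mul, norm_pow, Complex.norm_real, Real.norm_eq_abs] at h1
  norm_num at h1
  exact h1

end Observable

/-! ### Expectation of the error and of the running time -/

section Average

variable {n d N : ℕ} {A : Architecture n d} {p Q : ℝ} {μ : PMF (Circuit A)}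

theorem expect_branchSum_top_le (hμ : IsRandomModel Q μ) {x y : ℝ≥0∞} (hx : x ≤ 1)
    (hy : y = 0 ∨ x = 1 ∧ y = 1) (s : PauliString n) (w : ℕ) :
    expect μ (fun c => c.branchSum x y d le_rfl s w) ≤ (x * (1 + ENNReal.ofReal Q)) ^ w := by
  have := expect_branchSum_le hμ hx hy d le_rfl (fun _ => 1) (fun _ _ _ _ => rfl) s w
  simpa only [one_mul, expect_const, mul_one] using this

theorem enorm_error_le (h0 : 0 ≤ p) (h1 : p ≤ 1) (c : Circuit A) (ρ : Fin n → QubitState)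
    (a : Fin N → ℝ) (O : Fin N → PauliString n) (l : ℕ) :
    ‖c.truncatedValue p (productState ρ) (observable a O) l -
      c.noisyValue p (productState ρ) (observable a O)‖ₑ ≤
    ENNReal.ofReal (opNorm (observable a O)) * ∑ s ∈ Finset.univ.image O,
      c.branchSum (ENNReal.ofReal (1 - p)) 0 d le_rfl s l := by
  rw [truncatedValue_eq, noisyValue_eq, ← Finset.sum_sub_distrib]
  simp only [← mul_sub]
  rw [sum_mul_eq a O fun s => c.trunc p (productState ρ) d s l -
    (s.op * c.state p (productState ρ) d).trace, Finset.mul_sum]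
  refine (enorm_sum_le _ _).trans (Finset.sum_le_sum fun s _ => ?_)
  rw [enorm_mul, enorm_sub_rev]
  refine mul_le_mul' ?_ (enorm_sub_trunc_le c h0 h1 (posSemidef_productState ρ)
    (trace_productState ρ) d le_rfl s l)
  rw [← ofReal_norm, Complex.norm_real, Real.norm_eq_abs]
  exact ENNReal.ofReal_le_ofReal (abs_coeff_le a O s)

theorem expect_error_le (hμ : IsRandomModel Q μ) (hQ : 0 ≤ Q) (h0 : 0 ≤ p) (h1 : p ≤ 1)
    (ρ : Fin n → QubitState) (a : Fin N → ℝ) (O : Fin N → PauliString n) (l : ℕ) :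
    expect μ (fun c => ‖c.truncatedValue p (productState ρ) (observable a O) l -
      c.noisyValue p (productState ρ) (observable a O)‖ₑ) ≤
    ENNReal.ofReal (opNorm (observable a O) * (N * ((1 - p) * (1 + Q)) ^ l)) := by
  have hn : 0 ≤ opNorm (observable a O) := norm_nonneg _
  refine (expect_mono μ fun c => enorm_error_le h0 h1 c ρ a O l).trans ?_
  rw [expect_const_mul, expect_sum, ENNReal.ofReal_mul hn]
  refine mul_le_mul' le_rfl ?_
  refine (Finset.sum_le_sum fun s _ => expect_branchSum_top_le hμ
    (ENNReal.ofReal_le_one.2 (by linarith)) (Or.inl rfl) s l).trans ?_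
  rw [Finset.sum_const, nsmul_eq_mul, ENNReal.ofReal_mul (Nat.cast_nonneg _),
    ENNReal.ofReal_natCast, ENNReal.ofReal_pow (mul_nonneg (by linarith) (by linarith)),
    ENNReal.ofReal_mul (by linarith), ENNReal.ofReal_add zero_le_one hQ, ENNReal.ofReal_one]
  refine mul_le_mul' ?_ le_rfl
  exact_mod_cast Finset.card_image_le.trans (by simp)

theorem expect_time_le (hμ : IsRandomModel Q μ) (hQ : 0 ≤ Q) (p : ℝ) (ρ : Fin n → QubitState)
    (a : Fin N → ℝ) (O : Fin N → PauliString n) (l : ℕ) :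
    expect μ (fun c => ((unitCost * (l + 1) * (1 + ∑ r, (simTree p c ρ a O l r).count) : ℕ) : ℝ≥0∞))
      ≤ ENNReal.ofReal (unitCost * (l + 1) * (1 + N * (1 + Q) ^ l)) := by
  have h : ∀ c : Circuit A,
      ((unitCost * (l + 1) * (1 + ∑ r, (simTree p c ρ a O l r).count) : ℕ) : ℝ≥0∞) ≤
      ((unitCost * (l + 1) : ℕ) : ℝ≥0∞) * (1 + ∑ r, c.branchSum 1 1 d le_rfl (O r) l) := by
    intro c
    push_cast
    gcongr with r
    exact count_simTop_le c p _ l ⟨Finset.sort_nodup _ _, fun i => by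
      rw [Finset.mem_sort, PauliString.mem_support]⟩ _
  refine (expect_mono μ h).trans ?_
  rw [expect_const_mul, expect_add, expect_const, expect_sum]
  have h2 : (∑ r, expect μ fun c => c.branchSum 1 1 d le_rfl (O r) l) ≤
      (N : ℝ≥0∞) * (1 + ENNReal.ofReal Q) ^ l := by
    refine (Finset.sum_le_sum fun r _ => expect_branchSum_top_le hμ le_rfl
      (Or.inr ⟨rfl, rfl⟩) (O r) l).trans ?_
    simp
  refine (mul_le_mul' le_rfl (add_le_add le_rfl h2)).trans (le_of_eq ?_)
  rw [ENNReal.ofReal_mul (p := unitCost * ((l : ℝ) + 1)) (by positivity),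
    ENNReal.ofReal_add zero_le_one (by positivity),
    ENNReal.ofReal_mul (p := (N : ℝ)) (by positivity), ENNReal.ofReal_pow (by linarith),
    ENNReal.ofReal_add zero_le_one hQ, ENNReal.ofReal_one, ENNReal.ofReal_natCast]
  congr 1
  rw [← ENNReal.ofReal_natCast]
  push_cast
  rfl

/-- Markov's inequality in the form in which it is used here. -/
theorem one_sub_le_measure {S : Set (Circuit A)} {F : Circuit A → ℝ≥0∞} {δ : ℝ}
    (hF : ∀ c, c ∉ S → 1 ≤ F c) (hE : expect μ F ≤ ENNReal.ofReal δ) (hδ : 0 ≤ δ) :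
    ENNReal.ofReal (1 - δ) ≤ μ.toOuterMeasure S := by
  have h1 : (1 : ℝ≥0∞) ≤ μ.toOuterMeasure S + expect μ F := by
    rw [← expect_const μ 1, PMF.toOuterMeasure_apply]
    rw [expect, expect, ← ENNReal.tsum_add]
    refine ENNReal.tsum_le_tsum fun c => ?_
    by_cases hc : c ∈ S
    · rw [Set.indicator_of_mem hc, mul_one]
      exact le_self_add
    · rw [Set.indicator_of_notMem hc, zero_add]
      exact mul_le_mul' le_rfl (hF c hc)
  rw [ENNReal.ofReal_sub _ hδ, ENNReal.ofReal_one, tsub_le_iff_right]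
  exact h1.trans (add_le_add le_rfl hE)

end Average

/-! ### Estimates for the cut-off -/

section Estimates

/-- If `ℓ` is minimal and positive then `r^(ℓ-1)` exceeds `ε δ / (2 N)`; raising this to the power
`β` with `r^β ≤ 1/2` turns it into a bound for `2^ℓ`. -/
theorem two_pow_cut_le {r y N ε δ : ℝ} (hr0 : 0 ≤ r) {β : ℕ} (hβ : r ^ β < 1 / 2) {l : ℕ}
    (hmin : ∀ m < l, ¬ r ^ m * (N + N) ≤ ε * δ) (hy : 1 ≤ y) (hN : N ≤ y)
    (hε : 0 < ε) (hδ : 0 < δ) (hε' : 1 / ε ≤ y) (hδ' : 1 / δ ≤ y) :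
    (2 : ℝ) ^ l ≤ 2 ^ (β + 1) * y ^ (3 * β) := by
  cases l with
  | zero =>
    rw [pow_zero]
    exact one_le_mul_of_one_le_of_one_le (one_le_pow₀ one_le_two) (one_le_pow₀ hy)
  | succ m =>
    have h := not_le.1 (hmin m (Nat.lt_succ_self m))
    have h1 : 1 ≤ r ^ m * (2 * y ^ 3) := by
      have e : 1 = (ε * δ) * ((1 / ε) * (1 / δ)) := by field_simp
      calc (1 : ℝ) = (ε * δ) * ((1 / ε) * (1 / δ)) := e
        _ ≤ (r ^ m * (N + N)) * ((1 / ε) * (1 / δ)) := by gcongr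
        _ ≤ (r ^ m * (y + y)) * (y * y) := by gcongr
        _ = r ^ m * (2 * y ^ 3) := by ring
    have h2 : 1 ≤ (r ^ m * (2 * y ^ 3)) ^ β := one_le_pow₀ h1
    have h3 : (r ^ m) ^ β ≤ (1 / 2) ^ m := by
      rw [← pow_mul, mul_comm, pow_mul]
      exact pow_le_pow_left₀ (pow_nonneg hr0 _) hβ.le m
    have h4 : (1 : ℝ) ≤ (1 / 2) ^ m * (2 ^ β * y ^ (3 * β)) := by
      refine h2.trans ?_
      rw [mul_pow _ _ β, mul_pow _ _ β, ← pow_mul y]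
      gcongr
    calc (2 : ℝ) ^ (m + 1) = 2 * 2 ^ m * 1 := by ring
      _ ≤ 2 * 2 ^ m * ((1 / 2) ^ m * (2 ^ β * y ^ (3 * β))) := by gcongr
      _ = (2 * (1 / 2)) ^ m * (2 ^ (β + 1) * y ^ (3 * β)) := by rw [mul_pow]; ring
      _ = 2 ^ (β + 1) * y ^ (3 * β) := by norm_num

theorem poly_bound {r y N ε δ Q : ℝ} (hr0 : 0 ≤ r) {β : ℕ} (hβ : r ^ β < 1 / 2) {l : ℕ}
    (hmin : ∀ m < l, ¬ r ^ m * (N + N) ≤ ε * δ) (hy : 1 ≤ y) (hN0 : 0 ≤ N) (hN : N ≤ y)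
    (hε : 0 < ε) (hδ : 0 < δ) (hε' : 1 / ε ≤ y) (hδ' : 1 / δ ≤ y) (hQ : 0 ≤ Q) (hQ1 : Q ≤ 1)
    (U : ℕ) :
    U * (l + 1) * (1 + N * (1 + Q) ^ l) * (2 / δ) ≤
      ((4 * U * (2 ^ (β + 1)) ^ 2 + (6 * β + 2) : ℕ) : ℝ) *
        y ^ (4 * U * (2 ^ (β + 1)) ^ 2 + (6 * β + 2)) := by
  have h := two_pow_cut_le hr0 hβ hmin hy hN hε hδ hε' hδ'
  set Z : ℝ := 2 ^ (β + 1) * y ^ (3 * β) with hZ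
  have hZ1 : 1 ≤ Z := (one_le_pow₀ one_le_two).trans h
  have hl : (l : ℝ) + 1 ≤ Z := by
    refine le_trans ?_ h
    exact_mod_cast Nat.lt_two_pow_self (n := l)
  have hQl : (1 + Q) ^ l ≤ Z := (pow_le_pow_left₀ (by linarith) (by linarith) l).trans h
  have h5 : 2 / δ ≤ 2 * y := by
    rw [div_eq_mul_one_div]; gcongr
  calc U * (l + 1) * (1 + N * (1 + Q) ^ l) * (2 / δ) ≤ U * Z * (1 + y * Z) * (2 * y) := by gcongr
    _ ≤ U * Z * (y * Z + y * Z) * (2 * y) := by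
      gcongr
      exact one_le_mul_of_one_le_of_one_le hy hZ1
    _ = ((4 * U * (2 ^ (β + 1)) ^ 2 : ℕ) : ℝ) * y ^ (6 * β + 2) := by
      rw [hZ]; push_cast; ring
    _ ≤ _ := by
      exact mul_le_mul (Nat.cast_le.2 (Nat.le_add_right _ _))
        (pow_le_pow_right₀ hy (Nat.le_add_left _ _)) (by positivity) (by positivity)

/-- The exponent comes from `(1 + Q)^ℓ ≤ exp (Q ℓ)` and `ℓ - 1 ≤ log W / (p - Q)`. -/
theorem average_bound {p Q ε δ n N d : ℝ} (hQ : 0 ≤ Q) (hQ1 : Q ≤ 1) (hp : p ≤ 1) (hQp : Q < p)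
    (hn : 2 ≤ n) (hd : 1 ≤ d) (hN : 1 ≤ N) (hε : 0 < ε) (hε1 : ε ≤ 1) (hδ : 0 < δ) (hδ1 : δ < 1)
    {l : ℕ} (hmin : ∀ m < l, ¬ ((1 - p) * (1 + Q)) ^ m * (N + N) ≤ ε * δ) {U : ℝ} (hU : 0 ≤ U) :
    U * (l + 1) * (1 + N * (1 + Q) ^ l) ≤ 20 * U *
      (N * ((n * N * d / (ε * δ)) ^ (Q / (p - Q)) *
        (Real.log (n * N * d / (δ * ε)) / (p - Q)))) := by
  rw [mul_comm δ ε]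
  have hεδ : 0 < ε * δ := mul_pos hε hδ
  have hεδ1 : ε * δ ≤ 1 := mul_le_one₀ hε1 hδ.le hδ1.le
  set W := n * N * d / (ε * δ) with hW
  have hθ : 0 < p - Q := by linarith
  have hW2N : (N + N) / (ε * δ) ≤ W := by
    rw [hW]
    gcongr
    have : N + N ≤ n * N := by nlinarith
    nlinarith
  have hW2 : 2 ≤ W := by
    refine le_trans ?_ hW2N
    rw [le_div_iff₀ hεδ]
    nlinarith
  have hW0 : 0 < W := by linarith
  have hlog : 1 / 2 ≤ Real.log W := by
    have h1 := Real.log_le_log (by norm_num) hW2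
    have h2 := Real.log_two_gt_d9
    linarith
  have hα : 0 ≤ Q / (p - Q) := by positivity
  have hWα : 1 ≤ W ^ (Q / (p - Q)) := Real.one_le_rpow (by linarith) hα
  -- The last power of the rate above the threshold bounds the cut-off.
  have key : ∀ m : ℕ, l = m + 1 → (p - Q) * m ≤ Real.log W := by
    intro m hm
    have h := not_le.1 (hmin m (by omega))
    have h1 : ((1 - p) * (1 + Q)) ^ m ≤ Real.exp (-((p - Q) * m)) := by
      have : -((p - Q) * m) = m * (-(p - Q)) := by ring
      rw [this, Real.exp_nat_mul]
      refine pow_le_pow_left₀ (mul_nonneg (by linarith) (by linarith)) ?_ m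
      have := Real.add_one_le_exp (-(p - Q))
      nlinarith
    have h2 : Real.exp ((p - Q) * m) ≤ W := by
      refine le_trans ?_ hW2N
      rw [le_div_iff₀ hεδ]
      calc Real.exp ((p - Q) * m) * (ε * δ) ≤ Real.exp ((p - Q) * m) *
            (Real.exp (-((p - Q) * m)) * (N + N)) := by
            refine mul_le_mul_of_nonneg_left (h.le.trans ?_) (Real.exp_pos _).le
            gcongr
        _ = N + N := by rw [← mul_assoc, ← Real.exp_add, add_neg_cancel, Real.exp_zero, one_mul]
    rwa [Real.le_log_iff_exp_le hW0]
  have hQl : (1 + Q) ^ l ≤ 2 * W ^ (Q / (p - Q)) := by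
    cases l with
    | zero => rw [pow_zero]; linarith
    | succ m =>
      have h1 := key m rfl
      have h2 : (1 + Q) ^ m ≤ W ^ (Q / (p - Q)) := by
        rw [Real.rpow_def_of_pos hW0]
        calc (1 + Q) ^ m ≤ (Real.exp Q) ^ m :=
              pow_le_pow_left₀ (by linarith) (by have := Real.add_one_le_exp Q; linarith) m
          _ = Real.exp (m * Q) := (Real.exp_nat_mul _ _).symm
          _ ≤ _ := by
            refine Real.exp_le_exp.2 ?_
            rw [mul_div_assoc', le_div_iff₀ hθ]
            nlinarith
      rw [pow_succ]
      nlinarith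
  have hl : (l : ℝ) + 1 ≤ 5 * (Real.log W / (p - Q)) := by
    rw [mul_div_assoc', le_div_iff₀ hθ]
    have hθ1 : p - Q ≤ 1 := by linarith
    cases l with
    | zero => push_cast; nlinarith
    | succ m =>
      have h1 := key m rfl
      push_cast
      nlinarith
  have hN' : 1 + N * (1 + Q) ^ l ≤ 2 * N * (2 * W ^ (Q / (p - Q))) := by
    have : 1 ≤ N * (1 + Q) ^ l := one_le_mul_of_one_le_of_one_le hN (one_le_pow₀ (by linarith))
    nlinarith
  calc U * (l + 1) * (1 + N * (1 + Q) ^ l) ≤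
      U * (5 * (Real.log W / (p - Q))) * (2 * N * (2 * W ^ (Q / (p - Q)))) := by gcongr
    _ = _ := by ring

theorem isTheta_threshold : (fun Q : ℝ => 1 - 1 / (1 + Q)) =Θ[𝓝[>] 0] fun Q : ℝ => Q := by
  have hev : ∀ᶠ Q : ℝ in 𝓝[>] 0, 0 < Q ∧ Q < 1 := Ioo_mem_nhdsGT one_pos
  constructor
  · refine Asymptotics.IsBigO.of_bound 1 (hev.mono fun Q hQ => ?_)
    have e : 1 - 1 / (1 + Q) = Q / (1 + Q) := by
      have := hQ.1
      field_simp
      ring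
    rw [e, Real.norm_of_nonneg (by have := hQ.1; positivity), Real.norm_of_nonneg hQ.1.le, one_mul]
    exact div_le_self hQ.1.le (by linarith [hQ.1])
  · refine Asymptotics.IsBigO.of_bound 2 (hev.mono fun Q hQ => ?_)
    have e : 1 - 1 / (1 + Q) = Q / (1 + Q) := by
      have := hQ.1
      field_simp
      ring
    rw [e, Real.norm_of_nonneg hQ.1.le, Real.norm_of_nonneg (by have := hQ.1; positivity),
      mul_div_assoc', le_div_iff₀ (by linarith [hQ.1])]
    nlinarith [hQ.1, hQ.2]

end Estimates

end PauliPath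

theorem theorem4p1 :
    ((fun Q : ℝ => 1 - 1 / (1 + Q)) =Θ[𝓝[>] 0] fun Q : ℝ => Q) ∧
    ∃ (prog : Program) (C : ℝ),
      ∀ Q p : ℝ, 0 ≤ Q → Q ≤ 1 → 1 - 1 / (1 + Q) < p → p ≤ 1 →
      ∃ K : ℕ,
        ∀ (n d : ℕ) (A : Architecture n d) (μ : PMF (Circuit A)), IsRandomModel Q μ →
        ∀ (ρ : Fin n → QubitState) (N : ℕ) (a : Fin N → ℝ) (O : Fin N → PauliString n)
          (ε δ : ℝ), 0 < ε → 0 < δ → δ < 1 →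
        ∃ (l : ℕ) (out : Circuit A → ℝ) (time : Circuit A → ℕ),
          -- on every circuit the algorithm halts and returns a truncated Pauli-path sum
          (∀ c, ∃ s, Runs prog (input p Q ε δ c ρ a O) s (time c) ∧ s.output = out c ∧
            (out c : ℂ) = c.truncatedValue p (productState ρ) (observable a O) l) ∧
          -- with probability at least `1 - δ` it succeeds within polynomial time
          ENNReal.ofReal (1 - δ) ≤ μ.toOuterMeasure
            {c | ‖(out c : ℂ) - c.noisyValue p (productState ρ) (observable a O)‖
                  ≤ ε * opNorm (observable a O) ∧
                (time c : ℝ) ≤ K * (n + N + 1 / ε + 1 / δ) ^ K} ∧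
          -- bound on the average running time
          (Q < p → 2 ≤ n → 1 ≤ d → 1 ≤ N → ε ≤ 1 →
            ∑' c, μ c * (time c : ℝ≥0∞) ≤ ENNReal.ofReal
              (C * (N * ((n * N * d / (ε * δ)) ^ (Q / (p - Q)) *
                (Real.log (n * N * d / (δ * ε)) / (p - Q)))))) := by
  refine ⟨isTheta_threshold, Prog.main, 20 * unitCost, fun Q p hQ hQ1 hpQ hp => ?_⟩
  have hr0 : 0 ≤ (1 - p) * (1 + Q) := mul_nonneg (by linarith) (by linarith)
  have hr1 : (1 - p) * (1 + Q) < 1 := by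
    have h : 1 - p < 1 / (1 + Q) := by linarith
    rwa [lt_div_iff₀ (by linarith)] at h
  have hp0 : 0 ≤ p := by
    have h : 1 / (1 + Q) ≤ 1 := by
      rw [div_le_one (by linarith)]; linarith
    linarith
  obtain ⟨β, hβ⟩ := exists_pow_lt_of_lt_one (show (0 : ℝ) < 1 / 2 by norm_num) hr1
  refine ⟨4 * unitCost * (2 ^ (β + 1)) ^ 2 + (6 * β + 2),
    fun n d A μ hμ ρ N a O ε δ hε hδ hδ1 => ?_⟩
  -- The cut-off is the first level at which the expected error is small enough.
  have hex : ∃ l : ℕ, ((1 - p) * (1 + Q)) ^ l * (N + N : ℝ) ≤ ε * δ := by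
    obtain ⟨l, hl⟩ := exists_pow_lt_of_lt_one
      (show (0 : ℝ) < ε * δ / (N + N + 1) by positivity) hr1
    refine ⟨l, ?_⟩
    rw [lt_div_iff₀ (by positivity)] at hl
    have := pow_nonneg hr0 l
    nlinarith
  classical
  obtain ⟨l, hcut, hmin⟩ : ∃ l : ℕ, ((1 - p) * (1 + Q)) ^ l * (N + N : ℝ) ≤ ε * δ ∧
      ∀ m < l, ¬ ((1 - p) * (1 + Q)) ^ m * (N + N : ℝ) ≤ ε * δ :=
    ⟨Nat.find hex, Nat.find_spec hex, fun m hm => Nat.find_min hex hm⟩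
  choose fin time hrun htime hout using fun c : Circuit A =>
    main_spec (p := p) (Q := Q) (ε := ε) (δ := δ) (c := c) (ρ := ρ) (ca := a) (O := O) hcut hmin
  have hval : ∀ c : Circuit A, (((fin c).output : ℝ) : ℂ) =
      c.truncatedValue p (productState ρ) (observable a O) l := by
    intro c
    rw [hout, c.truncatedValue_eq, Complex.ofReal_sum]
    refine Finset.sum_congr rfl fun r _ => ?_
    exact c.sum_simTop p ρ l ⟨Finset.sort_nodup _ _, fun i => by
      rw [Finset.mem_sort, PauliString.mem_support]⟩ (a r)
  have hET : Circuit.expect μ (fun c => (time c : ℝ≥0∞)) ≤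
      ENNReal.ofReal (unitCost * (l + 1) * (1 + N * (1 + Q) ^ l)) :=
    (Circuit.expect_mono μ fun c => Nat.cast_le.2 (htime c)).trans (expect_time_le hμ hQ p ρ a O l)
  refine ⟨l, fun c => (fin c).output, time, fun c => ⟨fin c, hrun c, rfl, hval c⟩, ?_, ?_⟩
  · simp only [hval]
    set B : ℝ := unitCost * (l + 1) * (1 + N * (1 + Q) ^ l) with hB
    have hU : 0 < unitCost := Nat.succ_pos _
    have hBpos : 0 < B := by positivity
    have hy : 1 ≤ (n + N + 1 / ε + 1 / δ : ℝ) := by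
      have h1 : 1 ≤ 1 / δ := by rw [le_div_iff₀ hδ]; linarith
      have h2 : 0 < 1 / ε := by positivity
      have h3 : (0 : ℝ) ≤ n := Nat.cast_nonneg _
      have h4 : (0 : ℝ) ≤ N := Nat.cast_nonneg _
      linarith
    have hpoly := poly_bound (y := n + N + 1 / ε + 1 / δ) hr0 hβ hmin hy (Nat.cast_nonneg N)
      (by have : 0 < 1 / ε := by positivity
          have : 0 < 1 / δ := by positivity
          have : (0 : ℝ) ≤ n := Nat.cast_nonneg _
          linarith) hε hδ
      (by have : 0 < 1 / δ := by positivity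
          have : (0 : ℝ) ≤ n := Nat.cast_nonneg _
          have : (0 : ℝ) ≤ N := Nat.cast_nonneg _
          linarith)
      (by have : 0 < 1 / ε := by positivity
          have : (0 : ℝ) ≤ n := Nat.cast_nonneg _
          have : (0 : ℝ) ≤ N := Nat.cast_nonneg _
          linarith) hQ hQ1 unitCost
    rw [← hB] at hpoly
    have hEE := expect_error_le hμ hQ hp0 hp ρ a O l
    set X := opNorm (observable a O) with hX
    have hX0 : 0 ≤ X := norm_nonneg _
    -- Half of `δ` is spent on the error and half on the running time.
    refine one_sub_le_measure (F := fun c =>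
      (if ‖c.truncatedValue p (productState ρ) (observable a O) l -
        c.noisyValue p (productState ρ) (observable a O)‖ ≤ ε * X then 0 else 1) +
      (ENNReal.ofReal (B * (2 / δ)))⁻¹ * (time c : ℝ≥0∞)) (fun c hc => ?_) ?_ hδ.le
    · by_cases h1 : ‖c.truncatedValue p (productState ρ) (observable a O) l -
        c.noisyValue p (productState ρ) (observable a O)‖ ≤ ε * X
      · have h2 : B * (2 / δ) < time c := by
          by_contra h2
          exact hc ⟨h1, (not_lt.1 h2).trans hpoly⟩
        rw [if_pos h1, zero_add, mul_comm, ← div_eq_mul_inv, ENNReal.le_div_iff_mul_le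
          (Or.inl (by simp; positivity)) (Or.inl ENNReal.ofReal_ne_top), one_mul,
          ← ENNReal.ofReal_natCast]
        exact ENNReal.ofReal_le_ofReal h2.le
      · rw [if_neg h1]
        exact le_self_add
    · rw [Circuit.expect_add, Circuit.expect_const_mul, show δ = δ / 2 + δ / 2 by ring,
        ENNReal.ofReal_add (by positivity) (by positivity)]
      refine add_le_add ?_ ?_
      -- Markov's inequality needs a positive threshold; if the observable vanishes, so does the
      -- error on every circuit.
      · rcases hX0.eq_or_lt with h0 | h0
        · have hz : ∀ c : Circuit A, ‖c.truncatedValue p (productState ρ) (observable a O) l -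
              c.noisyValue p (productState ρ) (observable a O)‖ ≤ ε * X := by
            intro c
            have := enorm_error_le hp0 hp c ρ a O l
            rw [← hX, ← h0, ENNReal.ofReal_zero, zero_mul, nonpos_iff_eq_zero,
              enorm_eq_zero] at this
            rw [this, norm_zero, ← h0, mul_zero]
          simp only [hz, if_true]
          simp [Circuit.expect]
        · have hεX : 0 < ε * X := mul_pos hε h0
          refine (Circuit.expect_mono μ (G := fun c => (ENNReal.ofReal (ε * X))⁻¹ *
            ‖c.truncatedValue p (productState ρ) (observable a O) l -
              c.noisyValue p (productState ρ) (observable a O)‖ₑ) fun c => ?_).trans ?_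
          · split_ifs with h1
            · exact zero_le
            · rw [mul_comm, ← div_eq_mul_inv, ENNReal.le_div_iff_mul_le
                (Or.inl (by simpa using hεX)) (Or.inl ENNReal.ofReal_ne_top), one_mul,
                ← ofReal_norm]
              exact ENNReal.ofReal_le_ofReal (not_le.1 h1).le
          · rw [Circuit.expect_const_mul, mul_comm, ← div_eq_mul_inv]
            refine ENNReal.div_le_of_le_mul (hEE.trans ?_)
            rw [← ENNReal.ofReal_mul (by positivity)]
            refine ENNReal.ofReal_le_ofReal ?_
            nlinarith
      · rw [mul_comm, ← div_eq_mul_inv]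
        refine ENNReal.div_le_of_le_mul (hET.trans (le_of_eq ?_))
        rw [← ENNReal.ofReal_mul (by positivity)]
        congr 1
        field_simp
        norm_num
  · intro hQp hn hd hN hε1
    exact hET.trans (ENNReal.ofReal_le_ofReal (average_bound (n := n) (N := N) (d := d)
      hQ hQ1 hp hQp
      (by exact_mod_cast hn)
      (by exact_mod_cast hd) (by exact_mod_cast hN) hε hε1 hδ hδ1 hmin (Nat.cast_nonneg _)))
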